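/- Let $A\in\mathbb R^{n\times n}$, $B\in\mathbb R^{n\times d}$, let $S\in\mathbb R^{n\times n}$ and $R\in\mathbb R^{d\times d}$ be symmetric positive definite, $\gamma\in(0,1)$, $\sigma>0$, and let $\omega_t\sim N(0,D_\omega)$, $\eta_t\sim N(0,\sigma^2 I_d)$ ($t\ge 0$) be jointly independent, where $D_\omega$ is positive semidefinite and the covariance matrix $D_{\widetilde\omega}=\sigma^2BB^\top+D_\omega$ of $\widetilde\omega_t=B\eta_t+\omega_t$ is positive definite. For a policy $K\in\mathbb R^{d\times n}$ and an initial state $x_0$ put $$u_t=Kx_t+\eta_t,\qquad x_{t+1}=Ax_t+Bu_t+\omega_t,\qquad c_t=x_t^\top Sx_t+u_t^\top Ru_t,$$ $$J(K)=\sum_{t\ge 0}\gamma^t\,\mathbb E[x_t^\top(S+K^\top RK)x_t]+\frac{\sigma^2\operatorname{Tr}R}{1-\gamma}\quad(x_0=0),\qquad V_K(x)=\mathbb E\Big[\sum_{t\ge 0}\gamma^tc_t\,\Big|\,x_0=x\Big].$$ Here $\|\cdot\|_2$ is the spectral norm, $\|\cdot\|_F$ the Frobenius norm, $\rho(\cdot)$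 the spectral radius and $\sigma_{\min}(\cdot)$ the smallest singular value. Let $K$ be stable, that is $\rho(A+BK)<1$, let $\rho\in(\rho(A+BK),1)$, and let $\Gamma_K>0$ satisfy $\|(A+BK)^k\|_2\le\Gamma_K\rho^k$ for all $k\ge 1$. Let $\widetilde V(x)=\theta_0+x^\top\Theta x$ with $\theta_0\in\mathbb R$, $\Theta\in\mathbb R^{n\times n}$ be an $\epsilon_0$-approximation of $V_K$: writing $V_K(x)=\theta_0^\star+x^\top\Theta^\star x$ with $\Theta^\star$ symmetric, $\big(|\theta_0-\theta_0^\star|^2+\|\Theta-\Theta^\star\|_F^2\big)^{1/2}\le\epsilon_0$. For $L\ge 0$ consider the actor-critic estimator along the trajectory started at $x_0=0$, $$\hat G_{AC}^{(L)}(K)=\frac1{\sigma^2}\sum_{t=0}^L\gamma^t\,\tilde\delta_t\,(u_t-Kx_t)x_t^\top,\qquad \tilde\delta_t=c_t+\gamma\widetilde V(x_{t+1})-\widetilde V(x_t).$$ Then $J$ is differentiable at $K$, $\hat G_{AC}^{(L)}(K)$ and $\|\hat G_{AC}^{(L)}(K)\|_F^2$ are integrable, and $$\big\|\nabla J(K)-\mathbb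 E[\hat G_{AC}^{(L)}(K)]\big\|_2\le C_2\,\gamma^{L+1}\frac{\Gamma_K^2}{(1-\rho^2)(1-\gamma)}+C_4\,\Gamma_K\,J(K)\,\epsilon_0,$$ $$\mathbb E\big\|\hat G_{AC}^{(L)}(K)\big\|_F^2\le\Big[\frac{C_5(1+\epsilon_0^2)}{\sigma^2}+C_6\operatorname{Tr}[D_K]\,\sigma^2\Big]\frac{L}{1-\gamma^2},$$ where $D_K=\sum_{i\ge 0}(A+BK)^iD_{\widetilde\omega}[(A+BK)^i]^\top$ is the covariance of the stationary distribution of $x'=(A+BK)x+\widetilde\omega$, $$C_2=4\,\|D_{\widetilde\omega}\|_2\,\max\{1,\Gamma_K^{-2}\}\,\max\Big\{\Gamma_K\|B\|_2\frac{(1-\gamma)J(K)}{\sigma_{\min}(D_{\widetilde\omega})},\ \|R\|_2\|K\|_2\Big\},$$ $C_4$ depends only on $\|A\|_2,\|B\|_2,\|S\|_2,\|R\|_2,\|K\|_2,\Gamma_K,\frac1{1-\rho^2}$, the law of $\widetilde\omega$ (that is, $n$ and $D_{\widetilde\omega}$) and $(1-\gamma)J(K)$, $C_5$ depends only on these quantities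 and $d$, and $C_6$ depends only on $d$ and $\|R\|_2$. -/

import Mathlib

open MeasureTheory ProbabilityTheory
open scoped Matrix Matrix.Norms.L2Operator

noncomputable section

/-! Throughout, `‖X‖` of a real matrix `X` is the spectral norm (operator norm for the Euclidean
norms), supplied by `Matrix.Norms.L2Operator`. -/

/-- The data of a discounted linear quadratic regulator with state dimension `n`, control
dimension `d`, Gaussian system noise `N(0, Dω)` and exploration noise `N(0, σ² I)`. -/
structure LQR (n d : ℕ) where
  A : Matrix (Fin n) (Fin n) ℝ
  B : Matrix (Fin n) (Fin d) ℝ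
  S : Matrix (Fin n) (Fin n) ℝ
  R : Matrix (Fin d) (Fin d) ℝ
  Dω : Matrix (Fin n) (Fin n) ℝ
  γ : ℝ
  σ : ℝ
  posDef_S : S.PosDef
  posDef_R : R.PosDef
  posSemidef_Dω : Dω.PosSemidef
  γ_pos : 0 < γ
  γ_lt_one : γ < 1
  σ_pos : 0 < σ

namespace LQR

variable {n d : ℕ} (sys : LQR n d) (K : Matrix (Fin d) (Fin n) ℝ)

/-- The closed-loop matrix `A + B K`. -/
def closedLoop : Matrix (Fin n) (Fin n) ℝ := sys.A + sys.B * K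

/-- The spectral radius of `A + B K` (computed over `ℂ`). -/
def specRadius : ENNReal :=
  spectralRadius ℂ ((sys.closedLoop K).map (fun a : ℝ => (a : ℂ)))

/-- `K` is a stable policy. -/
def IsStable : Prop := sys.specRadius K < 1

/-- The covariance matrix of `ω̃ = B η + ω` with independent `η ∼ N(0, σ² I)`, `ω ∼ N(0, Dω)`. -/
def noiseCov : Matrix (Fin n) (Fin n) ℝ := sys.σ ^ 2 • (sys.B * sys.Bᵀ) + sys.Dω

/-- The covariance matrix of the stationary distribution of `x' = (A + B K) x + ω̃`. -/
def stationaryCov : Matrix (Fin n) (Fin n) ℝ :=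
  ∑' i : ℕ, sys.closedLoop K ^ i * sys.noiseCov * (sys.closedLoop K ^ i)ᵀ

/-- `(w t)` is i.i.d. `N(0, Dω)`, `(η t)` is i.i.d. `N(0, σ² I)`, and all these vectors are
jointly independent. -/
structure IsNoise {Ω : Type*} [MeasurableSpace Ω] (P : Measure Ω)
    (w : ℕ → Ω → EuclideanSpace ℝ (Fin n)) (η : ℕ → Ω → EuclideanSpace ℝ (Fin d)) : Prop where
  law_w : ∀ t, HasLaw (w t) (multivariateGaussian 0 sys.Dω) P
  law_η : ∀ t, HasLaw (η t) (multivariateGaussian 0 (sys.σ ^ 2 • 1)) P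
  indep_pair : ∀ t, IndepFun (w t) (η t) P
  indep_time : iIndepFun (fun t a => (w t a, η t a)) P

section Trajectory

variable {Ω : Type*} (w : ℕ → Ω → EuclideanSpace ℝ (Fin n)) (η : ℕ → Ω → EuclideanSpace ℝ (Fin d))

/-- The state process `x_{t+1} = A x_t + B u_t + ω_t` with `u_t = K x_t + η_t`, started at `x0`. -/
def state (x0 : Fin n → ℝ) : ℕ → Ω → Fin n → ℝ
  | 0, _ => x0
  | t + 1, a => sys.A *ᵥ state x0 t a + sys.B *ᵥ (K *ᵥ state x0 t a + (η t a).ofLp) + (w t a).ofLp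

/-- The control `u_t = K x_t + η_t`. -/
def control (x0 : Fin n → ℝ) (t : ℕ) (a : Ω) : Fin d → ℝ :=
  K *ᵥ sys.state K w η x0 t a + (η t a).ofLp

/-- The running cost `c_t = x_tᵀ S x_t + u_tᵀ R u_t`. -/
def runCost (x0 : Fin n → ℝ) (t : ℕ) (a : Ω) : ℝ :=
  sys.state K w η x0 t a ⬝ᵥ sys.S *ᵥ sys.state K w η x0 t a +
    sys.control K w η x0 t a ⬝ᵥ sys.R *ᵥ sys.control K w η x0 t a

variable [MeasurableSpace Ω] (P : Measure Ω)

/-- The objective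
`J(K) = ∑ₜ γᵗ E[x_tᵀ (S + Kᵀ R K) x_t] + σ² Tr R / (1 - γ)`, where `x_0 = 0`. -/
def J : ℝ :=
  ∑' t : ℕ, sys.γ ^ t *
      ∫ a, sys.state K w η 0 t a ⬝ᵥ (sys.S + Kᵀ * sys.R * K) *ᵥ sys.state K w η 0 t a ∂P +
    sys.σ ^ 2 * sys.R.trace / (1 - sys.γ)

/-- The gradient `∇J(K)`: the matrix of partial derivatives of `J` with respect to the entries. -/
def gradJ : Matrix (Fin d) (Fin n) ℝ :=
  Matrix.of fun i j => fderiv ℝ (fun K' => sys.J K' w η P) K (Matrix.single i j 1)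

/-- The state value function `V_K(x) = E[∑ₜ γᵗ c_t | x_0 = x]`. -/
def valueFn (x : Fin n → ℝ) : ℝ := ∫ a, ∑' t : ℕ, sys.γ ^ t * sys.runCost K w η x t a ∂P

end Trajectory

/-- The approximate value function `Ṽ(x; θ) = φ(x)ᵀ θ = θ₀ + xᵀ Θ x`, where
`φ(x) = (1, vec(x xᵀ))` and `θ = (θ₀, vec Θ)`. -/
def approxV (θ₀ : ℝ) (Θ : Matrix (Fin n) (Fin n) ℝ) (x : Fin n → ℝ) : ℝ := θ₀ + x ⬝ᵥ Θ *ᵥ x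

/-- The squared Frobenius norm. -/
def frobSq {m k : ℕ} (X : Matrix (Fin m) (Fin k) ℝ) : ℝ := ∑ i, ∑ j, X i j ^ 2

/-- `Ṽ(·; θ)` is an `ε₀`-approximation of `V_K`: `‖θ - θ⋆‖₂ ≤ ε₀`, where `θ⋆ = (θ₀⋆, vec Θ⋆)` with
`Θ⋆` symmetric is the parameter of `V_K`, that is `V_K = Ṽ(·; θ⋆)`. -/
def IsApproxValue {Ω : Type*} [MeasurableSpace Ω] (w : ℕ → Ω → EuclideanSpace ℝ (Fin n))
    (η : ℕ → Ω → EuclideanSpace ℝ (Fin d)) (P : Measure Ω) (θ₀ : ℝ)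
    (Θ : Matrix (Fin n) (Fin n) ℝ) (ε₀ : ℝ) : Prop :=
  ∃ (θ₀s : ℝ) (Θs : Matrix (Fin n) (Fin n) ℝ), Θs.IsSymm ∧
    (∀ x, sys.valueFn K w η P x = approxV θ₀s Θs x) ∧
    Real.sqrt ((θ₀ - θ₀s) ^ 2 + frobSq (Θ - Θs)) ≤ ε₀

section Estimator

variable {Ω : Type*} (w : ℕ → Ω → EuclideanSpace ℝ (Fin n)) (η : ℕ → Ω → EuclideanSpace ℝ (Fin d))
  (θ₀ : ℝ) (Θ : Matrix (Fin n) (Fin n) ℝ)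

/-- The temporal difference `δ̃_t = c_t + γ Ṽ(x_{t+1}) - Ṽ(x_t)` along the trajectory with
`x_0 = 0`. -/
def tdError (t : ℕ) (a : Ω) : ℝ :=
  sys.runCost K w η 0 t a + sys.γ * approxV θ₀ Θ (sys.state K w η 0 (t + 1) a) -
    approxV θ₀ Θ (sys.state K w η 0 t a)

/-- The actor-critic estimator
`Ĝ(K) = σ⁻² ∑_{t=0}^{L} γᵗ δ̃_t (u_t - K x_t) x_tᵀ` along the trajectory with `x_0 = 0`. -/
def acEstimator (L : ℕ) (a : Ω) : Matrix (Fin d) (Fin n) ℝ :=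
  (1 / sys.σ ^ 2) • ∑ t ∈ Finset.range (L + 1),
    (sys.γ ^ t * sys.tdError K w η θ₀ Θ t a) •
      Matrix.vecMulVec (sys.control K w η 0 t a - K *ᵥ sys.state K w η 0 t a)
        (sys.state K w η 0 t a)

end Estimator

end LQR

/-- The quantities that the constants may depend on: `‖A‖`, `‖B‖`, `‖S‖`, `‖R‖`, `‖K‖`, `Γ_K`,
`1 / (1 - ρ²)`, the law of `ω̃` (a centered Gaussian, given by its covariance matrix) and
`(1 - γ) J(K)`. -/
structure ConstParams (n : ℕ) where
  normA : ℝ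
  normB : ℝ
  normS : ℝ
  normR : ℝ
  normK : ℝ
  Γ : ℝ
  gap : ℝ
  cov : Matrix (Fin n) (Fin n) ℝ
  level : ℝ

/-- The values of these quantities for a given system, policy and pair `(Γ_K, ρ)`. -/
def LQR.constParams {n d : ℕ} (sys : LQR n d) (K : Matrix (Fin d) (Fin n) ℝ) {Ω : Type*}
    [MeasurableSpace Ω] (w : ℕ → Ω → EuclideanSpace ℝ (Fin n))
    (η : ℕ → Ω → EuclideanSpace ℝ (Fin d)) (P : Measure Ω) (Γ ρ : ℝ) : ConstParams n where
  normA := ‖sys.A‖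
  normB := ‖sys.B‖
  normS := ‖sys.S‖
  normR := ‖sys.R‖
  normK := ‖K‖
  Γ := Γ
  gap := 1 / (1 - ρ ^ 2)
  cov := sys.noiseCov
  level := (1 - sys.γ) * sys.J K w η P

/-- The smallest singular value of an `n × n` matrix. -/
def sigmaMin {n : ℕ} (X : Matrix (Fin n) (Fin n) ℝ) : ℝ :=
  (Matrix.toEuclideanLin X).singularValues (n - 1)

/-- The constant
`C₂ = 4 ‖D‖ max{1, Γ⁻²} max{Γ ‖B‖ (1 - γ) J(K) / σ_min(D), ‖R‖ ‖K‖}`, `D` the covariance of `ω̃`.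
The factor `max{1, Γ⁻²}` is `1` for `Γ ≥ 1`; for `Γ < 1` it accounts for the zeroth power of
`A + B K`, whose norm need not be at most `Γ`. -/
def ConstParams.C₂ {n : ℕ} (c : ConstParams n) : ℝ :=
  4 * ‖c.cov‖ * max 1 ((c.Γ ^ 2)⁻¹) *
    max (c.Γ * c.normB * (c.level / sigmaMin c.cov)) (c.normR * c.normK)

end

/-! Write M = A + BK, D for the covariance of the innovation ξ = Bη + ω, and Q = S + KᵀRK. From x₀ =
0 the state has second moments Σ_t = ∑_{i<t} Mⁱ D (Mⁱ)ᵀ. Hence J(K) is tr(QY) plus a constant, where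
Y = ∑ γᵗ Σ_t, and the value matrix Θ solves Θ = Q + γ MᵀΘM.

Gradient. The Lyapunov equations for Θ and Y are adjoint under the trace pairing
(`PowBound.trace_mul_discCov`). Using Θ of K and Y of K' gives an exact formula for J(K') - J(K)
(`IsNoise.J_sub_J`), quadratic in K' - K apart from the factor Y of K'. Continuity of Y then yields
∇J(K) = 2EY with E = RK + γBᵀΘM (`IsNoise.gradJ_eq`).

Bias. The value function is J(K) + xᵀΘx, so the approximate parameters are ε₀-close to J(K) and Θ
(`IsNoise.approx_bound`). Given x_t, flipping the signs of both noises preserves their law, so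
against η_t x_tᵀ only the odd part of the temporal difference counts. It is linear in the noise, and
the mean of the estimator is NᵀZ, where Z = ∑_{t≤L} γᵗ Σ_t and Nᵀ = 2E when the approximate matrix
is exact (`IsNoise.integral_acEstimator`). The bias is thus a tail of Y plus the effect of the error
in Θ. The identity (1-γ)J(K) = γ tr(ΘD) + σ² tr R bounds γ‖Θ‖ by (1-γ)J(K)/σ_min(D).

Second moment. Cauchy-Schwarz in time gives the factor 1/(1-γ²), and the summand at t = 0 vanishes
because x₀ = 0. Apart from ηᵀRη, the temporal difference is at most a constant times 1 + |x|² +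
|η/σ|² + |ξ|². Its contribution reduces to eighth moments, which are uniform in t because x_t is a
geometrically weighted sum of innovations. The term ηᵀRη contributes E|η|⁶|x|², which factors by
independence and produces Tr D_K. -/

noncomputable section

set_option linter.unusedSectionVars false

/-! ### Spectral norm, Frobenius norm and trace -/

namespace Matrix

variable {m n k : ℕ}

lemma l2_opNorm_le_of_forall {X : Matrix (Fin m) (Fin n) ℝ} {C : ℝ} (hC : 0 ≤ C)
    (h : ∀ x : EuclideanSpace ℝ (Fin n), ‖WithLp.toLp 2 (X *ᵥ x.ofLp)‖ ≤ C * ‖x‖) : ‖X‖ ≤ C := by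
  rw [l2_opNorm_def]
  exact ContinuousLinearMap.opNorm_le_bound _ hC h

lemma norm_toLp_mulVec_le (X : Matrix (Fin m) (Fin n) ℝ) (x : Fin n → ℝ) :
    ‖WithLp.toLp 2 (X *ᵥ x)‖ ≤ ‖X‖ * ‖WithLp.toLp 2 x‖ :=
  l2_opNorm_mulVec X (WithLp.toLp 2 x)

lemma dotProduct_eq_inner (x y : Fin n → ℝ) :
    x ⬝ᵥ y = inner ℝ (WithLp.toLp 2 y) (WithLp.toLp 2 x) := by
  simp [PiLp.inner_apply, dotProduct]

lemma dotProduct_self_eq_norm_sq (x : Fin n → ℝ) : x ⬝ᵥ x = ‖WithLp.toLp 2 x‖ ^ 2 := by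
  rw [dotProduct_eq_inner, real_inner_self_eq_norm_sq]

lemma abs_dotProduct_mulVec_le (X : Matrix (Fin m) (Fin n) ℝ) (x : Fin m → ℝ) (y : Fin n → ℝ) :
    |x ⬝ᵥ X *ᵥ y| ≤ ‖X‖ * ‖WithLp.toLp 2 x‖ * ‖WithLp.toLp 2 y‖ := by
  rw [dotProduct_eq_inner]
  refine (abs_real_inner_le_norm _ _).trans ?_
  have := mul_le_mul_of_nonneg_right (norm_toLp_mulVec_le X y) (norm_nonneg (WithLp.toLp 2 x))
  linarith

lemma l2_opNorm_transpose (X : Matrix (Fin m) (Fin n) ℝ) : ‖Xᵀ‖ = ‖X‖ := by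
  rw [← conjTranspose_eq_transpose_of_trivial, l2_opNorm_conjTranspose]

lemma l2_opNorm_one_le : ‖(1 : Matrix (Fin n) (Fin n) ℝ)‖ ≤ 1 :=
  l2_opNorm_le_of_forall zero_le_one fun x => by simp

/-- Cauchy-Schwarz in each row. -/
lemma sq_l2_opNorm_le_frobSq (X : Matrix (Fin m) (Fin n) ℝ) : ‖X‖ ^ 2 ≤ LQR.frobSq X := by
  have h0 : 0 ≤ LQR.frobSq X := Finset.sum_nonneg fun i _ => Finset.sum_nonneg fun j _ => sq_nonneg _
  have : ‖X‖ ≤ Real.sqrt (LQR.frobSq X) := by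
    refine l2_opNorm_le_of_forall (Real.sqrt_nonneg _) fun x => ?_
    refine le_of_sq_le_sq ?_ (by positivity)
    rw [mul_pow, Real.sq_sqrt h0, EuclideanSpace.real_norm_sq_eq, EuclideanSpace.real_norm_sq_eq,
      LQR.frobSq, Finset.sum_mul]
    exact Finset.sum_le_sum fun i _ =>
      Finset.sum_mul_sq_le_sq_mul_sq Finset.univ (fun j => X i j) (fun j => x.ofLp j)
  calc ‖X‖ ^ 2 ≤ Real.sqrt (LQR.frobSq X) ^ 2 := by gcongr
    _ = _ := Real.sq_sqrt h0

lemma trace_transpose_mul_self (X : Matrix (Fin m) (Fin n) ℝ) : (Xᵀ * X).trace = LQR.frobSq X := by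
  simp only [trace, diag, mul_apply, transpose_apply, LQR.frobSq]
  rw [Finset.sum_comm]
  simp [sq]

lemma PosSemidef.exists_eq_transpose_mul {X : Matrix (Fin n) (Fin n) ℝ} (hX : X.PosSemidef) :
    ∃ C : Matrix (Fin n) (Fin n) ℝ, X = Cᵀ * C := by
  open scoped MatrixOrder in
  refine ⟨CFC.sqrt X, ?_⟩
  have h1 : (CFC.sqrt X).IsHermitian := (CFC.sqrt_nonneg X).isSelfAdjoint
  rw [← conjTranspose_eq_transpose_of_trivial, h1.eq, CFC.sqrt_mul_sqrt_self X hX.nonneg]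

/-- For X = CᵀC the spectral norm is ‖C‖², while the trace is the squared Frobenius norm of C. -/
lemma PosSemidef.l2_opNorm_le_trace {X : Matrix (Fin n) (Fin n) ℝ} (hX : X.PosSemidef) :
    ‖X‖ ≤ X.trace := by
  obtain ⟨C, rfl⟩ := hX.exists_eq_transpose_mul
  rw [trace_transpose_mul_self, ← conjTranspose_eq_transpose_of_trivial,
    l2_opNorm_conjTranspose_mul_self, ← sq]
  exact sq_l2_opNorm_le_frobSq C

/-- Each diagonal entry is at most the spectral norm. The crude factor n does no harm: the bound
only serves to show that a remainder is little-o. -/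
lemma abs_trace_mul_le (X Y : Matrix (Fin n) (Fin n) ℝ) : |(X * Y).trace| ≤ n * (‖X‖ * ‖Y‖) := by
  have h : ∀ i, |(X * Y) i i| ≤ ‖X‖ * ‖Y‖ := fun i => by
    have := abs_dotProduct_mulVec_le (X * Y) (Pi.single i 1) (Pi.single i 1)
    simp only [single_one_dotProduct, mulVec_single_one, col_apply] at this
    have e : ‖(WithLp.toLp 2 (Pi.single i 1 : Fin n → ℝ))‖ = 1 := by simp
    rw [e] at this
    simp only [mul_one] at this
    exact this.trans (l2_opNorm_mul X Y)
  calc |(X * Y).trace| ≤ ∑ i, |(X * Y) i i| := Finset.abs_sum_le_sum_abs _ _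
    _ ≤ ∑ _i : Fin n, ‖X‖ * ‖Y‖ := Finset.sum_le_sum fun i _ => h i
    _ = _ := by simp

/-- If `Cᵀ C ≤ X` in the Loewner order then `‖C‖² ≤ ‖X‖`. -/
lemma sq_l2_opNorm_le_of_sub_posSemidef {C : Matrix (Fin m) (Fin n) ℝ}
    {X : Matrix (Fin n) (Fin n) ℝ} (h : (X - Cᵀ * C).PosSemidef) : ‖C‖ ^ 2 ≤ ‖X‖ := by
  have : ‖C‖ ≤ Real.sqrt ‖X‖ := by
    refine l2_opNorm_le_of_forall (Real.sqrt_nonneg _) fun x => ?_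
    refine le_of_sq_le_sq ?_ (by positivity)
    rw [mul_pow, Real.sq_sqrt (norm_nonneg _), ← dotProduct_self_eq_norm_sq]
    have h1 := h.dotProduct_mulVec_nonneg x.ofLp
    simp only [star_trivial, sub_mulVec, dotProduct_sub] at h1
    have h2 : x.ofLp ⬝ᵥ (Cᵀ * C) *ᵥ x.ofLp = (C *ᵥ x.ofLp) ⬝ᵥ (C *ᵥ x.ofLp) := by
      rw [← mulVec_mulVec, dotProduct_mulVec, vecMul_transpose]
    have h3 := (le_abs_self _).trans (abs_dotProduct_mulVec_le X x.ofLp x.ofLp)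
    simp only [WithLp.toLp_ofLp] at h3
    nlinarith
  calc ‖C‖ ^ 2 ≤ Real.sqrt ‖X‖ ^ 2 := by gcongr
    _ = _ := Real.sq_sqrt (norm_nonneg _)

lemma PosSemidef.l2_opNorm_le_of_sub {X Y : Matrix (Fin n) (Fin n) ℝ} (hX : X.PosSemidef)
    (h : (Y - X).PosSemidef) : ‖X‖ ≤ ‖Y‖ := by
  obtain ⟨C, rfl⟩ := hX.exists_eq_transpose_mul
  rw [← conjTranspose_eq_transpose_of_trivial, l2_opNorm_conjTranspose_mul_self, ← sq]
  exact sq_l2_opNorm_le_of_sub_posSemidef h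

end Matrix

/-! ### The smallest singular value of a positive semidefinite matrix. -/

open Matrix

/-- The squared singular values of D are the eigenvalues of D*D in decreasing order. Every squared
eigenvalue of D occurs in this list, so it is at least the last entry, of index n - 1. -/
lemma sigmaMin_le_eigenvalues {n : ℕ} {D : Matrix (Fin n) (Fin n) ℝ} (hD : D.PosSemidef)
    (i : Fin n) : sigmaMin D ≤ hD.1.eigenvalues i := by
  have hn : 0 < n := i.pos
  have hfr : Module.finrank ℝ (EuclideanSpace ℝ (Fin n)) = n := by simp
  refine le_of_sq_le_sq ?_ (hD.eigenvalues_nonneg i)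
  set T := Matrix.toEuclideanLin D with hT
  have hTs : LinearMap.adjoint T = T := by
    rw [hT, ← Matrix.toEuclideanLin_conjTranspose_eq_adjoint, hD.1.eq]
  have hTe : T (hD.1.eigenvectorBasis i) = hD.1.eigenvalues i • hD.1.eigenvectorBasis i := by
    apply (WithLp.ofLp_injective 2)
    rw [hT, Matrix.ofLp_toLpLin]
    simpa using hD.1.mulVec_eigenvectorBasis i
  have hev : Module.End.HasEigenvalue (LinearMap.adjoint T ∘ₗ T) (hD.1.eigenvalues i ^ 2) := by
    refine Module.End.hasEigenvalue_of_hasEigenvector (x := hD.1.eigenvectorBasis i) ⟨?_, ?_⟩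
    · rw [Module.End.mem_eigenspace_iff, LinearMap.comp_apply, hTs, hTe, map_smul, hTe, smul_smul, sq]
    · exact hD.1.eigenvectorBasis.orthonormal.ne_zero i
  obtain ⟨j, hj⟩ := T.isSymmetric_adjoint_comp_self.exists_eigenvalues_eq hfr hev
  rw [sigmaMin, LinearMap.sq_singularValues_of_lt T hfr (show n - 1 < n by omega)]
  refine le_trans ?_ hj.le
  exact T.isSymmetric_adjoint_comp_self.eigenvalues_antitone hfr
    (show j ≤ ⟨n - 1, _⟩ from Fin.le_def.2 (by have := j.isLt; simp; omega))

lemma sigmaMin_pos {n : ℕ} {D : Matrix (Fin n) (Fin n) ℝ} (hD : D.PosDef) (hn : 0 < n) :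
    0 < sigmaMin D := by
  have hfr : Module.finrank ℝ (EuclideanSpace ℝ (Fin n)) = n := by simp
  refine (LinearMap.injective_iff_forall_lt_finrank_singularValues_pos
    (T := Matrix.toEuclideanLin D)).1 ?_ (n - 1) (by omega)
  intro x y hxy
  have hxy' := congrArg (WithLp.ofLp (p := 2)) hxy
  rw [Matrix.ofLp_toLpLin, Matrix.ofLp_toLpLin] at hxy'
  simp only [toLin'_apply] at hxy'
  exact WithLp.ofLp_injective 2 (Matrix.mulVec_injective_iff_isUnit.2 hD.isUnit hxy')

/-- In an eigenbasis of D, tr(XD) is the sum of the nonnegative diagonal entries of X weighted by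
eigenvalues of D. This turns control of tr(ΘD), which is what the cost provides, into control of tr
Θ. -/
lemma sigmaMin_mul_trace_le {n : ℕ} {D X : Matrix (Fin n) (Fin n) ℝ} (hD : D.PosSemidef)
    (hX : X.PosSemidef) : sigmaMin D * X.trace ≤ (X * D).trace := by
  set U : Matrix (Fin n) (Fin n) ℝ := (hD.1.eigenvectorUnitary : Matrix (Fin n) (Fin n) ℝ) with hU
  have hUU : U * star U = 1 := Unitary.coe_mul_star_self _
  have hspec : D = U * diagonal hD.1.eigenvalues * star U := by
    conv_lhs => rw [hD.1.spectral_theorem]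
    simp [Unitary.conjStarAlgAut_apply, hU]
  set Z := star U * X * U with hZ
  have hZp : Z.PosSemidef := by
    have := hX.conjTranspose_mul_mul_same U
    simpa [hZ, star_eq_conjTranspose] using this
  have h1 : (X * D).trace = ∑ i, Z i i * hD.1.eigenvalues i := by
    calc (X * D).trace = (X * (U * diagonal hD.1.eigenvalues * star U)).trace :=
          congrArg (fun W => (X * W).trace) hspec
      _ = (Z * diagonal hD.1.eigenvalues).trace := by
          rw [← mul_assoc, trace_mul_comm, hZ]
          simp only [mul_assoc]
      _ = _ := by simp [trace, mul_diagonal]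
  have h2 : X.trace = ∑ i, Z i i := by
    change _ = Z.trace
    rw [hZ, trace_mul_comm, ← mul_assoc, hUU, one_mul]
  rw [h1, h2, Finset.mul_sum]
  refine Finset.sum_le_sum fun i _ => ?_
  rw [mul_comm]
  exact mul_le_mul_of_nonneg_left (sigmaMin_le_eigenvalues hD i) hZp.diag_nonneg

/-- Powers of a perturbed matrix. -/
lemma norm_add_pow_le {n : ℕ} {M F : Matrix (Fin n) (Fin n) ℝ} {c r : ℝ} (hc : 0 ≤ c)
    (hr : 0 ≤ r) (hM : ∀ k : ℕ, ‖M ^ k‖ ≤ c * r ^ k) (k : ℕ) :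
    ‖(M + F) ^ k‖ ≤ c * (r + c * ‖F‖) ^ k := by
  -- Discrete Duhamel formula: the sum runs over the position of the leftmost factor F in the
  -- expanded product.
  have hexp : ∀ k : ℕ, (M + F) ^ k =
      M ^ k + ∑ j ∈ Finset.range k, M ^ (k - 1 - j) * F * (M + F) ^ j := by
    intro k
    induction k with
    | zero => simp
    | succ k ih =>
      rw [Finset.sum_range_succ, pow_succ' (M + F) k, add_mul]
      nth_rewrite 1 [ih]
      have : ∑ j ∈ Finset.range k, M ^ (k + 1 - 1 - j) * F * (M + F) ^ j =
          M * ∑ j ∈ Finset.range k, M ^ (k - 1 - j) * F * (M + F) ^ j := by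
        rw [Finset.mul_sum]
        refine Finset.sum_congr rfl fun j hj => ?_
        have : k + 1 - 1 - j = (k - 1 - j) + 1 := by have := Finset.mem_range.1 hj; omega
        rw [this, pow_succ']
        simp only [mul_assoc]
      rw [this, mul_add, ← pow_succ']
      simp only [add_tsub_cancel_right, tsub_self, pow_zero, one_mul]
      abel
  induction k using Nat.strong_induction_on with
  | _ k ih =>
    set q := r + c * ‖F‖ with hq
    calc ‖(M + F) ^ k‖
        ≤ ‖M ^ k‖ + ∑ j ∈ Finset.range k, ‖M ^ (k - 1 - j) * F * (M + F) ^ j‖ := by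
          rw [hexp k]
          exact (norm_add_le _ _).trans (add_le_add_right (norm_sum_le _ _) _)
      _ ≤ c * r ^ k + ∑ j ∈ Finset.range k, c * r ^ (k - 1 - j) * ‖F‖ * (c * q ^ j) := by
          refine add_le_add (hM k) (Finset.sum_le_sum fun j hj => ?_)
          refine (norm_mul_le _ _).trans ?_
          refine mul_le_mul ((norm_mul_le _ _).trans ?_) (ih j (Finset.mem_range.1 hj))
            (norm_nonneg _) (by positivity)
          exact mul_le_mul_of_nonneg_right (hM _) (norm_nonneg _)
      -- Since q - r = c‖F‖, the sum becomes a two-variable geometric sum times q - r, which is q^k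
      -- - r^k; the induction closes with the same constant c.
      _ = c * (r ^ k + (∑ j ∈ Finset.range k, q ^ j * r ^ (k - 1 - j)) * (q - r)) := by
          rw [mul_add, Finset.sum_mul, Finset.mul_sum]
          congr 1
          refine Finset.sum_congr rfl fun j _ => ?_
          rw [hq]; ring
      _ = c * q ^ k := by
          rw [(Commute.all q r).geom_sum₂_mul]; ring

/-! ### Discounted covariance and value matrices -/

section Lyapunov

variable {n : ℕ}

/-- The covariance of `∑_{i<t} Mⁱ ξ_{t-1-i}` for white noise `ξ` with covariance `D`. -/
def covSeq (M D : Matrix (Fin n) (Fin n) ℝ) (t : ℕ) : Matrix (Fin n) (Fin n) ℝ :=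
  ∑ i ∈ Finset.range t, M ^ i * D * (M ^ i)ᵀ

/-- The discounted sum of the covariances `covSeq M D t`. -/
def discCov (M D : Matrix (Fin n) (Fin n) ℝ) (γ : ℝ) : Matrix (Fin n) (Fin n) ℝ :=
  ∑' t : ℕ, γ ^ t • covSeq M D t

/-- The solution of the discounted Lyapunov equation `X = Q + γ Mᵀ X M`. -/
def valueMat (M Q : Matrix (Fin n) (Fin n) ℝ) (γ : ℝ) : Matrix (Fin n) (Fin n) ℝ :=
  ∑' t : ℕ, γ ^ t • ((M ^ t)ᵀ * Q * M ^ t)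

@[simp] lemma covSeq_zero (M D : Matrix (Fin n) (Fin n) ℝ) : covSeq M D 0 = 0 := by
  simp [covSeq]

lemma covSeq_succ (M D : Matrix (Fin n) (Fin n) ℝ) (t : ℕ) :
    covSeq M D (t + 1) = M * covSeq M D t * Mᵀ + D := by
  rw [covSeq, Finset.sum_range_succ', covSeq, Finset.mul_sum, Finset.sum_mul]
  simp [pow_succ', mul_assoc]

lemma covSeq_transpose (M : Matrix (Fin n) (Fin n) ℝ) {D : Matrix (Fin n) (Fin n) ℝ}
    (hD : D.IsSymm) (t : ℕ) : (covSeq M D t)ᵀ = covSeq M D t := by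
  simp [covSeq, transpose_sum, transpose_mul, hD.eq, mul_assoc]

lemma covSeq_posSemidef (M : Matrix (Fin n) (Fin n) ℝ) {D : Matrix (Fin n) (Fin n) ℝ}
    (hD : D.PosSemidef) (t : ℕ) : (covSeq M D t).PosSemidef := by
  refine Matrix.posSemidef_sum _ fun i _ => ?_
  simpa using hD.mul_mul_conjTranspose_same (M ^ i)

lemma HasSum.matrix_mul_mul {m k l : ℕ} {ι : Type*} {f : ι → Matrix (Fin m) (Fin k) ℝ}
    {Y : Matrix (Fin m) (Fin k) ℝ} (h : HasSum f Y) (U : Matrix (Fin l) (Fin m) ℝ)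
    (V : Matrix (Fin k) (Fin n) ℝ) : HasSum (fun t => U * f t * V) (U * Y * V) :=
  h.map (⟨⟨fun X => U * X * V, by simp⟩, fun X Z => by
      simp only [Matrix.mul_add, Matrix.add_mul]⟩ : Matrix (Fin m) (Fin k) ℝ →+ Matrix (Fin l) (Fin n) ℝ)
    (show Continuous fun X : Matrix (Fin m) (Fin k) ℝ => U * X * V by fun_prop)

lemma HasSum.dotProduct_mulVec {m : ℕ} {ι : Type*} {f : ι → Matrix (Fin m) (Fin n) ℝ}
    {Y : Matrix (Fin m) (Fin n) ℝ} (h : HasSum f Y) (x : Fin m → ℝ) (y : Fin n → ℝ) :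
    HasSum (fun t => x ⬝ᵥ f t *ᵥ y) (x ⬝ᵥ Y *ᵥ y) :=
  h.map (⟨⟨fun X => x ⬝ᵥ X *ᵥ y, by simp⟩, fun X Z => by simp [add_mulVec, dotProduct_add]⟩ :
      Matrix (Fin m) (Fin n) ℝ →+ ℝ)
    (show Continuous fun X : Matrix (Fin m) (Fin n) ℝ => x ⬝ᵥ X *ᵥ y by fun_prop)

lemma HasSum.trace_mul {ι : Type*} {f : ι → Matrix (Fin n) (Fin n) ℝ}
    {Y : Matrix (Fin n) (Fin n) ℝ} (h : HasSum f Y) (Q : Matrix (Fin n) (Fin n) ℝ) :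
    HasSum (fun t => (Q * f t).trace) (Q * Y).trace :=
  h.map (⟨⟨fun X => (Q * X).trace, by simp⟩, fun X Z => by simp [mul_add]⟩ :
      Matrix (Fin n) (Fin n) ℝ →+ ℝ)
    (show Continuous fun X : Matrix (Fin n) (Fin n) ℝ => (Q * X).trace by fun_prop)

/-- The powers of `M` are dominated by the geometric sequence `c rᵏ` with `r < 1`. -/
structure PowBound (M : Matrix (Fin n) (Fin n) ℝ) (c r : ℝ) : Prop where
  nonneg : 0 ≤ r
  lt_one : r < 1
  norm_pow_le : ∀ k : ℕ, ‖M ^ k‖ ≤ c * r ^ k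

namespace PowBound

variable {M D Q : Matrix (Fin n) (Fin n) ℝ} {c r γ : ℝ}

lemma const_nonneg (h : PowBound M c r) : 0 ≤ c := by
  simpa using (norm_nonneg _).trans (h.norm_pow_le 0)

lemma sq_lt_one (h : PowBound M c r) : r ^ 2 < 1 := by
  have h1 := h.nonneg; have h2 := h.lt_one; nlinarith

lemma gap_nonneg (h : PowBound M c r) : 0 ≤ c ^ 2 / (1 - r ^ 2) :=
  div_nonneg (sq_nonneg _) (by linarith [h.sq_lt_one])

lemma sum_sq_norm_pow_le (h : PowBound M c r) (t : ℕ) :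
    ∑ i ∈ Finset.range t, ‖M ^ i‖ ^ 2 ≤ c ^ 2 / (1 - r ^ 2) := by
  have hs := h.sq_lt_one
  calc ∑ i ∈ Finset.range t, ‖M ^ i‖ ^ 2 ≤ ∑ i ∈ Finset.range t, c ^ 2 * (r ^ 2) ^ i := by
        refine Finset.sum_le_sum fun i _ => ?_
        calc ‖M ^ i‖ ^ 2 ≤ (c * r ^ i) ^ 2 := by gcongr; exact h.norm_pow_le i
          _ = _ := by ring
    _ ≤ ∑' i : ℕ, c ^ 2 * (r ^ 2) ^ i :=
        ((summable_geometric_of_lt_one (sq_nonneg r) hs).mul_left _).sum_le_tsum _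
          fun _ _ => by positivity
    _ = _ := by rw [tsum_mul_left, tsum_geometric_of_lt_one (sq_nonneg r) hs, div_eq_mul_inv]

lemma norm_covSeq_le (h : PowBound M c r) (D : Matrix (Fin n) (Fin n) ℝ) (t : ℕ) :
    ‖covSeq M D t‖ ≤ c ^ 2 / (1 - r ^ 2) * ‖D‖ := by
  calc ‖covSeq M D t‖ ≤ ∑ i ∈ Finset.range t, ‖M ^ i‖ ^ 2 * ‖D‖ := by
        refine (norm_sum_le _ _).trans (Finset.sum_le_sum fun i _ => ?_)
        have h1 := norm_mul_le (M ^ i * D) (M ^ i)ᵀ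
        have h2 := norm_mul_le (M ^ i) D
        rw [l2_opNorm_transpose] at h1
        nlinarith [norm_nonneg (M ^ i)]
    _ ≤ _ := by
        rw [← Finset.sum_mul]
        exact mul_le_mul_of_nonneg_right (h.sum_sq_norm_pow_le t) (norm_nonneg _)

lemma norm_smul_covSeq_le (h : PowBound M c r) (hγ : 0 ≤ γ) (D : Matrix (Fin n) (Fin n) ℝ) (t : ℕ) :
    ‖γ ^ t • covSeq M D t‖ ≤ c ^ 2 / (1 - r ^ 2) * ‖D‖ * γ ^ t := by
  rw [norm_smul, Real.norm_of_nonneg (pow_nonneg hγ t), mul_comm]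
  exact mul_le_mul_of_nonneg_right (h.norm_covSeq_le D t) (pow_nonneg hγ t)

lemma hasSum_discCov (h : PowBound M c r) (hγ : 0 ≤ γ) (hγ1 : γ < 1)
    (D : Matrix (Fin n) (Fin n) ℝ) :
    HasSum (fun t : ℕ => γ ^ t • covSeq M D t) (discCov M D γ) :=
  (Summable.of_norm_bounded ((summable_geometric_of_lt_one hγ hγ1).mul_left _)
    fun t => h.norm_smul_covSeq_le hγ D t).hasSum

lemma discCov_transpose (h : PowBound M c r) (hγ : 0 ≤ γ) (hγ1 : γ < 1) (hD : D.IsSymm) :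
    (discCov M D γ)ᵀ = discCov M D γ := by
  have h1 := (h.hasSum_discCov hγ hγ1 D).matrix_transpose
  simp only [transpose_smul, covSeq_transpose M hD] at h1
  exact h1.unique (h.hasSum_discCov hγ hγ1 D)

/-- Shift the index by one: the term at t = 0 is zero, `covSeq_succ` gives the recursion, and the
copies of D carry total weight γ + γ² + ... = γ/(1-γ). -/
lemma discCov_eq (h : PowBound M c r) (hγ : 0 ≤ γ) (hγ1 : γ < 1) (D : Matrix (Fin n) (Fin n) ℝ) :
    discCov M D γ = γ • (M * discCov M D γ * Mᵀ) + (γ / (1 - γ)) • D := by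
  have h1 := ((h.hasSum_discCov hγ hγ1 D).matrix_mul_mul M Mᵀ).const_smul γ
  have h2 := ((hasSum_geometric_of_lt_one hγ hγ1).mul_left γ).smul_const D
  have h3 := (hasSum_nat_add_iff' 1).2 (h.hasSum_discCov hγ hγ1 D)
  simp only [Finset.range_one, Finset.sum_singleton, covSeq_zero, smul_zero, sub_zero] at h3
  rw [div_eq_mul_inv]
  have e : (fun t : ℕ => γ ^ (t + 1) • covSeq M D (t + 1)) =
      fun t => γ • (M * γ ^ t • covSeq M D t * Mᵀ) + (γ * γ ^ t) • D := by
    funext t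
    rw [covSeq_succ, smul_add, Matrix.mul_smul, Matrix.smul_mul, smul_smul, pow_succ']
  rw [e] at h3
  exact h3.unique (h1.add h2)

lemma norm_discCov_sub_le (h : PowBound M c r) (hγ : 0 ≤ γ) (hγ1 : γ < 1)
    (D : Matrix (Fin n) (Fin n) ℝ) (N : ℕ) :
    ‖discCov M D γ - ∑ t ∈ Finset.range N, γ ^ t • covSeq M D t‖ ≤
      c ^ 2 / (1 - r ^ 2) * ‖D‖ * (γ ^ N / (1 - γ)) := by
  have h3 := (hasSum_nat_add_iff' N).2 (h.hasSum_discCov hγ hγ1 D)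
  have h4 := ((hasSum_geometric_of_lt_one hγ hγ1).mul_left
    (c ^ 2 / (1 - r ^ 2) * ‖D‖ * γ ^ N))
  rw [← h3.tsum_eq]
  refine (tsum_of_norm_bounded h4 fun t => ?_).trans_eq (by rw [div_eq_mul_inv]; ring)
  refine (h.norm_smul_covSeq_le hγ D (t + N)).trans_eq ?_
  rw [pow_add]; ring

lemma norm_sum_smul_covSeq_le (h : PowBound M c r) (hγ : 0 ≤ γ) (hγ1 : γ < 1)
    (D : Matrix (Fin n) (Fin n) ℝ) (N : ℕ) :
    ‖∑ t ∈ Finset.range N, γ ^ t • covSeq M D t‖ ≤ c ^ 2 / (1 - r ^ 2) * ‖D‖ / (1 - γ) := by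
  calc _ ≤ ∑ t ∈ Finset.range N, c ^ 2 / (1 - r ^ 2) * ‖D‖ * γ ^ t :=
        (norm_sum_le _ _).trans (Finset.sum_le_sum fun t _ => h.norm_smul_covSeq_le hγ D t)
    _ ≤ ∑' t, c ^ 2 / (1 - r ^ 2) * ‖D‖ * γ ^ t :=
        ((summable_geometric_of_lt_one hγ hγ1).mul_left _).sum_le_tsum _ fun t _ =>
          mul_nonneg (mul_nonneg h.gap_nonneg (norm_nonneg _)) (pow_nonneg hγ t)
    _ = _ := by rw [tsum_mul_left, tsum_geometric_of_lt_one hγ hγ1, div_eq_mul_inv _ (1 - γ)]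

lemma norm_smul_sandwich_le (h : PowBound M c r) (hγ : 0 ≤ γ) (hγ1 : γ < 1)
    (Q : Matrix (Fin n) (Fin n) ℝ) (t : ℕ) :
    ‖γ ^ t • ((M ^ t)ᵀ * Q * M ^ t)‖ ≤ c ^ 2 * ‖Q‖ * (r ^ 2) ^ t := by
  rw [norm_smul, Real.norm_of_nonneg (pow_nonneg hγ t)]
  have h1 := norm_mul_le ((M ^ t)ᵀ * Q) (M ^ t)
  have h2 := norm_mul_le (M ^ t)ᵀ Q
  rw [l2_opNorm_transpose] at h2
  calc _ ≤ 1 * (‖M ^ t‖ ^ 2 * ‖Q‖) :=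
        mul_le_mul (pow_le_one₀ hγ hγ1.le) (by nlinarith [norm_nonneg (M ^ t)]) (norm_nonneg _)
          zero_le_one
    _ ≤ (c * r ^ t) ^ 2 * ‖Q‖ := by
        rw [one_mul]
        gcongr
        exact h.norm_pow_le t
    _ = _ := by ring

lemma hasSum_valueMat (h : PowBound M c r) (hγ : 0 ≤ γ) (hγ1 : γ < 1)
    (Q : Matrix (Fin n) (Fin n) ℝ) :
    HasSum (fun t : ℕ => γ ^ t • ((M ^ t)ᵀ * Q * M ^ t)) (valueMat M Q γ) :=
  (Summable.of_norm_bounded ((summable_geometric_of_lt_one (sq_nonneg r) h.sq_lt_one).mul_left _)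
    fun t => h.norm_smul_sandwich_le hγ hγ1 Q t).hasSum

lemma norm_valueMat_le (h : PowBound M c r) (hγ : 0 ≤ γ) (hγ1 : γ < 1)
    (Q : Matrix (Fin n) (Fin n) ℝ) : ‖valueMat M Q γ‖ ≤ c ^ 2 / (1 - r ^ 2) * ‖Q‖ := by
  refine (tsum_of_norm_bounded ((hasSum_geometric_of_lt_one (sq_nonneg r) h.sq_lt_one).mul_left _)
    fun t => h.norm_smul_sandwich_le hγ hγ1 Q t).trans_eq ?_
  rw [div_eq_mul_inv]; ring

lemma valueMat_transpose (h : PowBound M c r) (hγ : 0 ≤ γ) (hγ1 : γ < 1) (hQ : Q.IsSymm) :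
    (valueMat M Q γ)ᵀ = valueMat M Q γ := by
  have h1 := (h.hasSum_valueMat hγ hγ1 Q).matrix_transpose
  simp only [transpose_smul, transpose_mul, transpose_transpose, hQ.eq, ← mul_assoc] at h1
  exact h1.unique (h.hasSum_valueMat hγ hγ1 Q)

lemma valueMat_posSemidef (h : PowBound M c r) (hγ : 0 ≤ γ) (hγ1 : γ < 1) (hQ : Q.PosSemidef) :
    (valueMat M Q γ).PosSemidef := by
  have hsymm : Q.IsSymm := by simpa using hQ.1
  refine .of_dotProduct_mulVec_nonneg (by simpa [IsSymm] using h.valueMat_transpose hγ hγ1 hsymm) fun x => ?_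
  refine ((h.hasSum_valueMat hγ hγ1 Q).dotProduct_mulVec (star x) x).nonneg fun t => ?_
  have := (hQ.conjTranspose_mul_mul_same (M ^ t)).smul (pow_nonneg hγ t)
  simpa using this.dotProduct_mulVec_nonneg x

lemma valueMat_eq (h : PowBound M c r) (hγ : 0 ≤ γ) (hγ1 : γ < 1) (Q : Matrix (Fin n) (Fin n) ℝ) :
    valueMat M Q γ = Q + γ • (Mᵀ * valueMat M Q γ * M) := by
  have h1 := ((h.hasSum_valueMat hγ hγ1 Q).matrix_mul_mul Mᵀ M).const_smul γ
  have h3 := (hasSum_nat_add_iff' 1).2 (h.hasSum_valueMat hγ hγ1 Q)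
  simp only [Finset.range_one, Finset.sum_singleton, pow_zero, transpose_one, one_mul, mul_one,
    one_smul] at h3
  rw [← sub_eq_iff_eq_add']
  have e : (fun t : ℕ => γ ^ (t + 1) • ((M ^ (t + 1))ᵀ * Q * M ^ (t + 1))) =
      fun t => γ • (Mᵀ * γ ^ t • ((M ^ t)ᵀ * Q * M ^ t) * M) := by
    funext t
    rw [Matrix.mul_smul, Matrix.smul_mul, smul_smul, pow_succ' γ, pow_succ M, transpose_mul]
    simp only [mul_assoc]
  rw [e] at h3
  exact h3.unique h1

/-- Duality: X ↦ X - γMᵀXM and Y ↦ Y - γMYMᵀ are adjoint under the trace pairing, and the two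
Lyapunov equations express Q and D through them. -/
lemma trace_mul_discCov (h : PowBound M c r) (hγ : 0 ≤ γ) (hγ1 : γ < 1)
    (Q D : Matrix (Fin n) (Fin n) ℝ) :
    (Q * discCov M D γ).trace = γ / (1 - γ) * (valueMat M Q γ * D).trace := by
  have h1 := h.valueMat_eq hγ hγ1 Q
  have h2 := h.discCov_eq hγ hγ1 D
  set X := valueMat M Q γ
  set Y := discCov M D γ
  have hQ : Q = X - γ • (Mᵀ * X * M) := by rw [eq_sub_iff_add_eq]; exact h1.symm
  have hD : (γ / (1 - γ)) • D = Y - γ • (M * Y * Mᵀ) := by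
    rw [eq_sub_iff_add_eq, add_comm]; exact h2.symm
  have h3 : γ / (1 - γ) * (X * D).trace = (X * ((γ / (1 - γ)) • D)).trace := by simp
  rw [h3, hD]
  conv_lhs => rw [hQ]
  have h4 : (Mᵀ * X * M * Y).trace = (X * (M * Y * Mᵀ)).trace := by
    rw [mul_assoc, mul_assoc, trace_mul_comm]
    simp only [mul_assoc]
  simp [sub_mul, mul_sub, h4]

/-- Comparison of the discounted costs of two closed loops through the value matrix of one. -/
lemma trace_mul_discCov_sub {M' Q' : Matrix (Fin n) (Fin n) ℝ} {c' r' : ℝ} (h : PowBound M c r)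
    (h' : PowBound M' c' r') (hγ : 0 ≤ γ) (hγ1 : γ < 1) (Q D : Matrix (Fin n) (Fin n) ℝ) :
    (Q' * discCov M' D γ).trace - (Q * discCov M D γ).trace =
      ((Q' - Q + γ • (M'ᵀ * valueMat M Q γ * M' - Mᵀ * valueMat M Q γ * M)) *
        discCov M' D γ).trace := by
  have h1 := h.valueMat_eq hγ hγ1 Q
  rw [h.trace_mul_discCov hγ hγ1 Q D]
  have h2 := h'.discCov_eq hγ hγ1 D
  set X := valueMat M Q γ
  set Y := discCov M' D γ
  -- The equation of M is used for Q and that of M' for D, so the comparison is exact rather than of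
  -- first order.
  have hQ : γ • (Mᵀ * X * M) = X - Q := by rw [eq_sub_iff_add_eq, add_comm]; exact h1.symm
  have hD : (γ / (1 - γ)) • D = Y - γ • (M' * Y * M'ᵀ) := by
    rw [eq_sub_iff_add_eq, add_comm]; exact h2.symm
  have h3 : γ / (1 - γ) * (X * D).trace = (X * ((γ / (1 - γ)) • D)).trace := by simp
  have h4 : (M'ᵀ * X * M' * Y).trace = (X * (M' * Y * M'ᵀ)).trace := by
    rw [mul_assoc, mul_assoc, trace_mul_comm]
    simp only [mul_assoc]
  rw [h3, hD, smul_sub, hQ]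
  simp only [sub_mul, add_mul, mul_sub, trace_sub, trace_add, Matrix.smul_mul,
    Matrix.mul_smul, trace_smul, h4, smul_eq_mul]
  ring

/-- The left side is a partial sum of a convergent series whose terms are positive semidefinite,
hence of nonnegative trace. -/
lemma trace_covSeq_le (h : PowBound M c r) (hD : D.PosSemidef) (t : ℕ) :
    (covSeq M D t).trace ≤ (∑' i : ℕ, M ^ i * D * (M ^ i)ᵀ).trace := by
  have hs : Summable fun i : ℕ => M ^ i * D * (M ^ i)ᵀ := by
    refine Summable.of_norm_bounded
      ((summable_geometric_of_lt_one (sq_nonneg r) h.sq_lt_one).mul_left (c ^ 2 * ‖D‖)) fun i => ?_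
    have h1 := norm_mul_le (M ^ i * D) (M ^ i)ᵀ
    have h2 := norm_mul_le (M ^ i) D
    rw [l2_opNorm_transpose] at h1
    calc _ ≤ ‖M ^ i‖ ^ 2 * ‖D‖ := by nlinarith [norm_nonneg (M ^ i)]
      _ ≤ (c * r ^ i) ^ 2 * ‖D‖ := by gcongr; exact h.norm_pow_le i
      _ = _ := by ring
  have h1 := hs.hasSum.trace_mul 1
  simp only [one_mul] at h1
  rw [covSeq, trace_sum]
  refine sum_le_hasSum _ (fun i _ => ?_) h1
  have := (hD.mul_mul_conjTranspose_same (M ^ i)).trace_nonneg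
  simpa using this

/-- Closed loops near a stable one are uniformly stable. -/
lemma eventually {α : Type*} [TopologicalSpace α] {f : α → Matrix (Fin n) (Fin n) ℝ} {a : α}
    (h : PowBound (f a) c r) (hf : ContinuousAt f a) :
    ∀ᶠ b in nhds a, PowBound (f b) c ((1 + r) / 2) := by
  have hlim : Filter.Tendsto (fun b => r + c * ‖f b - f a‖) (nhds a) (nhds r) := by
    have : ContinuousAt (fun b => r + c * ‖f b - f a‖) a := by fun_prop
    simpa [ContinuousAt] using this
  -- The rate (1 + r)/2 is any fixed number strictly between r and 1; `norm_add_pow_le` gives rate r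
  -- + c‖f b - f a‖, which drops below it near a, with c unchanged.
  have hr := h.lt_one
  have hr0 := h.nonneg
  filter_upwards [hlim.eventually_le_const (show r < (1 + r) / 2 by linarith)] with b hb
  refine ⟨by linarith, by linarith, fun k => ?_⟩
  have h1 := norm_add_pow_le (F := f b - f a) h.const_nonneg h.nonneg h.norm_pow_le k
  rw [add_sub_cancel] at h1
  have h0 : 0 ≤ r + c * ‖f b - f a‖ := add_nonneg hr0 (mul_nonneg h.const_nonneg (norm_nonneg _))
  exact h1.trans (mul_le_mul_of_nonneg_left (pow_le_pow_left₀ h0 hb k) h.const_nonneg)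

/-- Dominated convergence for series: each term is polynomial in the closed loop, and the uniform
stability of nearby closed loops supplies one geometric majorant. -/
lemma continuousAt_discCov {α : Type*} [TopologicalSpace α] {f : α → Matrix (Fin n) (Fin n) ℝ}
    {a : α} (h : PowBound (f a) c r) (hf : ContinuousAt f a) (hγ : 0 ≤ γ) (hγ1 : γ < 1)
    (D : Matrix (Fin n) (Fin n) ℝ) : ContinuousAt (fun b => discCov (f b) D γ) a := by
  refine tendsto_tsum_of_dominated_convergence
    (bound := fun t => c ^ 2 / (1 - ((1 + r) / 2) ^ 2) * ‖D‖ * γ ^ t)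
    ((summable_geometric_of_lt_one hγ hγ1).mul_left _) (fun t => ?_) ?_
  · have : ContinuousAt (fun b => γ ^ t • covSeq (f b) D t) a := by
      unfold covSeq
      fun_prop
    exact this
  · filter_upwards [h.eventually hf] with b hb t
    exact hb.norm_smul_covSeq_le hγ D t

end PowBound

end Lyapunov

/-! ### Random variables with moments of all orders -/

section Moments

variable {Ω : Type*} [MeasurableSpace Ω] {P : Measure Ω}

/-- `f` has finite moments of all orders. -/
def HasMoments (f : Ω → ℝ) (P : Measure Ω) : Prop := ∀ p : ℕ, MemLp f p P

namespace HasMoments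

variable {f g : Ω → ℝ}

lemma integrable (hf : HasMoments f P) : Integrable f P :=
  memLp_one_iff_integrable.1 (by simpa using hf 1)

lemma aestronglyMeasurable (hf : HasMoments f P) : AEStronglyMeasurable f P :=
  hf.integrable.aestronglyMeasurable

lemma const [IsFiniteMeasure P] (c : ℝ) : HasMoments (fun _ : Ω => c) P :=
  fun _ => memLp_const c

lemma add (hf : HasMoments f P) (hg : HasMoments g P) : HasMoments (fun a => f a + g a) P :=
  fun p => (hf p).add (hg p)

lemma sub (hf : HasMoments f P) (hg : HasMoments g P) : HasMoments (fun a => f a - g a) P :=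
  fun p => (hf p).sub (hg p)

/-- Hölder with exponents 2p and 2p. Closure under products makes every polynomial in the states and
the noises integrable. -/
lemma mul (hf : HasMoments f P) (hg : HasMoments g P) : HasMoments (fun a => f a * g a) P := by
  intro p
  have : ENNReal.HolderTriple ((2 * p : ℕ) : ENNReal) ((2 * p : ℕ) : ENNReal) (p : ENNReal) := by
    refine ⟨?_⟩
    push_cast
    rw [ENNReal.mul_inv (by simp) (by simp), ← add_mul, ENNReal.inv_two_add_inv_two, one_mul]
  exact (hg (2 * p)).mul' (hf (2 * p))

lemma const_mul (hf : HasMoments f P) (c : ℝ) : HasMoments (fun a => c * f a) P :=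
  fun p => (hf p).const_mul c

lemma pow [IsFiniteMeasure P] (hf : HasMoments f P) (k : ℕ) : HasMoments (fun a => f a ^ k) P := by
  induction k with
  | zero => simpa using const (P := P) 1
  | succ k ih => simpa [pow_succ] using ih.mul hf

lemma sum {ι : Type*} (s : Finset ι) {F : ι → Ω → ℝ} (h : ∀ i ∈ s, HasMoments (F i) P) :
    HasMoments (fun a => ∑ i ∈ s, F i a) P :=
  fun p => memLp_finsetSum s fun i hi => h i hi p

lemma mulVec {m k : ℕ} (X : Matrix (Fin m) (Fin k) ℝ) {F : Ω → Fin k → ℝ}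
    (h : ∀ i, HasMoments (fun a => F a i) P) (i : Fin m) :
    HasMoments (fun a => (X *ᵥ F a) i) P :=
  sum Finset.univ fun j _ => (h j).const_mul (X i j)

lemma dotProduct {k : ℕ} {F G : Ω → Fin k → ℝ} (hF : ∀ i, HasMoments (fun a => F a i) P)
    (hG : ∀ i, HasMoments (fun a => G a i) P) : HasMoments (fun a => F a ⬝ᵥ G a) P :=
  sum _ fun j _ => (hF j).mul (hG j)

lemma norm_toLp {k : ℕ} {F : Ω → Fin k → ℝ} (hF : ∀ i, HasMoments (fun a => F a i) P) :
    HasMoments (fun a => ‖WithLp.toLp 2 (F a)‖) P := by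
  intro p
  have h : MemLp (fun a => WithLp.toLp 2 (F a)) p P := by
    have : (fun a => WithLp.toLp 2 (F a)) =
        fun a => ∑ i, F a i • (EuclideanSpace.basisFun (Fin k) ℝ i) := by
      funext a
      ext j
      simp [Finset.sum_apply, Pi.single_apply]
    rw [this]
    exact memLp_finsetSum _ fun i _ =>
      (memLp_top_const
        (EuclideanSpace.basisFun (Fin k) ℝ i)).smul (hF i p)
  exact h.norm

end HasMoments

lemma integral_sum_sum_mul {ι κ : Type*} [Fintype ι] [Fintype κ] {F : ι → Ω → ℝ} {G : κ → Ω → ℝ}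
    (hF : ∀ i, HasMoments (F i) P) (hG : ∀ j, HasMoments (G j) P) (c : ι → κ → ℝ) :
    ∫ a, ∑ i, ∑ j, c i j * (F i a * G j a) ∂P = ∑ i, ∑ j, c i j * ∫ a, F i a * G j a ∂P := by
  rw [integral_finsetSum _ fun i _ => integrable_finsetSum _ fun j _ =>
    (((hF i).mul (hG j)).const_mul _).integrable]
  refine Finset.sum_congr rfl fun i _ => ?_
  rw [integral_finsetSum _ fun j _ => (((hF i).mul (hG j)).const_mul _).integrable]
  simp only [integral_const_mul]

lemma ProbabilityTheory.IndepFun.integral_dotProduct_mulVec {m k : ℕ} [IsFiniteMeasure P]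
    {F : Ω → Fin m → ℝ} {G : Ω → Fin k → ℝ} (h : IndepFun F G P)
    (hF : ∀ i, HasMoments (fun a => F a i) P) (hG : ∀ i, HasMoments (fun a => G a i) P)
    (hG0 : ∀ i, ∫ a, G a i ∂P = 0) (X : Matrix (Fin m) (Fin k) ℝ) :
    ∫ a, F a ⬝ᵥ X *ᵥ G a ∂P = 0 := by
  have h1 : ∀ a, F a ⬝ᵥ X *ᵥ G a = ∑ i, ∑ j, X i j * (F a i * G a j) := fun a => by
    simp only [_root_.dotProduct, Matrix.mulVec, Finset.mul_sum]
    exact Finset.sum_congr rfl fun i _ => Finset.sum_congr rfl fun j _ => by ring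
  simp only [h1]
  refine (integral_sum_sum_mul hF hG fun i j => X i j).trans ?_
  refine Finset.sum_eq_zero fun i _ => Finset.sum_eq_zero fun j _ => ?_
  have hij : IndepFun (fun a => F a i) (fun a => G a j) P :=
    h.comp (measurable_pi_apply i) (measurable_pi_apply j)
  rw [hij.integral_fun_mul_eq_mul_integral (hF i).aestronglyMeasurable
    (hG j).aestronglyMeasurable, hG0 j]
  ring

/-- The expectation of a quadratic form in terms of the second moments. -/
lemma integral_dotProduct_mulVec_eq_trace {k : ℕ} {F : Ω → Fin k → ℝ}
    (hF : ∀ i, HasMoments (fun a => F a i) P) {X : Matrix (Fin k) (Fin k) ℝ} (hXs : X.IsSymm)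
    (hX : ∀ i j, ∫ a, F a i * F a j ∂P = X i j) (Q : Matrix (Fin k) (Fin k) ℝ) :
    ∫ a, F a ⬝ᵥ Q *ᵥ F a ∂P = (Q * X).trace := by
  have h1 : ∀ a, F a ⬝ᵥ Q *ᵥ F a = ∑ i, ∑ j, Q i j * (F a i * F a j) := fun a => by
    simp only [_root_.dotProduct, Matrix.mulVec, Finset.mul_sum]
    exact Finset.sum_congr rfl fun i _ => Finset.sum_congr rfl fun j _ => by ring
  simp only [h1]
  refine (integral_sum_sum_mul hF hF fun i j => Q i j).trans ?_
  simp only [trace, hX, diag_apply, mul_apply]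
  exact Finset.sum_congr rfl fun i _ => Finset.sum_congr rfl fun j _ => by rw [hXs.apply]

end Moments

/-! ### Centered Gaussian vectors -/

section Gaussian

variable {Ω : Type*} [MeasurableSpace Ω] {P : Measure Ω} {k : ℕ}
  {X : Ω → EuclideanSpace ℝ (Fin k)} {S : Matrix (Fin k) (Fin k) ℝ}

namespace ProbabilityTheory.HasLaw

lemma gaussian_memLp (hX : HasLaw X (multivariateGaussian 0 S) P) (p : ℕ) : MemLp X p P := by
  have h := IsGaussian.memLp_id (multivariateGaussian 0 S) p (ENNReal.natCast_ne_top p)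
  rw [← hX.map_eq] at h
  exact (memLp_map_measure_iff (by fun_prop) hX.aemeasurable).1 h

lemma gaussian_hasMoments (hX : HasLaw X (multivariateGaussian 0 S) P) (i : Fin k) :
    HasMoments (fun a => X a i) P := fun p =>
  (EuclideanSpace.proj (𝕜 := ℝ) i : EuclideanSpace ℝ (Fin k) →L[ℝ] ℝ).comp_memLp'
    (hX.gaussian_memLp p)

lemma gaussian_integral_eq_zero (hX : HasLaw X (multivariateGaussian 0 S) P) (i : Fin k) :
    ∫ a, X a i ∂P = 0 := by
  have h1 := hX.integral_eq
  rw [integral_id_multivariateGaussian] at h1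
  have h2 := (EuclideanSpace.proj (𝕜 := ℝ) i : EuclideanSpace ℝ (Fin k) →L[ℝ] ℝ).integral_comp_comm
    (memLp_one_iff_integrable.1 (by simpa using hX.gaussian_memLp 1))
  rw [h1] at h2
  simpa using h2

lemma gaussian_integral_mul (hX : HasLaw X (multivariateGaussian 0 S) P) [IsProbabilityMeasure P]
    (hS : S.PosSemidef) (i j : Fin k) : ∫ a, X a i * X a j ∂P = S i j := by
  have h1 := hX.covariance_fun_comp (f := fun x => x i) (g := fun x => x j) (by fun_prop)
    (by fun_prop)
  rw [covariance_eval_multivariateGaussian hS, covariance_eq_sub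
    (by simpa using hX.gaussian_hasMoments i 2) (by simpa using hX.gaussian_hasMoments j 2)] at h1
  simpa [hX.gaussian_integral_eq_zero] using h1

end ProbabilityTheory.HasLaw

lemma map_neg_stdGaussian :
    (stdGaussian (EuclideanSpace ℝ (Fin k))).map (fun x => -x) =
      stdGaussian (EuclideanSpace ℝ (Fin k)) := by
  have := stdGaussian_map (LinearIsometryEquiv.neg ℝ (E := EuclideanSpace ℝ (Fin k)))
  simpa using this

/-- The centered Gaussian is a linear image of the standard one, which is invariant under the
isometry x ↦ -x. This symmetry singles out the odd part of the temporal difference. -/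
lemma map_neg_multivariateGaussian (S : Matrix (Fin k) (Fin k) ℝ) :
    (multivariateGaussian 0 S).map (fun x => -x) = multivariateGaussian 0 S := by
  rw [multivariateGaussian, Measure.map_map (by fun_prop) (by fun_prop)]
  conv_rhs => rw [← map_neg_stdGaussian, Measure.map_map (by fun_prop) (by fun_prop)]
  congr 1
  funext x
  simp

/-- The `p`-th absolute moment of the standard Gaussian vector in dimension `k`. -/
def stdMoment (k p : ℕ) : ℝ := ∫ x, ‖x‖ ^ p ∂(stdGaussian (EuclideanSpace ℝ (Fin k)))

lemma stdMoment_nonneg (k p : ℕ) : 0 ≤ stdMoment k p := integral_nonneg fun _ => by positivity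

-- The vector has the law of √S applied to a standard Gaussian, and ‖√S‖² = ‖S‖; the remaining
-- constant depends on the dimension and the exponent alone.
open scoped MatrixOrder in
lemma ProbabilityTheory.HasLaw.gaussian_integral_norm_pow_le
    (hX : HasLaw X (multivariateGaussian 0 S) P) (hS : S.PosSemidef) (p : ℕ) :
    ∫ a, ‖X a‖ ^ (2 * p) ∂P ≤ ‖S‖ ^ p * stdMoment k (2 * p) := by
  have h1 := hX.integral_comp (f := fun x => ‖x‖ ^ (2 * p)) (by fun_prop)
  have h2 : ∫ a, ‖X a‖ ^ (2 * p) ∂P = ∫ x, ‖x‖ ^ (2 * p) ∂(multivariateGaussian 0 S) := h1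
  rw [h2, multivariateGaussian, integral_map (by fun_prop) (by fun_prop), stdMoment,
    ← integral_const_mul]
  have hmem := IsGaussian.memLp_id (stdGaussian (EuclideanSpace ℝ (Fin k))) (2 * p : ℕ)
    (ENNReal.natCast_ne_top _)
  have hint : Integrable (fun x => ‖x‖ ^ (2 * p)) (stdGaussian (EuclideanSpace ℝ (Fin k))) :=
    hmem.integrable_norm_pow'
  have hbd : ∀ x : EuclideanSpace ℝ (Fin k),
      ‖0 + toEuclideanCLM (𝕜 := ℝ) (CFC.sqrt S) x‖ ^ (2 * p) ≤ ‖S‖ ^ p * ‖x‖ ^ (2 * p) := by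
    intro x
    have hn : ‖CFC.sqrt S‖ ^ 2 = ‖S‖ := by
      have hh : (CFC.sqrt S).IsHermitian := by
        exact (CFC.sqrt_nonneg S).isSelfAdjoint
      have hs : CFC.sqrt S * CFC.sqrt S = S := by
        exact CFC.sqrt_mul_sqrt_self S hS.nonneg
      conv_rhs => rw [← hs]
      rw [sq, ← l2_opNorm_conjTranspose_mul_self, hh.eq]
    rw [zero_add, pow_mul, pow_mul ‖x‖, ← mul_pow, ← hn, ← mul_pow]
    gcongr
    exact l2_opNorm_mulVec (CFC.sqrt S) x
  refine integral_mono_of_nonneg (ae_of_all _ fun x => by positivity) (hint.const_mul _)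
    (ae_of_all _ hbd)

end Gaussian

/-! ### Moments of linear images. -/

section

variable {Ω : Type*} [MeasurableSpace Ω] {P : Measure Ω}

lemma measurable_ofLp_apply {k : ℕ} (i : Fin k) :
    Measurable fun x : EuclideanSpace ℝ (Fin k) => x.ofLp i := by fun_prop

lemma measurable_mulVec_apply {m k : ℕ} (X : Matrix (Fin m) (Fin k) ℝ) (i : Fin m) :
    Measurable fun x : Fin k → ℝ => (X *ᵥ x) i := Continuous.measurable (by fun_prop)

lemma integral_mulVec_eq_zero {m k : ℕ} {F : Ω → Fin k → ℝ}
    (hF : ∀ i, HasMoments (fun a => F a i) P) (hF0 : ∀ i, ∫ a, F a i ∂P = 0)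
    (X : Matrix (Fin m) (Fin k) ℝ) (i : Fin m) : ∫ a, (X *ᵥ F a) i ∂P = 0 := by
  simp only [mulVec, dotProduct]
  rw [integral_finsetSum _ fun j _ => ((hF j).const_mul _).integrable]
  simp [integral_const_mul, hF0]

/-- Second moments of a linear image. -/
lemma integral_mulVec_mul_mulVec {m k l : ℕ} {F : Ω → Fin k → ℝ} {G : Ω → Fin l → ℝ}
    (hF : ∀ i, HasMoments (fun a => F a i) P) (hG : ∀ i, HasMoments (fun a => G a i) P)
    {C : Matrix (Fin k) (Fin l) ℝ} (hC : ∀ i j, ∫ a, F a i * G a j ∂P = C i j)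
    (X : Matrix (Fin m) (Fin k) ℝ) {m' : ℕ} (Y : Matrix (Fin m') (Fin l) ℝ) (i : Fin m)
    (j : Fin m') :
    ∫ a, (X *ᵥ F a) i * (Y *ᵥ G a) j ∂P = (X * C * Yᵀ) i j := by
  have h1 : ∀ a, (X *ᵥ F a) i * (Y *ᵥ G a) j =
      ∑ p, ∑ q, X i p * Y j q * (F a p * G a q) := fun a => by
    simp only [mulVec, dotProduct, Finset.sum_mul_sum]
    exact Finset.sum_congr rfl fun p _ => Finset.sum_congr rfl fun q _ => by ring
  simp only [h1]
  rw [integral_sum_sum_mul hF hG fun p q => X i p * Y j q, Finset.sum_comm]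
  simp only [hC, mul_apply, transpose_apply, Finset.sum_mul]
  exact Finset.sum_congr rfl fun p _ => Finset.sum_congr rfl fun q _ => by ring

end

/-! ### The state process and its second moments. -/

namespace LQR

variable {n d : ℕ} (sys : LQR n d) (K : Matrix (Fin d) (Fin n) ℝ)

/-- The closed-loop noise `B η_t + ω_t`. -/
def innov {Ω : Type*} (w : ℕ → Ω → EuclideanSpace ℝ (Fin n))
    (η : ℕ → Ω → EuclideanSpace ℝ (Fin d)) (t : ℕ) (a : Ω) : Fin n → ℝ :=
  sys.B *ᵥ (η t a).ofLp + (w t a).ofLp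

lemma state_zero {Ω : Type*} (w : ℕ → Ω → EuclideanSpace ℝ (Fin n))
    (η : ℕ → Ω → EuclideanSpace ℝ (Fin d)) (x0 : Fin n → ℝ) (a : Ω) :
    sys.state K w η x0 0 a = x0 := rfl

lemma state_succ {Ω : Type*} (w : ℕ → Ω → EuclideanSpace ℝ (Fin n))
    (η : ℕ → Ω → EuclideanSpace ℝ (Fin d)) (x0 : Fin n → ℝ) (t : ℕ) (a : Ω) :
    sys.state K w η x0 (t + 1) a =
      sys.closedLoop K *ᵥ sys.state K w η x0 t a + sys.innov w η t a := by
  rw [state, innov, closedLoop, add_mulVec, mulVec_add, mulVec_mulVec]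
  abel

/-- The state at time t sees only the noise before t. Two sample spaces are allowed so that the
recursion can be rerun on a space of noise histories. -/
lemma state_congr {Ω Ω' : Type*} {w : ℕ → Ω → EuclideanSpace ℝ (Fin n)}
    {η : ℕ → Ω → EuclideanSpace ℝ (Fin d)} {w' : ℕ → Ω' → EuclideanSpace ℝ (Fin n)}
    {η' : ℕ → Ω' → EuclideanSpace ℝ (Fin d)} (x0 : Fin n → ℝ) (a : Ω) (b : Ω') (t : ℕ)
    (h : ∀ s < t, w s a = w' s b ∧ η s a = η' s b) :
    sys.state K w η x0 t a = sys.state K w' η' x0 t b := by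
  induction t with
  | zero => rfl
  | succ t ih =>
    rw [state_succ, state_succ, ih fun s hs => h s (by omega), innov, innov, (h t (by omega)).1,
      (h t (by omega)).2]

lemma measurable_state {Ω : Type*} [MeasurableSpace Ω] {w : ℕ → Ω → EuclideanSpace ℝ (Fin n)}
    {η : ℕ → Ω → EuclideanSpace ℝ (Fin d)} (hw : ∀ t, Measurable (w t))
    (hη : ∀ t, Measurable (η t)) (x0 : Fin n → ℝ) (t : ℕ) :
    Measurable (sys.state K w η x0 t) := by
  induction t with
  | zero => exact measurable_const
  | succ t ih =>
    have e : sys.state K w η x0 (t + 1) = fun a =>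
        sys.closedLoop K *ᵥ sys.state K w η x0 t a +
          (sys.B *ᵥ (η t a).ofLp + (w t a).ofLp) := funext fun a => sys.state_succ K w η x0 t a
    rw [e]
    have h1 : ∀ {m k : ℕ} (X : Matrix (Fin m) (Fin k) ℝ), Measurable fun x : Fin k → ℝ => X *ᵥ x :=
      fun X => Continuous.measurable (by fun_prop)
    have h2 : ∀ {k : ℕ}, Measurable fun x : EuclideanSpace ℝ (Fin k) => x.ofLp :=
      fun {k} => Continuous.measurable (by fun_prop)
    exact ((h1 _).comp ih).add (((h1 _).comp (h2.comp (hη t))).add (h2.comp (hw t)))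

lemma noiseCov_posSemidef : sys.noiseCov.PosSemidef := by
  refine Matrix.PosSemidef.add (PosSemidef.smul ?_ (sq_nonneg _)) sys.posSemidef_Dω
  simpa using posSemidef_self_mul_conjTranspose sys.B

lemma noiseCov_isSymm : sys.noiseCov.IsSymm := by
  simpa using sys.noiseCov_posSemidef.1

lemma posSemidef_exploration (sys : LQR n d) :
    (sys.σ ^ 2 • (1 : Matrix (Fin d) (Fin d) ℝ)).PosSemidef :=
  PosSemidef.one.smul (sq_nonneg _)

namespace IsNoise

variable {sys} {Ω : Type*} [MeasurableSpace Ω] {P : Measure Ω}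
  {w : ℕ → Ω → EuclideanSpace ℝ (Fin n)} {η : ℕ → Ω → EuclideanSpace ℝ (Fin d)}

lemma hasMoments_w (h : sys.IsNoise P w η) (t : ℕ) (i : Fin n) :
    HasMoments (fun a => (w t a).ofLp i) P := (h.law_w t).gaussian_hasMoments i

lemma hasMoments_η (h : sys.IsNoise P w η) (t : ℕ) (i : Fin d) :
    HasMoments (fun a => (η t a).ofLp i) P := (h.law_η t).gaussian_hasMoments i

lemma integral_w_eq_zero (h : sys.IsNoise P w η) (t : ℕ) (i : Fin n) :
    ∫ a, (w t a).ofLp i ∂P = 0 := (h.law_w t).gaussian_integral_eq_zero i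

lemma integral_η_eq_zero (h : sys.IsNoise P w η) (t : ℕ) (i : Fin d) :
    ∫ a, (η t a).ofLp i ∂P = 0 := (h.law_η t).gaussian_integral_eq_zero i

variable [IsProbabilityMeasure P]

/-- The state at time t is a measurable function of the noise pairs at times s < t, which are
jointly independent of the pair at time t. -/
lemma indepFun_state (h : sys.IsNoise P w η) (x0 : Fin n → ℝ) (t : ℕ) :
    IndepFun (sys.state K w η x0 t) (fun a => (w t a, η t a)) P := by
  have hae : ∀ s, AEMeasurable (fun a => (w s a, η s a)) P := fun s =>
    (h.law_w s).aemeasurable.prodMk (h.law_η s).aemeasurable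
  have h1 := h.indep_time.indepFun_finset₀ (Finset.range t) {t} (by simp) hae
  let V := (i : Finset.range t) → EuclideanSpace ℝ (Fin n) × EuclideanSpace ℝ (Fin d)
  -- Coordinate processes on the space of histories before t. The value 0 at later times is never
  -- read by the state at time t.
  let w' : ℕ → V → EuclideanSpace ℝ (Fin n) := fun s v =>
    if hs : s ∈ Finset.range t then (v ⟨s, hs⟩).1 else 0
  let η' : ℕ → V → EuclideanSpace ℝ (Fin d) := fun s v =>
    if hs : s ∈ Finset.range t then (v ⟨s, hs⟩).2 else 0
  have hw' : ∀ s, Measurable (w' s) := fun s => by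
    by_cases hs : s ∈ Finset.range t
    · simp only [w', hs, dite_true]; fun_prop
    · simp only [w', hs, dite_false]; fun_prop
  have hη' : ∀ s, Measurable (η' s) := fun s => by
    by_cases hs : s ∈ Finset.range t
    · simp only [η', hs, dite_true]; fun_prop
    · simp only [η', hs, dite_false]; fun_prop
  have h2 := h1.comp (sys.measurable_state K hw' hη' x0 t)
    (measurable_pi_apply (⟨t, Finset.mem_singleton_self t⟩ : ({t} : Finset ℕ)))
  convert h2 using 1
  · funext a
    refine sys.state_congr K x0 a _ t fun s hs => ?_
    simp [w', η', hs]
  · rfl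

lemma indepFun_state_innov (h : sys.IsNoise P w η) (x0 : Fin n → ℝ) (t : ℕ) :
    IndepFun (sys.state K w η x0 t) (sys.innov w η t) P := by
  have hψ : Measurable fun y : EuclideanSpace ℝ (Fin n) × EuclideanSpace ℝ (Fin d) =>
      sys.B *ᵥ y.2.ofLp + y.1.ofLp := Continuous.measurable (by fun_prop)
  exact (h.indepFun_state K x0 t).comp measurable_id hψ

lemma hasMoments_innov (h : sys.IsNoise P w η) (t : ℕ) (i : Fin n) :
    HasMoments (fun a => sys.innov w η t a i) P :=
  (HasMoments.mulVec sys.B (F := fun a => (η t a).ofLp) (h.hasMoments_η t) i).add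
    (h.hasMoments_w t i)

lemma hasMoments_state (h : sys.IsNoise P w η) (x0 : Fin n → ℝ) (t : ℕ) (i : Fin n) :
    HasMoments (fun a => sys.state K w η x0 t a i) P := by
  induction t generalizing i with
  | zero => exact HasMoments.const _
  | succ t ih =>
    simp only [state_succ]
    exact (HasMoments.mulVec _ ih i).add (h.hasMoments_innov t i)

lemma integral_η_mul_η (h : sys.IsNoise P w η) (t : ℕ) (i j : Fin d) :
    ∫ a, (η t a).ofLp i * (η t a).ofLp j ∂P = sys.σ ^ 2 * (1 : Matrix (Fin d) (Fin d) ℝ) i j :=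
  (h.law_η t).gaussian_integral_mul sys.posSemidef_exploration i j

lemma integral_w_mul_η (h : sys.IsNoise P w η) (t : ℕ) (i : Fin n) (j : Fin d) :
    ∫ a, (w t a).ofLp i * (η t a).ofLp j ∂P = 0 := by
  have hi : IndepFun (fun a => (w t a).ofLp i) (fun a => (η t a).ofLp j) P :=
    (h.indep_pair t).comp (measurable_ofLp_apply i) (measurable_ofLp_apply j)
  rw [hi.integral_fun_mul_eq_mul_integral (h.hasMoments_w t i).aestronglyMeasurable
    (h.hasMoments_η t j).aestronglyMeasurable, h.integral_η_eq_zero, mul_zero]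

lemma integral_innov_eq_zero (h : sys.IsNoise P w η) (t : ℕ) (i : Fin n) :
    ∫ a, sys.innov w η t a i ∂P = 0 := by
  have h1 : ∫ a, ((sys.B *ᵥ (η t a).ofLp) i + (w t a).ofLp i) ∂P = 0 := by
    rw [integral_add (HasMoments.mulVec sys.B (F := fun a => (η t a).ofLp) (h.hasMoments_η t) i
      ).integrable (h.hasMoments_w t i).integrable, h.integral_w_eq_zero,
      integral_mulVec_eq_zero (h.hasMoments_η t) (h.integral_η_eq_zero t), add_zero]
  exact h1

lemma integral_innov_mul_innov (h : sys.IsNoise P w η) (t : ℕ) (i j : Fin n) :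
    ∫ a, sys.innov w η t a i * sys.innov w η t a j ∂P = sys.noiseCov i j := by
  have mB : ∀ i, HasMoments (fun a => (sys.B *ᵥ (η t a).ofLp) i) P :=
    HasMoments.mulVec sys.B (F := fun a => (η t a).ofLp) (h.hasMoments_η t)
  have mw := h.hasMoments_w t
  -- The identity matrix in front of ω brings the cross terms into the form of
  -- `integral_mulVec_mul_mulVec`; they vanish because ω and η are uncorrelated.
  have e : ∀ a, sys.innov w η t a i * sys.innov w η t a j =
      ((sys.B *ᵥ (η t a).ofLp) i * (sys.B *ᵥ (η t a).ofLp) j +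
        (w t a).ofLp i * (w t a).ofLp j) +
      (((1 : Matrix (Fin n) (Fin n) ℝ) *ᵥ (w t a).ofLp) i * (sys.B *ᵥ (η t a).ofLp) j +
       ((1 : Matrix (Fin n) (Fin n) ℝ) *ᵥ (w t a).ofLp) j * (sys.B *ᵥ (η t a).ofLp) i) := fun a => by
    simp only [innov, Pi.add_apply, one_mulVec]; ring
  have mw1 : ∀ i, HasMoments (fun a => ((1 : Matrix (Fin n) (Fin n) ℝ) *ᵥ (w t a).ofLp) i) P :=
    HasMoments.mulVec _ (F := fun a => (w t a).ofLp) mw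
  simp only [e]
  rw [integral_add (((mB i).mul (mB j)).add ((mw i).mul (mw j))).integrable
      (((mw1 i).mul (mB j)).add ((mw1 j).mul (mB i))).integrable,
    integral_add ((mB i).mul (mB j)).integrable ((mw i).mul (mw j)).integrable,
    integral_add ((mw1 i).mul (mB j)).integrable ((mw1 j).mul (mB i)).integrable,
    integral_mulVec_mul_mulVec (C := sys.σ ^ 2 • 1) (h.hasMoments_η t) (h.hasMoments_η t)
      (fun i j => h.integral_η_mul_η t i j),
    integral_mulVec_mul_mulVec (C := 0) (h.hasMoments_w t) (h.hasMoments_η t)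
      (fun i j => h.integral_w_mul_η t i j),
    integral_mulVec_mul_mulVec (C := 0) (h.hasMoments_w t) (h.hasMoments_η t)
      (fun i j => h.integral_w_mul_η t i j),
    (h.law_w t).gaussian_integral_mul sys.posSemidef_Dω i j]
  simp [noiseCov]

/-- The second moments of the state. -/
lemma integral_state_mul_state (h : sys.IsNoise P w η) (x0 : Fin n → ℝ) (t : ℕ) (i j : Fin n) :
    ∫ a, sys.state K w η x0 t a i * sys.state K w η x0 t a j ∂P =
      (sys.closedLoop K ^ t * vecMulVec x0 x0 * (sys.closedLoop K ^ t)ᵀ +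
        covSeq (sys.closedLoop K) sys.noiseCov t) i j := by
  induction t generalizing i j with
  | zero => simp [state_zero, vecMulVec_apply]
  | succ t ih =>
    set M := sys.closedLoop K with hM
    have mx := h.hasMoments_state K x0 t
    have mi := h.hasMoments_innov t
    have mM : ∀ i, HasMoments (fun a => (M *ᵥ sys.state K w η x0 t a) i) P :=
      HasMoments.mulVec M mx
    have e : ∀ a, sys.state K w η x0 (t + 1) a i * sys.state K w η x0 (t + 1) a j =
        ((M *ᵥ sys.state K w η x0 t a) i * (M *ᵥ sys.state K w η x0 t a) j +
          sys.innov w η t a i * sys.innov w η t a j) +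
        ((M *ᵥ sys.state K w η x0 t a) i * sys.innov w η t a j +
          (M *ᵥ sys.state K w η x0 t a) j * sys.innov w η t a i) := fun a => by
      simp only [state_succ, Pi.add_apply]; ring
    have hcross : ∀ i j, ∫ a, (M *ᵥ sys.state K w η x0 t a) i * sys.innov w η t a j ∂P = 0 := by
      intro i j
      have hi : IndepFun (fun a => (M *ᵥ sys.state K w η x0 t a) i)
          (fun a => sys.innov w η t a j) P :=
        (h.indepFun_state_innov K x0 t).comp (measurable_mulVec_apply M i) (measurable_pi_apply j)
      rw [hi.integral_fun_mul_eq_mul_integral (mM i).aestronglyMeasurable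
        (mi j).aestronglyMeasurable, h.integral_innov_eq_zero, mul_zero]
    simp only [e]
    rw [integral_add (((mM i).mul (mM j)).add ((mi i).mul (mi j))).integrable
        (((mM i).mul (mi j)).add ((mM j).mul (mi i))).integrable,
      integral_add ((mM i).mul (mM j)).integrable ((mi i).mul (mi j)).integrable,
      integral_add ((mM i).mul (mi j)).integrable ((mM j).mul (mi i)).integrable,
      integral_mulVec_mul_mulVec mx mx ih, h.integral_innov_mul_innov, hcross, hcross, covSeq_succ]
    simp [pow_succ', transpose_mul, mul_add, add_mul, mul_assoc, add_assoc]

lemma integral_state_zero_mul_state (h : sys.IsNoise P w η) (t : ℕ) (i j : Fin n) :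
    ∫ a, sys.state K w η 0 t a i * sys.state K w η 0 t a j ∂P =
      covSeq (sys.closedLoop K) sys.noiseCov t i j := by
  rw [h.integral_state_mul_state]
  simp

lemma integral_state_zero_quadratic (h : sys.IsNoise P w η) (t : ℕ)
    (Q : Matrix (Fin n) (Fin n) ℝ) :
    ∫ a, sys.state K w η 0 t a ⬝ᵥ Q *ᵥ sys.state K w η 0 t a ∂P =
      (Q * covSeq (sys.closedLoop K) sys.noiseCov t).trace :=
  integral_dotProduct_mulVec_eq_trace (h.hasMoments_state K 0 t)
    (covSeq_transpose _ sys.noiseCov_isSymm t) (h.integral_state_zero_mul_state K t) Q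

end IsNoise

end LQR

/-! ### The cost as a trace and its gradient. -/

namespace LQR

variable {n d : ℕ} (sys : LQR n d) (K : Matrix (Fin d) (Fin n) ℝ)

/-- The cost matrix `S + Kᵀ R K` of the closed loop. -/
def costMat : Matrix (Fin n) (Fin n) ℝ := sys.S + Kᵀ * sys.R * K

lemma R_isSymm : sys.R.IsSymm := by simpa using sys.posDef_R.1

lemma costMat_posSemidef : (sys.costMat K).PosSemidef := by
  refine sys.posDef_S.posSemidef.add ?_
  simpa using sys.posDef_R.posSemidef.conjTranspose_mul_mul_same K

lemma costMat_isSymm : (sys.costMat K).IsSymm := by simpa using (sys.costMat_posSemidef K).1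

/-- The value matrix of the policy `K`. -/
def theta : Matrix (Fin n) (Fin n) ℝ := valueMat (sys.closedLoop K) (sys.costMat K) sys.γ

/-- The discounted state covariance of the policy `K`. -/
def discStateCov : Matrix (Fin n) (Fin n) ℝ := discCov (sys.closedLoop K) sys.noiseCov sys.γ

/-- The matrix `R K + γ Bᵀ Θ (A + B K)`. -/
def gradFactor : Matrix (Fin d) (Fin n) ℝ :=
  sys.R * K + sys.γ • (sys.Bᵀ * sys.theta K * sys.closedLoop K)

variable {sys K} {c r : ℝ}

lemma hasSum_trace (hM : PowBound (sys.closedLoop K) c r) (Q : Matrix (Fin n) (Fin n) ℝ) :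
    HasSum (fun t : ℕ => sys.γ ^ t * (Q * covSeq (sys.closedLoop K) sys.noiseCov t).trace)
      (Q * sys.discStateCov K).trace := by
  have h1 := (hM.hasSum_discCov sys.γ_pos.le sys.γ_lt_one sys.noiseCov).trace_mul Q
  simpa [mul_smul, trace_smul, discStateCov] using h1

namespace IsNoise

variable {Ω : Type*} [MeasurableSpace Ω] {P : Measure Ω} [IsProbabilityMeasure P]
  {w : ℕ → Ω → EuclideanSpace ℝ (Fin n)} {η : ℕ → Ω → EuclideanSpace ℝ (Fin d)}

lemma J_eq (h : sys.IsNoise P w η) (hM : PowBound (sys.closedLoop K) c r) :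
    sys.J K w η P =
      (sys.costMat K * sys.discStateCov K).trace + sys.σ ^ 2 * sys.R.trace / (1 - sys.γ) := by
  rw [J, ← (hasSum_trace hM (sys.costMat K)).tsum_eq]
  congr 2
  funext t
  rw [h.integral_state_zero_quadratic K t, costMat]

/-- Trace duality removes the factor 1/(1-γ). Both summands are nonnegative, so each is bounded by
the level; this is how J(K) enters the constants. -/
lemma level_eq (h : sys.IsNoise P w η) (hM : PowBound (sys.closedLoop K) c r) :
    (1 - sys.γ) * sys.J K w η P =
      sys.γ * (sys.theta K * sys.noiseCov).trace + sys.σ ^ 2 * sys.R.trace := by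
  rw [h.J_eq hM, discStateCov, hM.trace_mul_discCov sys.γ_pos.le sys.γ_lt_one, theta]
  have := sys.γ_lt_one
  have h1 : 1 - sys.γ ≠ 0 := by linarith
  field_simp

/-- With Δ = K' - K the new closed loop is A + BK + BΔ, and expanding the comparison of traces in Δ
leaves a quadratic polynomial whose linear coefficient is `gradFactor`. -/
lemma J_sub_J (h : sys.IsNoise P w η) (hM : PowBound (sys.closedLoop K) c r)
    {K' : Matrix (Fin d) (Fin n) ℝ} {c' r' : ℝ} (hM' : PowBound (sys.closedLoop K') c' r') :
    sys.J K' w η P - sys.J K w η P =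
      (((K' - K)ᵀ * sys.gradFactor K + (sys.gradFactor K)ᵀ * (K' - K) +
        (K' - K)ᵀ * (sys.R + sys.γ • (sys.Bᵀ * sys.theta K * sys.B)) * (K' - K)) *
          sys.discStateCov K').trace := by
  rw [h.J_eq hM, h.J_eq hM', add_sub_add_right_eq_sub, discStateCov, discStateCov,
    hM.trace_mul_discCov_sub hM' sys.γ_pos.le sys.γ_lt_one]
  congr 2
  have hT : (sys.theta K)ᵀ = sys.theta K :=
    hM.valueMat_transpose sys.γ_pos.le sys.γ_lt_one (sys.costMat_isSymm K)
  change _ + sys.γ • (_ * sys.theta K * _ - _ * sys.theta K * _) = _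
  have hK' : K' = K + (K' - K) := by abel
  set Δ := K' - K
  rw [hK']
  simp only [costMat, closedLoop, gradFactor, transpose_add, transpose_mul, transpose_smul, hT,
    sys.R_isSymm.eq, transpose_transpose, Matrix.mul_add, Matrix.add_mul, Matrix.mul_smul,
    Matrix.smul_mul, smul_add, smul_sub, Matrix.mul_assoc]
  abel

variable (sys K) in
/-- The derivative of `J` at `K`. -/
def _root_.LQR.derivJ : Matrix (Fin d) (Fin n) ℝ →ₗ[ℝ] ℝ where
  toFun Δ := ((Δᵀ * sys.gradFactor K + (sys.gradFactor K)ᵀ * Δ) * sys.discStateCov K).trace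
  map_add' X Y := by
    simp only [transpose_add, Matrix.add_mul, Matrix.mul_add, trace_add]
    ring
  map_smul' a X := by
    simp [← smul_add]

/-- In the exact difference formula, replacing the covariance of K' by that of K costs ‖Δ‖ times a
quantity tending to zero, and the quadratic part is of order ‖Δ‖². -/
lemma hasFDerivAt_J (h : sys.IsNoise P w η) (hM : PowBound (sys.closedLoop K) c r) :
    HasFDerivAt (fun K' => sys.J K' w η P) (sys.derivJ K).toContinuousLinearMap K := by
  have hcl : ContinuousAt sys.closedLoop K := by unfold closedLoop; fun_prop
  have hev := hM.eventually hcl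
  have hcont := hM.continuousAt_discCov hcl sys.γ_pos.le sys.γ_lt_one sys.noiseCov
  change ContinuousAt sys.discStateCov K at hcont
  set E := sys.gradFactor K with hE
  set H := sys.R + sys.γ • (sys.Bᵀ * sys.theta K * sys.B) with hH
  set Y := sys.discStateCov K with hY
  -- A bound for the remainder divided by ‖K' - K‖.
  let g : Matrix (Fin d) (Fin n) ℝ → ℝ := fun K' =>
    n * (2 * ‖E‖ * ‖sys.discStateCov K' - Y‖ + ‖H‖ * ‖K' - K‖ * ‖sys.discStateCov K'‖)
  have hg : Filter.Tendsto g (nhds K) (nhds 0) := by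
    have : ContinuousAt g K := by fun_prop
    simpa [g, ContinuousAt, hY] using this
  rw [hasFDerivAt_iff_isLittleO, Asymptotics.isLittleO_iff]
  intro ε hε
  filter_upwards [hev, hg.eventually_le_const hε] with K' hK' hgK'
  have e : sys.J K' w η P - sys.J K w η P - (sys.derivJ K).toContinuousLinearMap (K' - K) =
      (((K' - K)ᵀ * E + Eᵀ * (K' - K)) * (sys.discStateCov K' - Y)).trace +
        ((K' - K)ᵀ * H * (K' - K) * sys.discStateCov K').trace := by
    rw [h.J_sub_J hM hK']
    change _ - (((K' - K)ᵀ * E + Eᵀ * (K' - K)) * Y).trace = _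
    simp only [Matrix.add_mul, Matrix.mul_sub, trace_add, trace_sub]
    ring
  have h1 : ‖(K' - K)ᵀ * E + Eᵀ * (K' - K)‖ ≤ 2 * ‖E‖ * ‖K' - K‖ := by
    have h2 := l2_opNorm_mul (K' - K)ᵀ E
    have h3 := l2_opNorm_mul Eᵀ (K' - K)
    rw [l2_opNorm_transpose] at h2 h3
    linarith [norm_add_le ((K' - K)ᵀ * E) (Eᵀ * (K' - K))]
  have h4 : ‖(K' - K)ᵀ * H * (K' - K)‖ ≤ ‖K' - K‖ * ‖H‖ * ‖K' - K‖ := by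
    refine (l2_opNorm_mul _ _).trans (mul_le_mul_of_nonneg_right ?_ (norm_nonneg _))
    exact (l2_opNorm_mul (K' - K)ᵀ H).trans_eq (by rw [l2_opNorm_transpose])
  rw [e]
  calc _ ≤ n * (2 * ‖E‖ * ‖K' - K‖ * ‖sys.discStateCov K' - Y‖) +
        n * (‖K' - K‖ * ‖H‖ * ‖K' - K‖ * ‖sys.discStateCov K'‖) := by
        refine (norm_add_le _ _).trans (add_le_add ?_ ?_)
        · exact (abs_trace_mul_le _ _).trans (by gcongr)
        · exact (abs_trace_mul_le _ _).trans (by gcongr)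
    _ = g K' * ‖K' - K‖ := by simp only [g]; ring
    _ ≤ ε * ‖K' - K‖ := by gcongr

/-- On a matrix unit the two linear terms are traces of transposed products, equal because Y is
symmetric; hence the factor 2. -/
lemma gradJ_eq (h : sys.IsNoise P w η) (hM : PowBound (sys.closedLoop K) c r) :
    sys.gradJ K w η P = (2 : ℝ) • (sys.gradFactor K * sys.discStateCov K) := by
  have hY : (sys.discStateCov K)ᵀ = sys.discStateCov K :=
    hM.discCov_transpose sys.γ_pos.le sys.γ_lt_one sys.noiseCov_isSymm
  ext i j
  rw [gradJ, of_apply, (h.hasFDerivAt_J hM).fderiv]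
  change (((single i j (1 : ℝ))ᵀ * sys.gradFactor K + (sys.gradFactor K)ᵀ * single i j (1 : ℝ)) *
    sys.discStateCov K).trace = _
  set E := sys.gradFactor K
  set Y := sys.discStateCov K
  have h1 : ((single i j (1 : ℝ))ᵀ * E * Y).trace = (E * Y) i j := by
    rw [Matrix.mul_assoc, transpose_single, trace_single_mul]; simp
  have h2 : (Eᵀ * single i j (1 : ℝ) * Y).trace = (E * Y) i j := by
    rw [← h1, ← trace_transpose ((single i j (1 : ℝ))ᵀ * E * Y), transpose_mul, transpose_mul,
      transpose_transpose, hY, trace_mul_comm]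
  rw [Matrix.add_mul, trace_add, h1, h2]
  simp; ring

/-! ### The value function -/

lemma runCost_eq (x0 : Fin n → ℝ) (t : ℕ) (a : Ω) :
    sys.runCost K w η x0 t a =
      sys.state K w η x0 t a ⬝ᵥ sys.costMat K *ᵥ sys.state K w η x0 t a +
        2 * (sys.state K w η x0 t a ⬝ᵥ (Kᵀ * sys.R) *ᵥ (η t a).ofLp) +
        (η t a).ofLp ⬝ᵥ sys.R *ᵥ (η t a).ofLp := by
  rw [runCost, control, costMat]
  set x := sys.state K w η x0 t a
  set z := (η t a).ofLp
  have h1 : z ⬝ᵥ sys.R *ᵥ (K *ᵥ x) = (K *ᵥ x) ⬝ᵥ sys.R *ᵥ z := by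
    rw [dotProduct_mulVec, ← mulVec_transpose, sys.R_isSymm.eq, dotProduct_comm]
  have h2 : ∀ y : Fin d → ℝ, x ⬝ᵥ Kᵀ *ᵥ y = (K *ᵥ x) ⬝ᵥ y := fun y => by
    rw [dotProduct_mulVec, vecMul_transpose]
  simp only [add_mulVec, mulVec_add, add_dotProduct, dotProduct_add, ← mulVec_mulVec, h1, h2]
  ring

lemma runCost_nonneg (x0 : Fin n → ℝ) (t : ℕ) (a : Ω) : 0 ≤ sys.runCost K w η x0 t a := by
  have h1 := sys.posDef_S.posSemidef.dotProduct_mulVec_nonneg (sys.state K w η x0 t a)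
  have h2 := sys.posDef_R.posSemidef.dotProduct_mulVec_nonneg (sys.control K w η x0 t a)
  exact add_nonneg (by simpa using h1) (by simpa using h2)

lemma hasMoments_quadratic {m : ℕ} {F : Ω → Fin m → ℝ} (hF : ∀ i, HasMoments (fun a => F a i) P)
    {l : ℕ} {G : Ω → Fin l → ℝ} (hG : ∀ i, HasMoments (fun a => G a i) P)
    (Q : Matrix (Fin m) (Fin l) ℝ) : HasMoments (fun a => F a ⬝ᵥ Q *ᵥ G a) P :=
  HasMoments.dotProduct hF (HasMoments.mulVec Q hG)

lemma hasMoments_runCost (h : sys.IsNoise P w η) (x0 : Fin n → ℝ) (t : ℕ) :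
    HasMoments (sys.runCost K w η x0 t) P := by
  have mx := h.hasMoments_state K x0 t
  have mη := h.hasMoments_η t
  have e : sys.runCost K w η x0 t = _ := funext fun a => runCost_eq x0 t a
  rw [e]
  exact ((hasMoments_quadratic mx mx _).add ((hasMoments_quadratic mx mη _).const_mul 2)).add
    (hasMoments_quadratic mη mη _)

lemma integral_runCost (h : sys.IsNoise P w η) (x0 : Fin n → ℝ) (t : ℕ) :
    ∫ a, sys.runCost K w η x0 t a ∂P =
      x0 ⬝ᵥ ((sys.closedLoop K ^ t)ᵀ * sys.costMat K * sys.closedLoop K ^ t) *ᵥ x0 +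
        (sys.costMat K * covSeq (sys.closedLoop K) sys.noiseCov t).trace +
          sys.σ ^ 2 * sys.R.trace := by
  have mx := h.hasMoments_state K x0 t
  have mη := h.hasMoments_η t
  have hind : IndepFun (sys.state K w η x0 t) (fun a => (η t a).ofLp) P := by
    have hψ : Measurable fun y : EuclideanSpace ℝ (Fin n) × EuclideanSpace ℝ (Fin d) =>
        y.2.ofLp := Continuous.measurable (by fun_prop)
    exact (h.indepFun_state K x0 t).comp measurable_id hψ
  simp only [runCost_eq]
  rw [integral_add ((hasMoments_quadratic mx mx _).add
      ((hasMoments_quadratic mx mη _).const_mul 2)).integrable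
      (hasMoments_quadratic mη mη _).integrable,
    integral_add (hasMoments_quadratic mx mx _).integrable
      ((hasMoments_quadratic mx mη _).const_mul 2).integrable, integral_const_mul,
    hind.integral_dotProduct_mulVec mx mη (h.integral_η_eq_zero t),
    integral_dotProduct_mulVec_eq_trace mη (X := sys.σ ^ 2 • 1) (by simp [IsSymm])
      (fun i j => h.integral_η_mul_η t i j),
    integral_dotProduct_mulVec_eq_trace mx ?_ (h.integral_state_mul_state K x0 t)]
  · have e : (sys.costMat K * (sys.closedLoop K ^ t * vecMulVec x0 x0 *
        (sys.closedLoop K ^ t)ᵀ)).trace =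
        x0 ⬝ᵥ ((sys.closedLoop K ^ t)ᵀ * sys.costMat K * sys.closedLoop K ^ t) *ᵥ x0 := by
      rw [← Matrix.mul_assoc, trace_mul_comm, ← Matrix.mul_assoc, ← Matrix.mul_assoc,
        mul_vecMulVec, trace_vecMulVec, dotProduct_comm]
    rw [Matrix.mul_add, trace_add, e]
    simp
  · refine IsSymm.add ?_ (covSeq_transpose _ sys.noiseCov_isSymm t)
    simp [IsSymm, transpose_mul, Matrix.mul_assoc, transpose_vecMulVec]

/-- The value function of a stable policy. -/
lemma valueFn_eq (h : sys.IsNoise P w η) (hM : PowBound (sys.closedLoop K) c r)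
    (x : Fin n → ℝ) :
    sys.valueFn K w η P x = approxV (sys.J K w η P) (sys.theta K) x := by
  have hint : ∀ t : ℕ, Integrable (fun a => sys.γ ^ t * sys.runCost K w η x t a) P := fun t =>
    ((h.hasMoments_runCost x t).const_mul _).integrable
  have hγ1 := sys.γ_lt_one
  have hs1 := (hM.hasSum_valueMat sys.γ_pos.le hγ1 (sys.costMat K)).dotProduct_mulVec x x
  have hs2 := hasSum_trace hM (sys.costMat K)
  have hs3 := (hasSum_geometric_of_lt_one sys.γ_pos.le hγ1).mul_right (sys.σ ^ 2 * sys.R.trace)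
  have hs : HasSum (fun t : ℕ => ∫ a, sys.γ ^ t * sys.runCost K w η x t a ∂P)
      (approxV (sys.J K w η P) (sys.theta K) x) := by
    have e : (fun t : ℕ => ∫ a, sys.γ ^ t * sys.runCost K w η x t a ∂P) = fun t : ℕ =>
        x ⬝ᵥ (sys.γ ^ t • ((sys.closedLoop K ^ t)ᵀ * sys.costMat K * sys.closedLoop K ^ t)) *ᵥ x +
          sys.γ ^ t * (sys.costMat K * covSeq (sys.closedLoop K) sys.noiseCov t).trace +
          sys.γ ^ t * (sys.σ ^ 2 * sys.R.trace) := by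
      funext t
      rw [integral_const_mul, h.integral_runCost, smul_mulVec, dotProduct_smul, smul_eq_mul]
      ring
    rw [e]
    -- The two parts independent of x add up to J(K), the constant term of the value function.
    convert (hs1.add hs2).add hs3 using 1
    rw [approxV, h.J_eq hM, theta, div_eq_mul_inv]
    ring
  rw [valueFn, ← hs.tsum_eq]
  -- The running costs are nonnegative, so the absolute summability needed to exchange sum and
  -- integral is the summability already found.
  refine (integral_tsum_of_summable_integral_norm hint ?_).symm
  refine hs.summable.congr fun t => integral_congr_ae (ae_of_all _ fun a => ?_)
  exact (Real.norm_of_nonneg (mul_nonneg (pow_nonneg sys.γ_pos.le t) (runCost_nonneg x t a))).symm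

/-- Polarization at pairs of unit vectors; symmetry is essential, as skew matrices have zero
quadratic form. -/
lemma eq_zero_of_quadratic_eq_zero {X : Matrix (Fin n) (Fin n) ℝ} (hX : X.IsSymm)
    (h : ∀ x, x ⬝ᵥ X *ᵥ x = 0) : X = 0 := by
  ext i j
  have h1 := h (Pi.single i 1 + Pi.single j 1)
  have h2 := h (Pi.single i 1)
  have h3 := h (Pi.single j 1)
  simp only [mulVec_add, add_dotProduct, dotProduct_add, single_one_dotProduct,
    mulVec_single_one, col_apply] at h1 h2 h3
  have h4 := hX.apply i j
  rw [Matrix.zero_apply]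
  linarith

/-- The parameter of the value function is unique. -/
lemma approx_bound (h : sys.IsNoise P w η) (hM : PowBound (sys.closedLoop K) c r) {θ₀ ε₀ : ℝ}
    {Θ : Matrix (Fin n) (Fin n) ℝ} (hθ : sys.IsApproxValue K w η P θ₀ Θ ε₀) :
    0 ≤ ε₀ ∧ |θ₀ - sys.J K w η P| ≤ ε₀ ∧ ‖Θ - sys.theta K‖ ≤ ε₀ := by
  obtain ⟨θ₀s, Θs, hsymm, hV, hε⟩ := hθ
  have hT : (sys.theta K).IsSymm :=
    hM.valueMat_transpose sys.γ_pos.le sys.γ_lt_one (sys.costMat_isSymm K)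
  have hV' : ∀ x, approxV (sys.J K w η P) (sys.theta K) x = approxV θ₀s Θs x := fun x => by
    rw [← hV, h.valueFn_eq hM]
  have h0 : sys.J K w η P = θ₀s := by simpa [approxV] using hV' 0
  have h1 : Θs = sys.theta K := by
    rw [← sub_eq_zero]
    refine eq_zero_of_quadratic_eq_zero (hsymm.sub hT) fun x => ?_
    have := hV' x
    rw [approxV, approxV, h0] at this
    rw [sub_mulVec, dotProduct_sub]
    linarith
  subst h0 h1
  have hε0 : 0 ≤ ε₀ := (Real.sqrt_nonneg _).trans hε
  have h2 : (θ₀ - sys.J K w η P) ^ 2 + frobSq (Θ - sys.theta K) ≤ ε₀ ^ 2 :=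
    (Real.sqrt_le_left hε0).1 hε
  have h3 := sq_l2_opNorm_le_frobSq (Θ - sys.theta K)
  refine ⟨hε0, abs_le_of_sq_le_sq (by nlinarith [sq_nonneg ‖Θ - sys.theta K‖]) hε0, ?_⟩
  exact le_of_sq_le_sq (by nlinarith [sq_nonneg (θ₀ - sys.J K w η P)]) hε0

end IsNoise

end LQR

/-! ### Entrywise integration of random matrices. -/

section

variable {Ω : Type*} [MeasurableSpace Ω] {P : Measure Ω} {m k : ℕ}

lemma integrable_matrix {F : Ω → Matrix (Fin m) (Fin k) ℝ}
    (h : ∀ i j, Integrable (fun a => F a i j) P) : Integrable F P := by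
  have e : F = fun a => ∑ i, ∑ j, F a i j • single i j (1 : ℝ) := by
    funext a
    conv_lhs => rw [matrix_eq_sum_single (F a)]
    simp
  rw [e]
  exact integrable_finsetSum _ fun i _ => integrable_finsetSum _ fun j _ => (h i j).smul_const _

lemma integral_matrix_apply {F : Ω → Matrix (Fin m) (Fin k) ℝ} (hF : Integrable F P) (i : Fin m)
    (j : Fin k) : (∫ a, F a ∂P) i j = ∫ a, F a i j ∂P := by
  let f : Matrix (Fin m) (Fin k) ℝ →ₗ[ℝ] ℝ :=
    { toFun := fun X => X i j, map_add' := fun _ _ => rfl, map_smul' := fun _ _ => rfl }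
  exact (f.toContinuousLinearMap.integral_comp_comm hF).symm

end

/-! ### Mean and bias of the estimator. -/

namespace LQR

variable {n d : ℕ} {sys : LQR n d} {K : Matrix (Fin d) (Fin n) ℝ} {c r : ℝ}

namespace IsNoise

variable {Ω : Type*} [MeasurableSpace Ω] {P : Measure Ω} [IsProbabilityMeasure P]
  {w : ℕ → Ω → EuclideanSpace ℝ (Fin n)} {η : ℕ → Ω → EuclideanSpace ℝ (Fin d)}
  {θ₀ : ℝ} {Θ : Matrix (Fin n) (Fin n) ℝ}

/-- Given the current state, the noise at the current time is symmetric. -/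
lemma identDistrib_neg (h : sys.IsNoise P w η) (x0 : Fin n → ℝ) (t : ℕ) :
    IdentDistrib (fun a => (sys.state K w η x0 t a, (w t a, η t a)))
      (fun a => (sys.state K w η x0 t a, (-w t a, -η t a))) P P := by
  have aw := (h.law_w t).aemeasurable
  have aη := (h.law_η t).aemeasurable
  have awn : AEMeasurable (fun a => -w t a) P := aw.neg
  have aηn : AEMeasurable (fun a => -η t a) P := aη.neg
  have ax : AEMeasurable (sys.state K w η x0 t) P := by
    refine aemeasurable_pi_lambda _ fun i => ?_
    exact (h.hasMoments_state K x0 t i).aestronglyMeasurable.aemeasurable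
  have hi := h.indepFun_state K x0 t
  have hneg : Measurable fun y : EuclideanSpace ℝ (Fin n) × EuclideanSpace ℝ (Fin d) =>
      (-y.1, -y.2) := by fun_prop
  have hi' : IndepFun (sys.state K w η x0 t) (fun a => (-w t a, -η t a)) P :=
    hi.comp measurable_id hneg
  have hp' : IndepFun (fun a => -w t a) (fun a => -η t a) P :=
    (h.indep_pair t).comp measurable_neg measurable_neg
  have lw : P.map (fun a => -w t a) = P.map (w t) := by
    have := AEMeasurable.map_map_of_aemeasurable
      (g := fun x : EuclideanSpace ℝ (Fin n) => -x) (by fun_prop) aw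
    rw [(h.law_w t).map_eq, map_neg_multivariateGaussian] at this
    rw [(h.law_w t).map_eq, this]
    rfl
  have lη : P.map (fun a => -η t a) = P.map (η t) := by
    have := AEMeasurable.map_map_of_aemeasurable
      (g := fun x : EuclideanSpace ℝ (Fin d) => -x) (by fun_prop) aη
    rw [(h.law_η t).map_eq, map_neg_multivariateGaussian] at this
    rw [(h.law_η t).map_eq, this]
    rfl
  have lp : P.map (fun a => (-w t a, -η t a)) = P.map (fun a => (w t a, η t a)) := by
    rw [(indepFun_iff_map_prod_eq_prod_map_map awn aηn).1 hp',
      (indepFun_iff_map_prod_eq_prod_map_map aw aη).1 (h.indep_pair t), lw, lη]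
  refine ⟨ax.prodMk (aw.prodMk aη), ax.prodMk (awn.prodMk aηn), ?_⟩
  rw [(indepFun_iff_map_prod_eq_prod_map_map ax (aw.prodMk aη)).1 hi,
    (indepFun_iff_map_prod_eq_prod_map_map ax (awn.prodMk aηn)).1 hi', lp]

variable (sys K θ₀ Θ) in
/-- The temporal difference as a function of the state and the noise. -/
def _root_.LQR.tdFun (x : Fin n → ℝ) (u : Fin n → ℝ) (z : Fin d → ℝ) : ℝ :=
  x ⬝ᵥ sys.S *ᵥ x + (K *ᵥ x + z) ⬝ᵥ sys.R *ᵥ (K *ᵥ x + z) +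
    sys.γ * approxV θ₀ Θ (sys.closedLoop K *ᵥ x + (sys.B *ᵥ z + u)) - approxV θ₀ Θ x

lemma tdError_eq (t : ℕ) (a : Ω) :
    sys.tdError K w η θ₀ Θ t a =
      sys.tdFun K θ₀ Θ (sys.state K w η 0 t a) (w t a).ofLp (η t a).ofLp := by
  rw [tdError, tdFun, state_succ]
  rfl

variable (sys K Θ) in
/-- Half the part of the temporal difference that is odd in the control noise. -/
def _root_.LQR.oddCoeff : Matrix (Fin n) (Fin d) ℝ :=
  (2 : ℝ) • (Kᵀ * sys.R) + sys.γ • ((sys.closedLoop K)ᵀ * (Θ + Θᵀ) * sys.B)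

/-- The terms of degree zero and two in the noises (u, z) are even and cancel, among them everything
involving θ₀. What remains is linear in the noise. -/
lemma tdFun_sub_tdFun_neg (x u : Fin n → ℝ) (z : Fin d → ℝ) :
    sys.tdFun K θ₀ Θ x u z - sys.tdFun K θ₀ Θ x (-u) (-z) =
      2 * (x ⬝ᵥ sys.oddCoeff K Θ *ᵥ z +
        x ⬝ᵥ (sys.γ • ((sys.closedLoop K)ᵀ * (Θ + Θᵀ))) *ᵥ u) := by
  have h1 : z ⬝ᵥ sys.R *ᵥ (K *ᵥ x) = (K *ᵥ x) ⬝ᵥ sys.R *ᵥ z := by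
    rw [dotProduct_mulVec, ← mulVec_transpose, sys.R_isSymm.eq, dotProduct_comm]
  have h2 : ∀ y : Fin d → ℝ, x ⬝ᵥ Kᵀ *ᵥ y = (K *ᵥ x) ⬝ᵥ y := fun y => by
    rw [dotProduct_mulVec, vecMul_transpose]
  have h3 : ∀ y : Fin n → ℝ, x ⬝ᵥ (sys.closedLoop K)ᵀ *ᵥ y = (sys.closedLoop K *ᵥ x) ⬝ᵥ y :=
    fun y => by rw [dotProduct_mulVec, vecMul_transpose]
  have h4 : ∀ y y' : Fin n → ℝ, y ⬝ᵥ Θᵀ *ᵥ y' = y' ⬝ᵥ Θ *ᵥ y := fun y y' => by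
    rw [mulVec_transpose, dotProduct_comm, ← dotProduct_mulVec]
  simp only [tdFun, approxV, oddCoeff, add_mulVec, mulVec_add, add_dotProduct, dotProduct_add,
    ← mulVec_mulVec, h1, h2, h3, h4, mulVec_neg, neg_dotProduct, dotProduct_neg, smul_mulVec,
    dotProduct_smul, smul_eq_mul]
  ring

lemma hasMoments_tdError (h : sys.IsNoise P w η) (t : ℕ) :
    HasMoments (sys.tdError K w η θ₀ Θ t) P := by
  have h1 : ∀ s, HasMoments (fun a => approxV θ₀ Θ (sys.state K w η 0 s a)) P := fun s =>
    (HasMoments.const θ₀).add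
      (hasMoments_quadratic (h.hasMoments_state K 0 s) (h.hasMoments_state K 0 s) Θ)
  exact ((h.hasMoments_runCost 0 t).add ((h1 (t + 1)).const_mul _)).sub (h1 t)

/-- The conditional expectation of a term of the estimator, integrated. -/
lemma integral_tdError_mul (h : sys.IsNoise P w η) (t : ℕ) (i : Fin d) (j : Fin n) :
    ∫ a, sys.tdError K w η θ₀ Θ t a * ((η t a).ofLp i * sys.state K w η 0 t a j) ∂P =
      sys.σ ^ 2 * ((sys.oddCoeff K Θ)ᵀ * covSeq (sys.closedLoop K) sys.noiseCov t) i j := by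
  set x := sys.state K w η 0 t with hx
  have mx : ∀ p, HasMoments (fun a => x a p) P := h.hasMoments_state K 0 t
  have mη := h.hasMoments_η t
  have mw := h.hasMoments_w t
  set N₁ := sys.oddCoeff K Θ with hN₁
  set N₂ := sys.γ • ((sys.closedLoop K)ᵀ * (Θ + Θᵀ)) with hN₂
  have hmeas : Measurable fun y : (Fin n → ℝ) × EuclideanSpace ℝ (Fin n) × EuclideanSpace ℝ (Fin d) =>
      sys.tdFun K θ₀ Θ y.1 y.2.1.ofLp y.2.2.ofLp * (y.2.2.ofLp i * y.1 j) := by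
    refine Continuous.measurable ?_
    unfold tdFun approxV
    fun_prop
  have hsym : ∫ a, sys.tdError K w η θ₀ Θ t a * ((η t a).ofLp i * x a j) ∂P =
      ∫ a, sys.tdFun K θ₀ Θ (x a) (-(w t a).ofLp) (-(η t a).ofLp) *
        (-(η t a).ofLp i * x a j) ∂P := by
    simp only [tdError_eq]
    exact ((h.identDistrib_neg (K := K) 0 t).comp hmeas).integral_eq
  have hI := ((h.hasMoments_tdError (K := K) (θ₀ := θ₀) (Θ := Θ) t).mul
    ((mη i).mul (mx j))).integrable
  have hodd : ∀ a, sys.tdFun K θ₀ Θ (x a) (-(w t a).ofLp) (-(η t a).ofLp) *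
        (-(η t a).ofLp i * x a j) =
      2 * ((x a ⬝ᵥ N₁ *ᵥ (η t a).ofLp + x a ⬝ᵥ N₂ *ᵥ (w t a).ofLp) *
        ((η t a).ofLp i * x a j)) -
      sys.tdError K w η θ₀ Θ t a * ((η t a).ofLp i * x a j) := fun a => by
    rw [tdError_eq]
    have := tdFun_sub_tdFun_neg (sys := sys) (K := K) (θ₀ := θ₀) (Θ := Θ) (x a) (w t a).ofLp
      (η t a).ofLp
    linear_combination ((η t a).ofLp i * x a j) * this
  have m1 : HasMoments (fun a => x a ⬝ᵥ N₁ *ᵥ (η t a).ofLp * ((η t a).ofLp i * x a j)) P :=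
    (hasMoments_quadratic mx mη N₁).mul ((mη i).mul (mx j))
  have m2 : HasMoments (fun a => x a ⬝ᵥ N₂ *ᵥ (w t a).ofLp * ((η t a).ofLp i * x a j)) P :=
    (hasMoments_quadratic mx mw N₂).mul ((mη i).mul (mx j))
  -- By symmetry the integral I satisfies I = 2·(odd part) - I, so it equals the integral of the odd
  -- part alone.
  have hmain : ∫ a, sys.tdError K w η θ₀ Θ t a * ((η t a).ofLp i * x a j) ∂P =
      ∫ a, x a ⬝ᵥ N₁ *ᵥ (η t a).ofLp * ((η t a).ofLp i * x a j) ∂P +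
      ∫ a, x a ⬝ᵥ N₂ *ᵥ (w t a).ofLp * ((η t a).ofLp i * x a j) ∂P := by
    have m12 : Integrable (fun a => 2 * ((x a ⬝ᵥ N₁ *ᵥ (η t a).ofLp +
        x a ⬝ᵥ N₂ *ᵥ (w t a).ofLp) * ((η t a).ofLp i * x a j))) P :=
      ((((hasMoments_quadratic mx mη N₁).add (hasMoments_quadratic mx mw N₂)).mul
        ((mη i).mul (mx j))).const_mul 2).integrable
    simp only [hodd] at hsym
    rw [integral_sub m12 hI, integral_const_mul] at hsym
    rw [← integral_add m1.integrable m2.integrable]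
    simp only [← add_mul]
    linarith
  have hcov := h.integral_state_zero_mul_state K t
  have hind : ∀ (p : Fin n) (g : EuclideanSpace ℝ (Fin n) × EuclideanSpace ℝ (Fin d) → ℝ),
      Measurable g →
      IndepFun (fun a => x a p * x a j) (fun a => g (w t a, η t a)) P := fun p g hg => by
    have hφ : Measurable fun y : Fin n → ℝ => y p * y j := by fun_prop
    exact (h.indepFun_state K 0 t).comp hφ hg
  have hexp : ∀ {l : ℕ} (z : Ω → Fin l → ℝ) (N : Matrix (Fin n) (Fin l) ℝ) (a : Ω),
      x a ⬝ᵥ N *ᵥ z a * ((η t a).ofLp i * x a j) =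
        ∑ p, ∑ q, N p q * ((x a p * x a j) * (z a q * (η t a).ofLp i)) := fun z N a => by
    simp only [dotProduct, Matrix.mulVec, Finset.mul_sum, Finset.sum_mul]
    exact Finset.sum_congr rfl fun p _ => Finset.sum_congr rfl fun q _ => by ring
  have hcovs : ∀ p, covSeq (sys.closedLoop K) sys.noiseCov t p j =
      ∫ a, x a p * x a j ∂P := fun p => (hcov p j).symm
  have e1 : ∫ a, x a ⬝ᵥ N₁ *ᵥ (η t a).ofLp * ((η t a).ofLp i * x a j) ∂P =
      sys.σ ^ 2 * (N₁ᵀ * covSeq (sys.closedLoop K) sys.noiseCov t) i j := by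
    simp only [hexp (fun a => (η t a).ofLp) N₁]
    rw [integral_sum_sum_mul (F := fun p a => x a p * x a j)
      (G := fun q a => (η t a).ofLp q * (η t a).ofLp i) (fun p => (mx p).mul (mx j))
      (fun q => (mη q).mul (mη i)) fun p q => N₁ p q, mul_apply, Finset.mul_sum]
    refine Finset.sum_congr rfl fun p _ => ?_
    have hq : ∀ q, ∫ a, (x a p * x a j) * ((η t a).ofLp q * (η t a).ofLp i) ∂P =
        (∫ a, x a p * x a j ∂P) * (sys.σ ^ 2 * (1 : Matrix (Fin d) (Fin d) ℝ) q i) := fun q => by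
      rw [← h.integral_η_mul_η t q i]
      exact (hind p (fun y => y.2.ofLp q * y.2.ofLp i) (by fun_prop)
        ).integral_fun_mul_eq_mul_integral ((mx p).mul (mx j)).aestronglyMeasurable
        ((mη q).mul (mη i)).aestronglyMeasurable
    simp only [hq, one_apply, ← hcovs, transpose_apply]
    simp
    ring
  have e2 : ∫ a, x a ⬝ᵥ N₂ *ᵥ (w t a).ofLp * ((η t a).ofLp i * x a j) ∂P = 0 := by
    simp only [hexp (fun a => (w t a).ofLp) N₂]
    rw [integral_sum_sum_mul (F := fun p a => x a p * x a j)
      (G := fun q a => (w t a).ofLp q * (η t a).ofLp i) (fun p => (mx p).mul (mx j))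
      (fun q => (mw q).mul (mη i)) fun p q => N₂ p q]
    refine Finset.sum_eq_zero fun p _ => Finset.sum_eq_zero fun q _ => ?_
    have hq : ∫ a, (x a p * x a j) * ((w t a).ofLp q * (η t a).ofLp i) ∂P =
        (∫ a, x a p * x a j ∂P) * ∫ a, (w t a).ofLp q * (η t a).ofLp i ∂P :=
      (hind p (fun y => y.1.ofLp q * y.2.ofLp i) (by fun_prop)
        ).integral_fun_mul_eq_mul_integral ((mx p).mul (mx j)).aestronglyMeasurable
        ((mw q).mul (mη i)).aestronglyMeasurable
    rw [hq, h.integral_w_mul_η, mul_zero, mul_zero]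
  rw [hmain, e1, e2, add_zero]

lemma acEstimator_apply (L : ℕ) (a : Ω) (i : Fin d) (j : Fin n) :
    sys.acEstimator K w η θ₀ Θ L a i j = ∑ t ∈ Finset.range (L + 1),
      (1 / sys.σ ^ 2 * sys.γ ^ t) *
        (sys.tdError K w η θ₀ Θ t a * ((η t a).ofLp i * sys.state K w η 0 t a j)) := by
  simp only [acEstimator, control, add_sub_cancel_left, Matrix.smul_apply, Matrix.sum_apply,
    vecMulVec_apply, smul_eq_mul, Finset.mul_sum]
  exact Finset.sum_congr rfl fun t _ => by ring

lemma hasMoments_acEstimator (h : sys.IsNoise P w η) (L : ℕ) (i : Fin d) (j : Fin n) :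
    HasMoments (fun a => sys.acEstimator K w η θ₀ Θ L a i j) P := by
  simp only [acEstimator_apply]
  exact HasMoments.sum _ fun t _ => ((h.hasMoments_tdError t).mul
    ((h.hasMoments_η t i).mul (h.hasMoments_state K 0 t j))).const_mul _

lemma integrable_acEstimator (h : sys.IsNoise P w η) (L : ℕ) :
    Integrable (fun a => sys.acEstimator K w η θ₀ Θ L a) P :=
  integrable_matrix fun i j => (h.hasMoments_acEstimator L i j).integrable

lemma integrable_frobSq_acEstimator (h : sys.IsNoise P w η) (L : ℕ) :
    Integrable (fun a => frobSq (sys.acEstimator K w η θ₀ Θ L a)) P :=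
  integrable_finsetSum _ fun i _ => integrable_finsetSum _ fun j _ =>
    ((h.hasMoments_acEstimator L i j).pow 2).integrable

lemma integral_acEstimator (h : sys.IsNoise P w η) (L : ℕ) :
    ∫ a, sys.acEstimator K w η θ₀ Θ L a ∂P = (sys.oddCoeff K Θ)ᵀ *
      ∑ t ∈ Finset.range (L + 1), sys.γ ^ t • covSeq (sys.closedLoop K) sys.noiseCov t := by
  ext i j
  rw [integral_matrix_apply (h.integrable_acEstimator L)]
  simp only [acEstimator_apply]
  rw [integral_finsetSum _ fun t _ => ((((h.hasMoments_tdError t).mul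
    ((h.hasMoments_η t i).mul (h.hasMoments_state K 0 t j))).const_mul _).integrable)]
  simp only [integral_const_mul, h.integral_tdError_mul]
  rw [Matrix.mul_sum, Matrix.sum_apply]
  refine Finset.sum_congr rfl fun t _ => ?_
  have := sys.σ_pos.ne'
  rw [Matrix.mul_smul, Matrix.smul_apply, smul_eq_mul]
  field_simp

/-- The bias of the actor-critic estimator. -/
lemma norm_gradJ_sub_le (h : sys.IsNoise P w η) (hM : PowBound (sys.closedLoop K) c r) {ε₀ : ℝ}
    (hθ : ‖Θ - sys.theta K‖ ≤ ε₀) (L : ℕ) :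
    ‖sys.gradJ K w η P - ∫ a, sys.acEstimator K w η θ₀ Θ L a ∂P‖ ≤
      2 * (‖sys.R‖ * ‖K‖ + sys.γ * (‖sys.B‖ * ‖sys.theta K‖ * ‖sys.closedLoop K‖)) *
        (c ^ 2 / (1 - r ^ 2) * ‖sys.noiseCov‖ * (sys.γ ^ (L + 1) / (1 - sys.γ))) +
      2 * ‖sys.B‖ * ε₀ * ‖sys.closedLoop K‖ *
        (c ^ 2 / (1 - r ^ 2) * ‖sys.noiseCov‖ / (1 - sys.γ)) := by
  have hγ := sys.γ_pos.le
  have hγ1 := sys.γ_lt_one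
  have hT : (sys.theta K)ᵀ = sys.theta K := hM.valueMat_transpose hγ hγ1 (sys.costMat_isSymm K)
  rw [h.gradJ_eq hM, h.integral_acEstimator]
  have t1 := hM.norm_discCov_sub_le hγ hγ1 sys.noiseCov (L + 1)
  have t2 := hM.norm_sum_smul_covSeq_le hγ hγ1 sys.noiseCov (L + 1)
  change ‖sys.discStateCov K - _‖ ≤ _ at t1
  set Y := sys.discStateCov K
  set Z := ∑ t ∈ Finset.range (L + 1), sys.γ ^ t • covSeq (sys.closedLoop K) sys.noiseCov t
  set M := sys.closedLoop K with hMdef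
  set T := sys.theta K with hTdef
  -- When Θ = T the transpose of `oddCoeff` is twice `gradFactor`. The bias therefore splits into
  -- the tail Y - Z of the discounted covariance and the error Θ - T acting on the truncated sum Z.
  have e : (2 : ℝ) • (sys.gradFactor K * Y) - (sys.oddCoeff K Θ)ᵀ * Z =
      ((2 : ℝ) • sys.gradFactor K) * (Y - Z) -
        (sys.γ • (sys.Bᵀ * ((Θ - T) + (Θ - T)ᵀ) * M)) * Z := by
    simp only [gradFactor, oddCoeff, ← hMdef, ← hTdef, transpose_add, transpose_sub, transpose_mul,
      transpose_smul, hT, sys.R_isSymm.eq, transpose_transpose, Matrix.mul_add, Matrix.add_mul,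
      Matrix.mul_sub, Matrix.sub_mul, Matrix.smul_mul, smul_add, smul_sub,
      Matrix.mul_assoc]
    module
  have n1 : ‖(2 : ℝ) • sys.gradFactor K‖ ≤
      2 * (‖sys.R‖ * ‖K‖ + sys.γ * (‖sys.B‖ * ‖T‖ * ‖M‖)) := by
    rw [norm_smul, Real.norm_ofNat]
    refine mul_le_mul_of_nonneg_left ((norm_add_le _ _).trans (add_le_add (l2_opNorm_mul _ _) ?_))
      zero_le_two
    rw [norm_smul, Real.norm_of_nonneg hγ]
    refine mul_le_mul_of_nonneg_left ((l2_opNorm_mul _ _).trans ?_) hγ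
    refine mul_le_mul_of_nonneg_right ((l2_opNorm_mul _ _).trans_eq ?_) (norm_nonneg _)
    rw [l2_opNorm_transpose]
  have n2 : ‖sys.γ • (sys.Bᵀ * ((Θ - T) + (Θ - T)ᵀ) * M)‖ ≤ 2 * ‖sys.B‖ * ε₀ * ‖M‖ := by
    rw [norm_smul, Real.norm_of_nonneg hγ]
    have h1 : ‖(Θ - T) + (Θ - T)ᵀ‖ ≤ 2 * ε₀ := by
      refine (norm_add_le _ _).trans ?_
      rw [l2_opNorm_transpose]
      linarith
    calc _ ≤ 1 * (‖sys.B‖ * (2 * ε₀) * ‖M‖) := by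
          refine mul_le_mul hγ1.le ((l2_opNorm_mul _ _).trans ?_) (norm_nonneg _) zero_le_one
          refine mul_le_mul_of_nonneg_right ((l2_opNorm_mul _ _).trans ?_) (norm_nonneg _)
          rw [l2_opNorm_transpose]
          exact mul_le_mul_of_nonneg_left h1 (norm_nonneg _)
      _ = _ := by ring
  rw [e]
  refine (norm_sub_le _ _).trans (add_le_add ?_ ?_)
  · exact (l2_opNorm_mul _ _).trans (mul_le_mul n1 t1 (norm_nonneg _) ((norm_nonneg _).trans n1))
  · exact (l2_opNorm_mul _ _).trans (mul_le_mul n2 t2 (norm_nonneg _) ((norm_nonneg _).trans n2))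

end IsNoise

end LQR

/-! ### Power inequalities for the moment bounds. -/

lemma sum_mul_pow_eight_le {ι : Type*} (s : Finset ι) (α v : ι → ℝ) (hα : ∀ i ∈ s, 0 ≤ α i) :
    (∑ i ∈ s, α i * v i) ^ 8 ≤ (∑ i ∈ s, α i) ^ 7 * ∑ i ∈ s, α i * v i ^ 8 := by
  -- Weighted Cauchy-Schwarz; applied three times it yields the Jensen inequality with exponent 8 =
  -- 2³.
  have cs : ∀ u : ι → ℝ, (∑ i ∈ s, α i * u i) ^ 2 ≤ (∑ i ∈ s, α i) * ∑ i ∈ s, α i * u i ^ 2 :=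
    fun u => Finset.sum_sq_le_sum_mul_sum_of_sq_le_mul s hα
      (fun i hi => mul_nonneg (hα i hi) (sq_nonneg _)) fun i _ => le_of_eq (by ring)
  have hW : 0 ≤ ∑ i ∈ s, α i := Finset.sum_nonneg hα
  set W := ∑ i ∈ s, α i
  have h1 := cs v
  have h2 := cs fun i => v i ^ 2
  have h3 := cs fun i => (v i ^ 2) ^ 2
  have e : ∀ i, ((v i ^ 2) ^ 2) ^ 2 = v i ^ 8 := fun i => by ring
  simp only [e] at h3
  calc (∑ i ∈ s, α i * v i) ^ 8 = (((∑ i ∈ s, α i * v i) ^ 2) ^ 2) ^ 2 := by ring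
    _ ≤ ((W * ∑ i ∈ s, α i * v i ^ 2) ^ 2) ^ 2 := by gcongr
    _ = W ^ 4 * ((∑ i ∈ s, α i * v i ^ 2) ^ 2) ^ 2 := by ring
    _ ≤ W ^ 4 * (W * ∑ i ∈ s, α i * (v i ^ 2) ^ 2) ^ 2 := by gcongr
    _ = W ^ 6 * (∑ i ∈ s, α i * (v i ^ 2) ^ 2) ^ 2 := by ring
    _ ≤ W ^ 6 * (W * ∑ i ∈ s, α i * v i ^ 8) := by gcongr
    _ = _ := by ring

lemma add_pow_eight_le (a b : ℝ) : (a + b) ^ 8 ≤ 128 * (a ^ 8 + b ^ 8) := by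
  have h1 : ∀ a b : ℝ, (a + b) ^ 2 ≤ 2 * (a ^ 2 + b ^ 2) := fun a b => by
    nlinarith [sq_nonneg (a - b)]
  calc (a + b) ^ 8 = (((a + b) ^ 2) ^ 2) ^ 2 := by ring
    _ ≤ ((2 * (a ^ 2 + b ^ 2)) ^ 2) ^ 2 := by gcongr; exact h1 a b
    _ = 16 * ((a ^ 2 + b ^ 2) ^ 2) ^ 2 := by ring
    _ ≤ 16 * (2 * ((a ^ 2) ^ 2 + (b ^ 2) ^ 2)) ^ 2 := by gcongr; exact h1 _ _
    _ = 64 * ((a ^ 2) ^ 2 + (b ^ 2) ^ 2) ^ 2 := by ring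
    _ ≤ 64 * (2 * (((a ^ 2) ^ 2) ^ 2 + ((b ^ 2) ^ 2) ^ 2)) := by gcongr; exact h1 _ _
    _ = _ := by ring

lemma sum_four_pow_four_le (a b c d : ℝ) :
    (a + b + c + d) ^ 4 ≤ 64 * (a ^ 4 + b ^ 4 + c ^ 4 + d ^ 4) := by
  have h1 : ∀ a b c d : ℝ, (a + b + c + d) ^ 2 ≤ 4 * (a ^ 2 + b ^ 2 + c ^ 2 + d ^ 2) :=
    fun a b c d => by
      nlinarith [sq_nonneg (a - b), sq_nonneg (a - c), sq_nonneg (a - d), sq_nonneg (b - c),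
        sq_nonneg (b - d), sq_nonneg (c - d)]
  calc (a + b + c + d) ^ 4 = ((a + b + c + d) ^ 2) ^ 2 := by ring
    _ ≤ (4 * (a ^ 2 + b ^ 2 + c ^ 2 + d ^ 2)) ^ 2 := by gcongr; exact h1 a b c d
    _ = 16 * (a ^ 2 + b ^ 2 + c ^ 2 + d ^ 2) ^ 2 := by ring
    _ ≤ 16 * (4 * ((a ^ 2) ^ 2 + (b ^ 2) ^ 2 + (c ^ 2) ^ 2 + (d ^ 2) ^ 2)) := by
        gcongr; exact h1 _ _ _ _
    _ = _ := by ring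

/-! ### Frobenius norms and eighth moments. -/

namespace LQR

variable {n d : ℕ} {sys : LQR n d} {K : Matrix (Fin d) (Fin n) ℝ} {c r : ℝ}

lemma frobSq_smul_vecMulVec {m k : ℕ} (s : ℝ) (u : Fin m → ℝ) (v : Fin k → ℝ) :
    frobSq (s • vecMulVec u v) =
      s ^ 2 * (‖WithLp.toLp 2 u‖ ^ 2 * ‖WithLp.toLp 2 v‖ ^ 2) := by
  simp only [frobSq, Matrix.smul_apply, vecMulVec_apply, smul_eq_mul, mul_pow,
    EuclideanSpace.real_norm_sq_eq, ← Finset.mul_sum, ← Finset.sum_mul]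

/-- Cauchy-Schwarz in t for each entry, with ∑ γ²ᵗ ≤ 1/(1-γ²); no independence between different
times is needed. -/
lemma frobSq_sum_smul_le {m k : ℕ} (N : ℕ) {γ : ℝ} (hγ : 0 ≤ γ) (hγ1 : γ < 1)
    (X : ℕ → Matrix (Fin m) (Fin k) ℝ) :
    frobSq (∑ t ∈ Finset.range N, γ ^ t • X t) ≤
      1 / (1 - γ ^ 2) * ∑ t ∈ Finset.range N, frobSq (X t) := by
  have hs : γ ^ 2 < 1 := by nlinarith
  have hgeo : ∑ t ∈ Finset.range N, (γ ^ t) ^ 2 ≤ 1 / (1 - γ ^ 2) := by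
    calc ∑ t ∈ Finset.range N, (γ ^ t) ^ 2 = ∑ t ∈ Finset.range N, (γ ^ 2) ^ t :=
          Finset.sum_congr rfl fun t _ => by ring
      _ ≤ ∑' t, (γ ^ 2) ^ t :=
          (summable_geometric_of_lt_one (sq_nonneg γ) hs).sum_le_tsum _ fun _ _ => by positivity
      _ = _ := by rw [tsum_geometric_of_lt_one (sq_nonneg γ) hs, one_div]
  have hentry : ∀ i j, (∑ t ∈ Finset.range N, γ ^ t • X t) i j ^ 2 ≤
      1 / (1 - γ ^ 2) * ∑ t ∈ Finset.range N, X t i j ^ 2 := fun i j => by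
    rw [Matrix.sum_apply]
    simp only [Matrix.smul_apply, smul_eq_mul]
    refine (Finset.sum_mul_sq_le_sq_mul_sq _ (fun t => γ ^ t) fun t => X t i j).trans ?_
    exact mul_le_mul_of_nonneg_right hgeo (Finset.sum_nonneg fun _ _ => sq_nonneg _)
  calc frobSq (∑ t ∈ Finset.range N, γ ^ t • X t)
      ≤ ∑ i, ∑ j, 1 / (1 - γ ^ 2) * ∑ t ∈ Finset.range N, X t i j ^ 2 :=
        Finset.sum_le_sum fun i _ => Finset.sum_le_sum fun j _ => hentry i j
    _ = _ := by
        simp only [← Finset.mul_sum, frobSq]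
        rw [Finset.sum_comm (s := Finset.range N)]
        congr 1
        exact Finset.sum_congr rfl fun i _ => Finset.sum_comm

lemma state_eq_sum {Ω : Type*} (w : ℕ → Ω → EuclideanSpace ℝ (Fin n))
    (η : ℕ → Ω → EuclideanSpace ℝ (Fin d)) (t : ℕ) (a : Ω) :
    sys.state K w η 0 t a =
      ∑ i ∈ Finset.range t, sys.closedLoop K ^ (t - 1 - i) *ᵥ sys.innov w η i a := by
  induction t with
  | zero => rfl
  | succ t ih =>
    rw [state_succ, ih, Finset.sum_range_succ, mulVec_sum]
    simp only [add_tsub_cancel_right, tsub_self, pow_zero, one_mulVec]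
    congr 1
    refine Finset.sum_congr rfl fun i hi => ?_
    have : t - i = (t - 1 - i) + 1 := by have := Finset.mem_range.1 hi; omega
    rw [mulVec_mulVec, this, pow_succ']

/-- The difference of the two covariances is Dω, which is positive semidefinite. This allows the
moments of the innovation to be bounded through its covariance and the dimensions alone, free of σ
and B. -/
lemma sq_σ_mul_norm_B_le : (sys.σ * ‖sys.B‖) ^ 2 ≤ ‖sys.noiseCov‖ := by
  have h := sq_l2_opNorm_le_of_sub_posSemidef (C := sys.σ • sys.Bᵀ) (X := sys.noiseCov) (by
    have e : sys.noiseCov - (sys.σ • sys.Bᵀ)ᵀ * (sys.σ • sys.Bᵀ) = sys.Dω := by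
      simp [noiseCov, smul_smul, sq]
    rw [e]
    exact sys.posSemidef_Dω)
  rwa [norm_smul, l2_opNorm_transpose, Real.norm_of_nonneg sys.σ_pos.le] at h

lemma norm_Dω_le : ‖sys.Dω‖ ≤ ‖sys.noiseCov‖ := by
  refine sys.posSemidef_Dω.l2_opNorm_le_of_sub ?_
  have e : sys.noiseCov - sys.Dω = sys.σ ^ 2 • (sys.B * sys.Bᵀ) := by simp [noiseCov]
  rw [e]
  refine PosSemidef.smul ?_ (sq_nonneg _)
  simpa using posSemidef_self_mul_conjTranspose sys.B

lemma norm_exploration_le : ‖sys.σ ^ 2 • (1 : Matrix (Fin d) (Fin d) ℝ)‖ ≤ sys.σ ^ 2 := by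
  rw [norm_smul, Real.norm_of_nonneg (sq_nonneg _)]
  exact mul_le_of_le_one_right (sq_nonneg _) l2_opNorm_one_le

/-- A bound on the eighth moment of the closed-loop noise. -/
def innovMoment (n d : ℕ) (D : Matrix (Fin n) (Fin n) ℝ) : ℝ :=
  128 * ‖D‖ ^ 4 * (stdMoment d 8 + stdMoment n 8)

lemma innovMoment_nonneg (D : Matrix (Fin n) (Fin n) ℝ) : 0 ≤ innovMoment n d D :=
  mul_nonneg (by positivity) (add_nonneg (stdMoment_nonneg _ _) (stdMoment_nonneg _ _))

namespace IsNoise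

variable {Ω : Type*} [MeasurableSpace Ω] {P : Measure Ω} [IsProbabilityMeasure P]
  {w : ℕ → Ω → EuclideanSpace ℝ (Fin n)} {η : ℕ → Ω → EuclideanSpace ℝ (Fin d)}
  {θ₀ : ℝ} {Θ : Matrix (Fin n) (Fin n) ℝ}

lemma hasMoments_norm_η (h : sys.IsNoise P w η) (t : ℕ) : HasMoments (fun a => ‖η t a‖) P :=
  HasMoments.norm_toLp (F := fun a => (η t a).ofLp) (h.hasMoments_η t)

lemma hasMoments_norm_w (h : sys.IsNoise P w η) (t : ℕ) : HasMoments (fun a => ‖w t a‖) P :=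
  HasMoments.norm_toLp (F := fun a => (w t a).ofLp) (h.hasMoments_w t)

lemma integral_norm_η_pow_le (h : sys.IsNoise P w η) (t p : ℕ) :
    ∫ a, ‖η t a‖ ^ (2 * p) ∂P ≤ sys.σ ^ (2 * p) * stdMoment d (2 * p) := by
  refine ((h.law_η t).gaussian_integral_norm_pow_le sys.posSemidef_exploration p).trans ?_
  rw [pow_mul sys.σ]
  refine mul_le_mul_of_nonneg_right ?_ (stdMoment_nonneg _ _)
  exact pow_le_pow_left₀ (norm_nonneg _) norm_exploration_le p

lemma integral_norm_innov_pow_le (h : sys.IsNoise P w η) (t : ℕ) :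
    ∫ a, ‖WithLp.toLp 2 (sys.innov w η t a)‖ ^ 8 ∂P ≤ innovMoment n d sys.noiseCov := by
  have hη := h.integral_norm_η_pow_le t 4
  have hw := (h.law_w t).gaussian_integral_norm_pow_le sys.posSemidef_Dω 4
  norm_num only at hη hw
  have mη := (h.hasMoments_norm_η t).pow 8
  have mw := (h.hasMoments_norm_w t).pow 8
  have hpt : ∀ a, ‖WithLp.toLp 2 (sys.innov w η t a)‖ ^ 8 ≤
      128 * (‖sys.B‖ ^ 8 * ‖η t a‖ ^ 8 + ‖w t a‖ ^ 8) := fun a => by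
    have h1 : ‖WithLp.toLp 2 (sys.innov w η t a)‖ ≤ ‖sys.B‖ * ‖η t a‖ + ‖w t a‖ := by
      rw [innov, WithLp.toLp_add]
      exact (norm_add_le _ _).trans (add_le_add (norm_toLp_mulVec_le _ _) le_rfl)
    calc _ ≤ (‖sys.B‖ * ‖η t a‖ + ‖w t a‖) ^ 8 := by gcongr
      _ ≤ 128 * ((‖sys.B‖ * ‖η t a‖) ^ 8 + ‖w t a‖ ^ 8) := add_pow_eight_le _ _
      _ = _ := by rw [mul_pow]
  have hB : (sys.σ * ‖sys.B‖) ^ 8 ≤ ‖sys.noiseCov‖ ^ 4 := by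
    calc (sys.σ * ‖sys.B‖) ^ 8 = ((sys.σ * ‖sys.B‖) ^ 2) ^ 4 := by ring
      _ ≤ _ := by gcongr; exact sq_σ_mul_norm_B_le
  have hD : ‖sys.Dω‖ ^ 4 ≤ ‖sys.noiseCov‖ ^ 4 := by gcongr; exact norm_Dω_le
  have s1 := stdMoment_nonneg d 8
  have s2 := stdMoment_nonneg n 8
  calc _ ≤ ∫ a, 128 * (‖sys.B‖ ^ 8 * ‖η t a‖ ^ 8 + ‖w t a‖ ^ 8) ∂P :=
        integral_mono ((HasMoments.norm_toLp (h.hasMoments_innov t)).pow 8).integrable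
          (((mη.const_mul _).add mw).const_mul 128).integrable hpt
    _ = 128 * (‖sys.B‖ ^ 8 * ∫ a, ‖η t a‖ ^ 8 ∂P + ∫ a, ‖w t a‖ ^ 8 ∂P) := by
        rw [integral_const_mul, integral_add (mη.const_mul _).integrable mw.integrable,
          integral_const_mul]
    _ ≤ 128 * (‖sys.B‖ ^ 8 * (sys.σ ^ 8 * stdMoment d 8) + ‖sys.Dω‖ ^ 4 * stdMoment n 8) := by
        gcongr
    _ = 128 * ((sys.σ * ‖sys.B‖) ^ 8 * stdMoment d 8 + ‖sys.Dω‖ ^ 4 * stdMoment n 8) := by ring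
    _ ≤ 128 * (‖sys.noiseCov‖ ^ 4 * stdMoment d 8 + ‖sys.noiseCov‖ ^ 4 * stdMoment n 8) := by
        gcongr
    _ = _ := by rw [innovMoment]; ring

/-- The state is a sum of innovations with geometric weights of total mass at most c/(1-r), so
Jensen bounds its eighth moment uniformly in t. -/
lemma integral_norm_state_pow_le (h : sys.IsNoise P w η) (hM : PowBound (sys.closedLoop K) c r)
    (t : ℕ) :
    ∫ a, ‖WithLp.toLp 2 (sys.state K w η 0 t a)‖ ^ 8 ∂P ≤
      (c / (1 - r)) ^ 8 * innovMoment n d sys.noiseCov := by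
  have hr := hM.nonneg
  have hr1 := hM.lt_one
  have hc := hM.const_nonneg
  let α : ℕ → ℝ := fun i => c * r ^ (t - 1 - i)
  have hα : ∀ i, 0 ≤ α i := fun i => by positivity
  have hW : ∑ i ∈ Finset.range t, α i ≤ c / (1 - r) := by
    rw [Finset.sum_range_reflect (fun i => c * r ^ i) t, ← Finset.mul_sum, div_eq_mul_inv,
      ← tsum_geometric_of_lt_one hr hr1]
    exact mul_le_mul_of_nonneg_left ((summable_geometric_of_lt_one hr hr1).sum_le_tsum _
      fun _ _ => by positivity) hc
  have hW0 : 0 ≤ ∑ i ∈ Finset.range t, α i := Finset.sum_nonneg fun i _ => hα i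
  have mv : ∀ i, HasMoments (fun a => ‖WithLp.toLp 2 (sys.innov w η i a)‖ ^ 8) P := fun i =>
    (HasMoments.norm_toLp (h.hasMoments_innov i)).pow 8
  have hpt : ∀ a, ‖WithLp.toLp 2 (sys.state K w η 0 t a)‖ ^ 8 ≤ (c / (1 - r)) ^ 7 *
      ∑ i ∈ Finset.range t, α i * ‖WithLp.toLp 2 (sys.innov w η i a)‖ ^ 8 := fun a => by
    have h1 : ‖WithLp.toLp 2 (sys.state K w η 0 t a)‖ ≤
        ∑ i ∈ Finset.range t, α i * ‖WithLp.toLp 2 (sys.innov w η i a)‖ := by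
      rw [state_eq_sum, WithLp.toLp_sum]
      refine (norm_sum_le _ _).trans (Finset.sum_le_sum fun i _ => ?_)
      exact (norm_toLp_mulVec_le _ _).trans
        (mul_le_mul_of_nonneg_right (hM.norm_pow_le _) (norm_nonneg _))
    calc _ ≤ (∑ i ∈ Finset.range t, α i * ‖WithLp.toLp 2 (sys.innov w η i a)‖) ^ 8 := by gcongr
      _ ≤ _ := sum_mul_pow_eight_le _ α _ fun i _ => hα i
      _ ≤ _ := mul_le_mul_of_nonneg_right (pow_le_pow_left₀ hW0 hW 7)
          (Finset.sum_nonneg fun i _ => mul_nonneg (hα i) (by positivity))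
  have hκ : 0 ≤ c / (1 - r) := div_nonneg hc (by linarith)
  calc _ ≤ ∫ a, (c / (1 - r)) ^ 7 *
        ∑ i ∈ Finset.range t, α i * ‖WithLp.toLp 2 (sys.innov w η i a)‖ ^ 8 ∂P :=
        integral_mono ((HasMoments.norm_toLp (h.hasMoments_state K 0 t)).pow 8).integrable
          ((HasMoments.sum _ fun i _ => (mv i).const_mul (α i)).const_mul _).integrable hpt
    _ = (c / (1 - r)) ^ 7 *
        ∑ i ∈ Finset.range t, α i * ∫ a, ‖WithLp.toLp 2 (sys.innov w η i a)‖ ^ 8 ∂P := by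
        rw [integral_const_mul, integral_finsetSum _ fun i _ => ((mv i).const_mul (α i)).integrable]
        simp only [integral_const_mul]
    _ ≤ (c / (1 - r)) ^ 7 * ∑ i ∈ Finset.range t, α i * innovMoment n d sys.noiseCov := by
        refine mul_le_mul_of_nonneg_left (Finset.sum_le_sum fun i _ => ?_) (pow_nonneg hκ 7)
        exact mul_le_mul_of_nonneg_left (h.integral_norm_innov_pow_le i) (hα i)
    _ ≤ (c / (1 - r)) ^ 7 * (c / (1 - r) * innovMoment n d sys.noiseCov) := by
        rw [← Finset.sum_mul]
        exact mul_le_mul_of_nonneg_left (mul_le_mul_of_nonneg_right hW (innovMoment_nonneg _))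
          (pow_nonneg hκ 7)
    _ = _ := by ring

/-- The contribution of the quadratic exploration cost. -/
lemma integral_norm_η_pow_mul_norm_state_sq_le (h : sys.IsNoise P w η)
    (hM : PowBound (sys.closedLoop K) c r) (t : ℕ) :
    ∫ a, ‖η t a‖ ^ 6 * ‖WithLp.toLp 2 (sys.state K w η 0 t a)‖ ^ 2 ∂P ≤
      sys.σ ^ 6 * stdMoment d 6 * (sys.stationaryCov K).trace := by
  have mη := (h.hasMoments_norm_η t).pow 6
  have mx := (HasMoments.norm_toLp (h.hasMoments_state K 0 t)).pow 2
  have hind : IndepFun (fun a => ‖WithLp.toLp 2 (sys.state K w η 0 t a)‖ ^ 2)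
      (fun a => ‖η t a‖ ^ 6) P := by
    have hφ : Measurable fun x : Fin n → ℝ => ‖WithLp.toLp 2 x‖ ^ 2 :=
      Continuous.measurable (by fun_prop)
    have hψ : Measurable fun y : EuclideanSpace ℝ (Fin n) × EuclideanSpace ℝ (Fin d) =>
      ‖y.2‖ ^ 6 := by fun_prop
    exact (h.indepFun_state K 0 t).comp hφ hψ
  have hx : ∫ a, ‖WithLp.toLp 2 (sys.state K w η 0 t a)‖ ^ 2 ∂P =
      (covSeq (sys.closedLoop K) sys.noiseCov t).trace := by
    have := h.integral_state_zero_quadratic K t 1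
    simpa [dotProduct_self_eq_norm_sq] using this
  have hη := h.integral_norm_η_pow_le t 3
  norm_num only at hη
  rw [hind.symm.integral_fun_mul_eq_mul_integral mη.aestronglyMeasurable mx.aestronglyMeasurable,
    hx]
  exact mul_le_mul hη (hM.trace_covSeq_le sys.noiseCov_posSemidef t)
    (covSeq_posSemidef _ sys.noiseCov_posSemidef t).trace_nonneg
    (mul_nonneg (pow_nonneg sys.σ_pos.le 6) (stdMoment_nonneg _ _))

end IsNoise

end LQR

/-! ### Bounds through the level (1-γ)J(K) and growth inequalities. -/

lemma sigmaMin_nonneg {n : ℕ} (X : Matrix (Fin n) (Fin n) ℝ) : 0 ≤ sigmaMin X :=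
  LinearMap.singularValues_nonneg _ _

namespace LQR

variable {n d : ℕ} {sys : LQR n d} {K : Matrix (Fin d) (Fin n) ℝ} {c r : ℝ}

lemma norm_costMat_le : ‖sys.costMat K‖ ≤ ‖sys.S‖ + ‖K‖ ^ 2 * ‖sys.R‖ := by
  refine (norm_add_le _ _).trans (add_le_add le_rfl ?_)
  have h1 := l2_opNorm_mul (Kᵀ * sys.R) K
  have h2 := l2_opNorm_mul Kᵀ sys.R
  rw [l2_opNorm_transpose] at h2
  nlinarith [norm_nonneg K]

lemma theta_posSemidef (hM : PowBound (sys.closedLoop K) c r) : (sys.theta K).PosSemidef :=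
  hM.valueMat_posSemidef sys.γ_pos.le sys.γ_lt_one (sys.costMat_posSemidef K)

lemma norm_theta_le (hM : PowBound (sys.closedLoop K) c r) :
    ‖sys.theta K‖ ≤ (‖sys.S‖ + ‖K‖ ^ 2 * ‖sys.R‖) * (c ^ 2 / (1 - r ^ 2)) := by
  refine (hM.norm_valueMat_le sys.γ_pos.le sys.γ_lt_one _).trans ?_
  rw [mul_comm]
  exact mul_le_mul_of_nonneg_right norm_costMat_le hM.gap_nonneg

lemma norm_closedLoop_le (hM : PowBound (sys.closedLoop K) c r) : ‖sys.closedLoop K‖ ≤ c := by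
  have h1 := hM.norm_pow_le 1
  rw [pow_one, pow_one] at h1
  exact h1.trans (mul_le_of_le_one_right hM.const_nonneg hM.lt_one.le)

namespace IsNoise

variable {Ω : Type*} [MeasurableSpace Ω] {P : Measure Ω} [IsProbabilityMeasure P]
  {w : ℕ → Ω → EuclideanSpace ℝ (Fin n)} {η : ℕ → Ω → EuclideanSpace ℝ (Fin d)}
  {θ₀ ε₀ : ℝ} {Θ : Matrix (Fin n) (Fin n) ℝ}

lemma trace_theta_mul_nonneg (hM : PowBound (sys.closedLoop K) c r) :
    0 ≤ (sys.theta K * sys.noiseCov).trace :=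
  (mul_nonneg (sigmaMin_nonneg _) (theta_posSemidef hM).trace_nonneg).trans
    (sigmaMin_mul_trace_le sys.noiseCov_posSemidef (theta_posSemidef hM))

lemma sq_σ_mul_trace_le_level (h : sys.IsNoise P w η) (hM : PowBound (sys.closedLoop K) c r) :
    sys.σ ^ 2 * sys.R.trace ≤ (1 - sys.γ) * sys.J K w η P := by
  rw [h.level_eq hM]
  linarith [mul_nonneg sys.γ_pos.le (trace_theta_mul_nonneg hM)]

lemma level_nonneg (h : sys.IsNoise P w η) (hM : PowBound (sys.closedLoop K) c r) :
    0 ≤ (1 - sys.γ) * sys.J K w η P :=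
  (mul_nonneg (sq_nonneg _) sys.posDef_R.posSemidef.trace_nonneg).trans
    (h.sq_σ_mul_trace_le_level hM)

lemma level_pos (h : sys.IsNoise P w η) (hM : PowBound (sys.closedLoop K) c r) (hd : 0 < d) :
    0 < (1 - sys.γ) * sys.J K w η P := by
  have : Nonempty (Fin d) := ⟨⟨0, hd⟩⟩
  exact (mul_pos (pow_pos sys.σ_pos 2) sys.posDef_R.trace_pos).trans_le
    (h.sq_σ_mul_trace_le_level hM)

lemma sq_σ_mul_norm_R_le (h : sys.IsNoise P w η) (hM : PowBound (sys.closedLoop K) c r) :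
    sys.σ ^ 2 * ‖sys.R‖ ≤ (1 - sys.γ) * sys.J K w η P :=
  (mul_le_mul_of_nonneg_left sys.posDef_R.posSemidef.l2_opNorm_le_trace (sq_nonneg _)).trans
    (h.sq_σ_mul_trace_le_level hM)

/-- Here ‖Θ‖ ≤ tr Θ ≤ tr(ΘD)/σ_min(D), and γ tr(ΘD) is part of the level. The gradient contains Θ
only with the factor γ, so no 1/γ arises. -/
lemma γ_mul_norm_theta_le (h : sys.IsNoise P w η) (hM : PowBound (sys.closedLoop K) c r)
    (hD : sys.noiseCov.PosDef) (hn : 0 < n) :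
    sys.γ * ‖sys.theta K‖ ≤ (1 - sys.γ) * sys.J K w η P / sigmaMin sys.noiseCov := by
  have hs := sigmaMin_pos hD hn
  rw [le_div_iff₀ hs, h.level_eq hM]
  have h1 := sigmaMin_mul_trace_le sys.noiseCov_posSemidef (theta_posSemidef hM)
  have h2 := (theta_posSemidef hM).l2_opNorm_le_trace
  have h3 : 0 ≤ sys.σ ^ 2 * sys.R.trace :=
    mul_nonneg (sq_nonneg _) sys.posDef_R.posSemidef.trace_nonneg
  calc sys.γ * ‖sys.theta K‖ * sigmaMin sys.noiseCov
      = sys.γ * (sigmaMin sys.noiseCov * ‖sys.theta K‖) := by ring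
    _ ≤ sys.γ * (sigmaMin sys.noiseCov * (sys.theta K).trace) := by
        have := sys.γ_pos.le
        gcongr
    _ ≤ sys.γ * (sys.theta K * sys.noiseCov).trace :=
        mul_le_mul_of_nonneg_left h1 sys.γ_pos.le
    _ ≤ _ := by linarith

end IsNoise

/-- The growth constant of the temporal difference. -/
def tdConst (normS normR normK level s c : ℝ) : ℝ :=
  (normS + normK ^ 2 * normR) + normR * normK ^ 2 + (level + 1) +
    ((normS + normK ^ 2 * normR) * s + 1) * (2 * c ^ 2 + 3)

/-- X, Z, V stand for the norms of the state, the exploration noise and the innovation, T for the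
norm of the approximate value matrix, and Zσ for (Z/σ)². The cross term is split by the
arithmetic-geometric mean inequality; the resulting R Z² is traded for lev·Zσ, which keeps σ out of
the constant. -/
lemma tdConst_growth {S K R lev s c ε X Z V Zσ T : ℝ} (hS : 0 ≤ S) (hR : 0 ≤ R)
    (hlev : 0 ≤ lev) (hs : 0 ≤ s) (hε : 0 ≤ ε) (hZσ : 0 ≤ Zσ)
    (hT : T ≤ ((S + K ^ 2 * R) * s + 1) * (1 + ε)) (hRZ : R * Z ^ 2 ≤ lev * Zσ) :
    (S + K ^ 2 * R) * X ^ 2 + 2 * (K * R * X * Z) + (lev + ε) +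
        T * (2 * c ^ 2 * X ^ 2 + 2 * V ^ 2) + T * X ^ 2 ≤
      tdConst S R K lev s c * (1 + ε) * (1 + X ^ 2 + Zσ + V ^ 2) := by
  rw [tdConst]
  have hq0 : 0 ≤ S + K ^ 2 * R := by positivity
  set q := S + K ^ 2 * R
  set W := 1 + X ^ 2 + Zσ + V ^ 2 with hW
  have hX2 := sq_nonneg X
  have hV2 := sq_nonneg V
  have hu : 1 ≤ 1 + ε := by linarith
  have hu0 : 0 ≤ 1 + ε := by linarith
  have hWX : X ^ 2 ≤ W := by linarith
  have hWXV : X ^ 2 + V ^ 2 ≤ W := by linarith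
  have hWZ : 1 + Zσ ≤ W := by linarith
  have hW0 : 0 ≤ W := by positivity
  have c0 : 2 * (K * R * X * Z) ≤ R * K ^ 2 * X ^ 2 + R * Z ^ 2 := by
    have := mul_nonneg hR (sq_nonneg (K * X - Z))
    linarith [show R * (K * X - Z) ^ 2 = R * K ^ 2 * X ^ 2 + R * Z ^ 2 - 2 * (K * R * X * Z) by ring]
  have c1 : q * X ^ 2 ≤ q * (1 + ε) * W :=
    mul_le_mul (le_mul_of_one_le_right hq0 hu) hWX hX2 (by positivity)
  have c2 : R * K ^ 2 * X ^ 2 ≤ R * K ^ 2 * (1 + ε) * W :=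
    mul_le_mul (le_mul_of_one_le_right (by positivity) hu) hWX hX2 (by positivity)
  have c3 : lev * Zσ + (lev + ε) ≤ (lev + 1) * (1 + ε) * W := by
    have k1 : 0 ≤ lev * ε := by positivity
    have k2 : 0 ≤ ε * Zσ := by positivity
    have k3 : 0 ≤ lev * ε * Zσ := by positivity
    calc lev * Zσ + (lev + ε) ≤ (lev + 1) * (1 + ε) * (1 + Zσ) := by
          have e : (lev + 1) * (1 + ε) * (1 + Zσ) =
            lev + lev * ε + 1 + ε + lev * Zσ + lev * ε * Zσ + Zσ + ε * Zσ := by ring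
          linarith
      _ ≤ _ := by gcongr
  have c4 : T * (2 * c ^ 2 * X ^ 2 + 2 * V ^ 2) + T * X ^ 2 ≤
      (q * s + 1) * (2 * c ^ 2 + 3) * (1 + ε) * W := by
    have k0 : 0 ≤ q * s := mul_nonneg hq0 hs
    calc _ = T * (2 * c ^ 2 * X ^ 2 + X ^ 2 + 2 * V ^ 2) := by ring
      _ ≤ ((q * s + 1) * (1 + ε)) * ((2 * c ^ 2 + 3) * W) := by
          refine mul_le_mul hT ?_ (by positivity) (by positivity)
          calc 2 * c ^ 2 * X ^ 2 + X ^ 2 + 2 * V ^ 2 ≤ (2 * c ^ 2 + 3) * (X ^ 2 + V ^ 2) := by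
                have k1 : 0 ≤ c ^ 2 * V ^ 2 := by positivity
                have e : (2 * c ^ 2 + 3) * (X ^ 2 + V ^ 2) =
                  2 * c ^ 2 * X ^ 2 + 2 * (c ^ 2 * V ^ 2) + 3 * X ^ 2 + 3 * V ^ 2 := by ring
                linarith
            _ ≤ _ := by gcongr
      _ = _ := by ring
  calc _ ≤ q * (1 + ε) * W + R * K ^ 2 * (1 + ε) * W + (lev + 1) * (1 + ε) * W +
        (q * s + 1) * (2 * c ^ 2 + 3) * (1 + ε) * W := by linarith
    _ = _ := by ring

/-- Here ρ is the exploration cost ηᵀRη. Squaring δ = (δ - ρ) + ρ separates a part governed by σ²W⁴,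
hence by eighth powers, from a part with Z⁶X². The constant is 256 = 2·2·64, from the squares of two
sums and from `sum_four_pow_four_le`. -/
lemma sq_mul_le_of_growth {δ ρ H ε R σ X Z V : ℝ} (hσ : 0 < σ)
    (h1 : |δ - ρ| ≤ H * (1 + ε) * (1 + X ^ 2 + (Z / σ) ^ 2 + V ^ 2)) (h2 : |ρ| ≤ R * Z * Z) :
    δ ^ 2 * (Z ^ 2 * X ^ 2) ≤
      256 * H ^ 2 * (1 + ε ^ 2) * σ ^ 2 * (1 + X ^ 8 + 1 / σ ^ 8 * Z ^ 8 + V ^ 8) +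
        2 * R ^ 2 * (Z ^ 6 * X ^ 2) := by
  set W := 1 + X ^ 2 + (Z / σ) ^ 2 + V ^ 2 with hW
  have hX2 := sq_nonneg X
  have hV2 := sq_nonneg V
  have hZ2 := sq_nonneg (Z / σ)
  have hW1 : 0 ≤ W := by positivity
  have g1 : (δ - ρ) ^ 2 ≤ (H * (1 + ε) * W) ^ 2 := sq_le_sq.2 (h1.trans (le_abs_self _))
  have g2 : ρ ^ 2 ≤ (R * Z * Z) ^ 2 := sq_le_sq.2 (h2.trans (le_abs_self _))
  have g3 : δ ^ 2 ≤ 2 * (H * (1 + ε) * W) ^ 2 + 2 * (R * Z * Z) ^ 2 := by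
    have := sq_nonneg (δ - ρ - ρ)
    have e : δ ^ 2 = 2 * (δ - ρ) ^ 2 + 2 * ρ ^ 2 - (δ - ρ - ρ) ^ 2 := by ring
    linarith
  have g4 : (1 + ε) ^ 2 ≤ 2 * (1 + ε ^ 2) := by
    have := sq_nonneg (1 - ε)
    have e : (1 + ε) ^ 2 = 2 * (1 + ε ^ 2) - (1 - ε) ^ 2 := by ring
    linarith
  have g5 : W ^ 2 * (Z ^ 2 * X ^ 2) ≤ σ ^ 2 * (64 * (1 + X ^ 8 + 1 / σ ^ 8 * Z ^ 8 + V ^ 8)) := by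
    have e : Z ^ 2 = σ ^ 2 * (Z / σ) ^ 2 := by field_simp
    have k1 : (Z / σ) ^ 2 ≤ W := by linarith
    have k2 : X ^ 2 ≤ W := by linarith
    calc W ^ 2 * (Z ^ 2 * X ^ 2) = σ ^ 2 * (W ^ 2 * ((Z / σ) ^ 2 * X ^ 2)) := by
          rw [e]; ring
      _ ≤ σ ^ 2 * (W ^ 2 * (W * W)) := by gcongr
      _ = σ ^ 2 * W ^ 4 := by ring
      _ ≤ σ ^ 2 * (64 * (1 ^ 4 + (X ^ 2) ^ 4 + ((Z / σ) ^ 2) ^ 4 + (V ^ 2) ^ 4)) := by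
          gcongr
          exact sum_four_pow_four_le _ _ _ _
      _ = _ := by
          have e2 : ((Z / σ) ^ 2) ^ 4 = 1 / σ ^ 8 * Z ^ 8 := by
            rw [div_pow, div_pow]; ring
          rw [e2]; ring
  calc δ ^ 2 * (Z ^ 2 * X ^ 2)
      ≤ (2 * (H * (1 + ε) * W) ^ 2 + 2 * (R * Z * Z) ^ 2) * (Z ^ 2 * X ^ 2) := by gcongr
    _ = 2 * H ^ 2 * (1 + ε) ^ 2 * (W ^ 2 * (Z ^ 2 * X ^ 2)) + 2 * R ^ 2 * (Z ^ 6 * X ^ 2) := by ring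
    _ ≤ 2 * H ^ 2 * (2 * (1 + ε ^ 2)) *
        (σ ^ 2 * (64 * (1 + X ^ 8 + 1 / σ ^ 8 * Z ^ 8 + V ^ 8))) +
          2 * R ^ 2 * (Z ^ 6 * X ^ 2) := by gcongr
    _ = _ := by ring

/-! ### Second moment of the estimator. -/

namespace IsNoise

variable {Ω : Type*} [MeasurableSpace Ω] {P : Measure Ω} [IsProbabilityMeasure P]
  {w : ℕ → Ω → EuclideanSpace ℝ (Fin n)} {η : ℕ → Ω → EuclideanSpace ℝ (Fin d)}
  {θ₀ ε₀ : ℝ} {Θ : Matrix (Fin n) (Fin n) ℝ}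

lemma abs_tdError_sub_le (h : sys.IsNoise P w η) (hM : PowBound (sys.closedLoop K) c r)
    (hθ : sys.IsApproxValue K w η P θ₀ Θ ε₀) (t : ℕ) (a : Ω) :
    |sys.tdError K w η θ₀ Θ t a - (η t a).ofLp ⬝ᵥ sys.R *ᵥ (η t a).ofLp| ≤
      tdConst ‖sys.S‖ ‖sys.R‖ ‖K‖ ((1 - sys.γ) * sys.J K w η P) (c ^ 2 / (1 - r ^ 2)) c * (1 + ε₀) *
        (1 + ‖WithLp.toLp 2 (sys.state K w η 0 t a)‖ ^ 2 + (‖η t a‖ / sys.σ) ^ 2 +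
          ‖WithLp.toLp 2 (sys.innov w η t a)‖ ^ 2) := by
  obtain ⟨hε0, hε1, hε2⟩ := h.approx_bound hM hθ
  have hlev := h.level_nonneg hM
  have hRlev := h.sq_σ_mul_norm_R_le hM
  have hγ := sys.γ_pos
  have hγ1 := sys.γ_lt_one
  have hσ := sys.σ_pos
  have hc := hM.const_nonneg
  have hs := hM.gap_nonneg
  have hT := norm_theta_le hM
  have hMn := norm_closedLoop_le hM
  have hq := norm_costMat_le (sys := sys) (K := K)
  have hx' : sys.state K w η 0 (t + 1) a = _ := sys.state_succ K w η 0 t a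
  set x := sys.state K w η 0 t a with hx
  set v := sys.innov w η t a with hv
  set z := (η t a).ofLp with hz
  set x' := sys.state K w η 0 (t + 1) a with hxs
  have hzn : ‖η t a‖ = ‖WithLp.toLp 2 z‖ := by rw [hz]
  rw [hzn]
  set X := ‖WithLp.toLp 2 x‖
  set V := ‖WithLp.toLp 2 v‖
  set Z := ‖WithLp.toLp 2 z‖
  set q := ‖sys.S‖ + ‖K‖ ^ 2 * ‖sys.R‖ with hqdef
  set s := c ^ 2 / (1 - r ^ 2)
  set lev := (1 - sys.γ) * sys.J K w η P with hlevdef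
  have hX0 : 0 ≤ X := norm_nonneg _
  have hV0 : 0 ≤ V := norm_nonneg _
  have hZ0 : 0 ≤ Z := norm_nonneg _
  have hR0 : 0 ≤ ‖sys.R‖ := norm_nonneg _
  have hK0 : 0 ≤ ‖K‖ := norm_nonneg _
  have hq0 : 0 ≤ q := by positivity
  have hΘ : ‖Θ‖ ≤ (q * s + 1) * (1 + ε₀) := by
    have h1 : ‖Θ‖ ≤ ‖Θ - sys.theta K‖ + ‖sys.theta K‖ := by
      simpa using norm_add_le (Θ - sys.theta K) (sys.theta K)
    nlinarith [mul_nonneg (mul_nonneg hq0 hs) hε0]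
  have a1 : |x ⬝ᵥ sys.costMat K *ᵥ x| ≤ q * X ^ 2 := by
    refine (abs_dotProduct_mulVec_le _ _ _).trans ?_
    rw [mul_assoc, ← sq]
    gcongr
  have a2 : |x ⬝ᵥ (Kᵀ * sys.R) *ᵥ z| ≤ ‖K‖ * ‖sys.R‖ * X * Z := by
    refine (abs_dotProduct_mulVec_le _ _ _).trans ?_
    have := l2_opNorm_mul Kᵀ sys.R
    rw [l2_opNorm_transpose] at this
    gcongr
  have hX' : ‖WithLp.toLp 2 x'‖ ≤ c * X + V := by
    rw [hx', WithLp.toLp_add]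
    refine (norm_add_le _ _).trans (add_le_add ((norm_toLp_mulVec_le _ _).trans ?_) le_rfl)
    gcongr
  have a3 : |x' ⬝ᵥ Θ *ᵥ x'| ≤ ‖Θ‖ * (2 * c ^ 2 * X ^ 2 + 2 * V ^ 2) := by
    refine (abs_dotProduct_mulVec_le _ _ _).trans ?_
    rw [mul_assoc, ← sq]
    refine mul_le_mul_of_nonneg_left ?_ (norm_nonneg _)
    calc ‖WithLp.toLp 2 x'‖ ^ 2 ≤ (c * X + V) ^ 2 := by gcongr
      _ ≤ _ := by nlinarith [sq_nonneg (c * X - V)]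
  have a4 : |x ⬝ᵥ Θ *ᵥ x| ≤ ‖Θ‖ * X ^ 2 := by
    refine (abs_dotProduct_mulVec_le _ _ _).trans_eq ?_
    rw [mul_assoc, ← sq]
  -- After removing the quadratic forms, θ₀ survives only as (1-γ)θ₀, which is within ε₀ of the
  -- level; a bound on θ₀ itself would bring in 1/(1-γ).
  have a5 : |(1 - sys.γ) * θ₀| ≤ lev + ε₀ := by
    have e : (1 - sys.γ) * θ₀ = lev + (1 - sys.γ) * (θ₀ - sys.J K w η P) := by
      rw [hlevdef]; ring
    rw [e]
    refine (abs_add_le _ _).trans (add_le_add (abs_of_nonneg hlev).le ?_)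
    rw [abs_mul, abs_of_pos (by linarith)]
    calc (1 - sys.γ) * |θ₀ - sys.J K w η P| ≤ 1 * ε₀ :=
          mul_le_mul (by linarith) hε1 (abs_nonneg _) zero_le_one
      _ = ε₀ := one_mul _
  have hRZ : ‖sys.R‖ * Z ^ 2 ≤ lev * (Z / sys.σ) ^ 2 := by
    have e : ‖sys.R‖ * Z ^ 2 = sys.σ ^ 2 * ‖sys.R‖ * (Z / sys.σ) ^ 2 := by
      field_simp
    rw [e]
    gcongr
  have e : sys.tdError K w η θ₀ Θ t a - z ⬝ᵥ sys.R *ᵥ z =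
      x ⬝ᵥ sys.costMat K *ᵥ x + 2 * (x ⬝ᵥ (Kᵀ * sys.R) *ᵥ z) - (1 - sys.γ) * θ₀ +
        sys.γ * (x' ⬝ᵥ Θ *ᵥ x') - x ⬝ᵥ Θ *ᵥ x := by
    rw [tdError, runCost_eq, approxV, approxV]
    ring
  have b3 : |sys.γ * (x' ⬝ᵥ Θ *ᵥ x')| ≤ ‖Θ‖ * (2 * c ^ 2 * X ^ 2 + 2 * V ^ 2) := by
    rw [abs_mul, abs_of_pos hγ]
    exact (mul_le_of_le_one_left (abs_nonneg _) hγ1.le).trans a3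
  have key : |sys.tdError K w η θ₀ Θ t a - z ⬝ᵥ sys.R *ᵥ z| ≤
      q * X ^ 2 + 2 * (‖K‖ * ‖sys.R‖ * X * Z) + (lev + ε₀) +
        ‖Θ‖ * (2 * c ^ 2 * X ^ 2 + 2 * V ^ 2) + ‖Θ‖ * X ^ 2 := by
    rw [e]
    rw [abs_le] at a1 a2 a4 a5 b3 ⊢
    constructor
    · linarith only [a1.1, a2.1, a4.2, a5.2, b3.1]
    · linarith only [a1.2, a2.2, a4.1, a5.1, b3.2]
  exact key.trans (tdConst_growth (norm_nonneg _) hR0 hlev hs hε0 (sq_nonneg _)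
    hΘ hRZ)

/-- A bound on the second moment of a term of the estimator. -/
lemma integral_sq_tdError_mul_le (h : sys.IsNoise P w η) (hM : PowBound (sys.closedLoop K) c r)
    (hθ : sys.IsApproxValue K w η P θ₀ Θ ε₀) (t : ℕ) :
    ∫ a, sys.tdError K w η θ₀ Θ t a ^ 2 *
        (‖η t a‖ ^ 2 * ‖WithLp.toLp 2 (sys.state K w η 0 t a)‖ ^ 2) ∂P ≤
      256 * tdConst ‖sys.S‖ ‖sys.R‖ ‖K‖ ((1 - sys.γ) * sys.J K w η P)
        (c ^ 2 / (1 - r ^ 2)) c ^ 2 * (1 + ε₀ ^ 2) * sys.σ ^ 2 *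
        (1 + (c / (1 - r)) ^ 8 * innovMoment n d sys.noiseCov + stdMoment d 8 +
          innovMoment n d sys.noiseCov) +
      2 * ‖sys.R‖ ^ 2 * (sys.σ ^ 6 * stdMoment d 6 * (sys.stationaryCov K).trace) := by
  have hσ := sys.σ_pos
  set H := tdConst ‖sys.S‖ ‖sys.R‖ ‖K‖ ((1 - sys.γ) * sys.J K w η P) (c ^ 2 / (1 - r ^ 2)) c
    with hH
  have mx : HasMoments (fun a => ‖WithLp.toLp 2 (sys.state K w η 0 t a)‖) P :=
    HasMoments.norm_toLp (h.hasMoments_state K 0 t)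
  have mv : HasMoments (fun a => ‖WithLp.toLp 2 (sys.innov w η t a)‖) P :=
    HasMoments.norm_toLp (h.hasMoments_innov t)
  have mη := h.hasMoments_norm_η t
  have htd := h.abs_tdError_sub_le hM hθ t
  have hx8 := h.integral_norm_state_pow_le hM t
  have hv8 := h.integral_norm_innov_pow_le t
  have hη8 := h.integral_norm_η_pow_le t 4
  have hlast := h.integral_norm_η_pow_mul_norm_state_sq_le hM t
  norm_num only at hη8
  have hpt : ∀ a, sys.tdError K w η θ₀ Θ t a ^ 2 *
        (‖η t a‖ ^ 2 * ‖WithLp.toLp 2 (sys.state K w η 0 t a)‖ ^ 2) ≤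
      256 * H ^ 2 * (1 + ε₀ ^ 2) * sys.σ ^ 2 *
        (1 + ‖WithLp.toLp 2 (sys.state K w η 0 t a)‖ ^ 8 + 1 / sys.σ ^ 8 * ‖η t a‖ ^ 8 +
          ‖WithLp.toLp 2 (sys.innov w η t a)‖ ^ 8) +
      2 * ‖sys.R‖ ^ 2 * (‖η t a‖ ^ 6 * ‖WithLp.toLp 2 (sys.state K w η 0 t a)‖ ^ 2) := by
    intro a
    have h2 := abs_dotProduct_mulVec_le sys.R (η t a).ofLp (η t a).ofLp
    rw [WithLp.toLp_ofLp] at h2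
    exact sq_mul_le_of_growth hσ (htd a) h2
  have m8 : HasMoments (fun a => 1 + ‖WithLp.toLp 2 (sys.state K w η 0 t a)‖ ^ 8 +
      1 / sys.σ ^ 8 * ‖η t a‖ ^ 8 + ‖WithLp.toLp 2 (sys.innov w η t a)‖ ^ 8) P :=
    (((HasMoments.const 1).add (mx.pow 8)).add ((mη.pow 8).const_mul _)).add (mv.pow 8)
  have m6 := ((mη.pow 6).mul (mx.pow 2))
  have hη8' : 1 / sys.σ ^ 8 * ∫ a, ‖η t a‖ ^ 8 ∂P ≤ stdMoment d 8 := by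
    calc _ ≤ 1 / sys.σ ^ 8 * (sys.σ ^ 8 * stdMoment d 8) := by gcongr
      _ = _ := by field_simp
  calc _ ≤ _ := integral_mono
        (((h.hasMoments_tdError t).pow 2).mul ((mη.pow 2).mul (mx.pow 2))).integrable
        ((m8.const_mul _).add (m6.const_mul _)).integrable hpt
    _ = 256 * H ^ 2 * (1 + ε₀ ^ 2) * sys.σ ^ 2 *
        (1 + ∫ a, ‖WithLp.toLp 2 (sys.state K w η 0 t a)‖ ^ 8 ∂P +
          1 / sys.σ ^ 8 * ∫ a, ‖η t a‖ ^ 8 ∂P +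
          ∫ a, ‖WithLp.toLp 2 (sys.innov w η t a)‖ ^ 8 ∂P) +
        2 * ‖sys.R‖ ^ 2 *
          ∫ a, ‖η t a‖ ^ 6 * ‖WithLp.toLp 2 (sys.state K w η 0 t a)‖ ^ 2 ∂P := by
        rw [integral_add (m8.const_mul _).integrable (m6.const_mul _).integrable,
          integral_const_mul, integral_const_mul,
          integral_add (((HasMoments.const 1).add (mx.pow 8)).add
            ((mη.pow 8).const_mul _)).integrable (mv.pow 8).integrable,
          integral_add ((HasMoments.const 1).add (mx.pow 8)).integrable
            ((mη.pow 8).const_mul _).integrable,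
          integral_add (HasMoments.const 1).integrable (mx.pow 8).integrable, integral_const_mul]
        simp
    _ ≤ _ := by gcongr

/-- The second moment of the actor-critic estimator. -/
lemma integral_frobSq_acEstimator_le (h : sys.IsNoise P w η)
    (hM : PowBound (sys.closedLoop K) c r) (hθ : sys.IsApproxValue K w η P θ₀ Θ ε₀) (L : ℕ) :
    ∫ a, frobSq (sys.acEstimator K w η θ₀ Θ L a) ∂P ≤
      (256 * tdConst ‖sys.S‖ ‖sys.R‖ ‖K‖ ((1 - sys.γ) * sys.J K w η P)
          (c ^ 2 / (1 - r ^ 2)) c ^ 2 *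
          (1 + (c / (1 - r)) ^ 8 * innovMoment n d sys.noiseCov + stdMoment d 8 +
            innovMoment n d sys.noiseCov) * (1 + ε₀ ^ 2) / sys.σ ^ 2 +
        2 * ‖sys.R‖ ^ 2 * stdMoment d 6 * (sys.stationaryCov K).trace * sys.σ ^ 2) *
      (L / (1 - sys.γ ^ 2)) := by
  have hσ := sys.σ_pos
  have hγ2 : 0 < 1 - sys.γ ^ 2 := by nlinarith [sys.γ_pos, sys.γ_lt_one]
  set Bd := 256 * tdConst ‖sys.S‖ ‖sys.R‖ ‖K‖ ((1 - sys.γ) * sys.J K w η P)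
          (c ^ 2 / (1 - r ^ 2)) c ^ 2 *
          (1 + (c / (1 - r)) ^ 8 * innovMoment n d sys.noiseCov + stdMoment d 8 +
            innovMoment n d sys.noiseCov) * (1 + ε₀ ^ 2) / sys.σ ^ 2 +
        2 * ‖sys.R‖ ^ 2 * stdMoment d 6 * (sys.stationaryCov K).trace * sys.σ ^ 2 with hBd
  let X : ℕ → Ω → Matrix (Fin d) (Fin n) ℝ := fun t a =>
    (1 / sys.σ ^ 2 * sys.tdError K w η θ₀ Θ t a) •
      vecMulVec (η t a).ofLp (sys.state K w η 0 t a)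
  have hX : ∀ a, sys.acEstimator K w η θ₀ Θ L a =
      ∑ t ∈ Finset.range (L + 1), sys.γ ^ t • X t a := fun a => by
    simp only [acEstimator, control, add_sub_cancel_left, Finset.smul_sum, smul_smul, X]
    exact Finset.sum_congr rfl fun t _ => by congr 1; ring
  have hXf : ∀ t a, frobSq (X t a) = (1 / sys.σ ^ 2) ^ 2 * (sys.tdError K w η θ₀ Θ t a ^ 2 *
      (‖η t a‖ ^ 2 * ‖WithLp.toLp 2 (sys.state K w η 0 t a)‖ ^ 2)) := fun t a => by
    simp only [X, frobSq_smul_vecMulVec, WithLp.toLp_ofLp]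
    ring
  have mX : ∀ t, HasMoments (fun a => frobSq (X t a)) P := fun t => by
    simp only [hXf]
    exact (((h.hasMoments_tdError t).pow 2).mul (((h.hasMoments_norm_η t).pow 2).mul
      ((HasMoments.norm_toLp (h.hasMoments_state K 0 t)).pow 2))).const_mul _
  have hbd : ∀ t, ∫ a, frobSq (X t a) ∂P ≤ Bd := fun t => by
    simp only [hXf]
    rw [integral_const_mul]
    calc _ ≤ (1 / sys.σ ^ 2) ^ 2 * _ :=
          mul_le_mul_of_nonneg_left (h.integral_sq_tdError_mul_le hM hθ t) (sq_nonneg _)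
      _ = Bd := by rw [hBd]; field_simp
  -- Because x₀ = 0 the summand at t = 0 vanishes, which gives the factor L instead of L + 1.
  have h0 : ∀ a, frobSq (X 0 a) = 0 := fun a => by
    rw [hXf, state_zero]
    simp
  calc ∫ a, frobSq (sys.acEstimator K w η θ₀ Θ L a) ∂P
      ≤ ∫ a, 1 / (1 - sys.γ ^ 2) * ∑ t ∈ Finset.range (L + 1), frobSq (X t a) ∂P := by
        refine integral_mono (h.integrable_frobSq_acEstimator L)
          ((HasMoments.sum _ fun t _ => mX t).const_mul _).integrable fun a => ?_
        simp only [hX a]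
        exact frobSq_sum_smul_le _ sys.γ_pos.le sys.γ_lt_one fun t => X t a
    _ = 1 / (1 - sys.γ ^ 2) * ∑ t ∈ Finset.range L, ∫ a, frobSq (X (t + 1) a) ∂P := by
        rw [integral_const_mul, integral_finsetSum _ fun t _ => (mX t).integrable,
          Finset.sum_range_succ']
        simp [h0]
    _ ≤ 1 / (1 - sys.γ ^ 2) * ∑ _t ∈ Finset.range L, Bd := by
        gcongr with t
        exact hbd (t + 1)
    _ = _ := by simp; field_simp

end IsNoise

end LQR

/-! ### The constants and the final assembly. -/

namespace ConstParams

/-- The constant of the bias caused by the approximation of the value function. -/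
def biasConst {n : ℕ} (p : ConstParams n) : ℝ :=
  -- The bias bound multiplies this by J(K) = level/(1-γ); dividing by the level leaves just the
  -- factor 1/(1-γ).
  2 * p.normB * ‖p.cov‖ * (max 1 p.Γ ^ 2 * p.gap) / p.level

/-- The constant of the second moment of the estimator. -/
def varianceConst {n : ℕ} (d : ℕ) (p : ConstParams n) : ℝ :=
  256 * LQR.tdConst p.normS p.normR p.normK p.level (max 1 p.Γ ^ 2 * p.gap) (max 1 p.Γ) ^ 2 *
    (1 + (2 * max 1 p.Γ * p.gap) ^ 8 * LQR.innovMoment n d p.cov + stdMoment d 8 +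
      LQR.innovMoment n d p.cov)

end ConstParams

lemma norm_fin_zero_left {m : ℕ} (hm : m = 0) {k : ℕ} (X : Matrix (Fin m) (Fin k) ℝ) :
    ‖X‖ = 0 := by
  subst hm
  rw [Subsingleton.elim X 0, norm_zero]

namespace LQR

variable {n d : ℕ} {sys : LQR n d} {K : Matrix (Fin d) (Fin n) ℝ} {ρ Γ : ℝ}

/-- The assumed bound starts at k = 1, whereas the series also contain the zeroth power, of norm up
to 1; hence max 1 Γ. The spectral radius only serves to make ρ positive. -/
lemma powBound_of_hpow (hρ : sys.specRadius K < ENNReal.ofReal ρ) (hρ1 : ρ < 1)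
    (hpow : ∀ k : ℕ, 1 ≤ k → ‖sys.closedLoop K ^ k‖ ≤ Γ * ρ ^ k) :
    PowBound (sys.closedLoop K) (max 1 Γ) ρ := by
  have hρ0 : 0 < ρ := ENNReal.ofReal_pos.1 (bot_le.trans_lt hρ)
  refine ⟨hρ0.le, hρ1, fun k => ?_⟩
  rcases Nat.eq_zero_or_pos k with rfl | hk
  · rw [pow_zero, pow_zero, mul_one]
    exact l2_opNorm_one_le.trans (le_max_left _ _)
  · exact (hpow k hk).trans (mul_le_mul_of_nonneg_right (le_max_right _ _) (pow_nonneg hρ0.le k))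

/-- Source of the factor max{1, Γ⁻²} in `ConstParams.C₂`. -/
lemma sq_max_one_eq (hΓ : 0 < Γ) : max 1 Γ ^ 2 = max 1 ((Γ ^ 2)⁻¹) * Γ ^ 2 := by
  have h2 : 0 < Γ ^ 2 := by positivity
  rcases le_total 1 Γ with h | h
  · have h1 : 1 ≤ Γ ^ 2 := one_le_pow₀ h
    rw [max_eq_right h, max_eq_left (inv_le_one_of_one_le₀ h1), one_mul]
  · have h1 : Γ ^ 2 ≤ 1 := pow_le_one₀ hΓ.le h
    rw [max_eq_left h, max_eq_right ((one_le_inv₀ h2).2 h1), inv_mul_cancel₀ h2.ne', one_pow]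

namespace IsNoise

variable {Ω : Type*} [MeasurableSpace Ω] {P : Measure Ω} [IsProbabilityMeasure P]
  {w : ℕ → Ω → EuclideanSpace ℝ (Fin n)} {η : ℕ → Ω → EuclideanSpace ℝ (Fin d)}
  {θ₀ ε₀ : ℝ} {Θ : Matrix (Fin n) (Fin n) ℝ}

lemma bias_le (h : sys.IsNoise P w η) (hD : sys.noiseCov.PosDef) (hΓ : 0 < Γ)
    (hM : PowBound (sys.closedLoop K) (max 1 Γ) ρ) (hMΓ : ‖sys.closedLoop K‖ ≤ Γ)
    (hθ : sys.IsApproxValue K w η P θ₀ Θ ε₀) (L : ℕ) :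
    ‖sys.gradJ K w η P - ∫ a, sys.acEstimator K w η θ₀ Θ L a ∂P‖ ≤
      (sys.constParams K w η P Γ ρ).C₂ * sys.γ ^ (L + 1) *
          (Γ ^ 2 / ((1 - ρ ^ 2) * (1 - sys.γ))) +
        (sys.constParams K w η P Γ ρ).biasConst * Γ * sys.J K w η P * ε₀ := by
  obtain ⟨hε0, -, hε⟩ := h.approx_bound hM hθ
  have hγ := sys.γ_pos
  have hγ1 : 0 < 1 - sys.γ := by linarith [sys.γ_lt_one]
  have hρ2 : 0 < 1 - ρ ^ 2 := by linarith [hM.sq_lt_one]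
  have hs := hM.gap_nonneg
  refine (h.norm_gradJ_sub_le hM hε L).trans (add_le_add ?_ ?_)
  · set κ := max (Γ * ‖sys.B‖ * ((1 - sys.γ) * sys.J K w η P / sigmaMin sys.noiseCov))
      (‖sys.R‖ * ‖K‖) with hκ
    have h1 : sys.γ * (‖sys.B‖ * ‖sys.theta K‖ * ‖sys.closedLoop K‖) ≤
        Γ * ‖sys.B‖ * ((1 - sys.γ) * sys.J K w η P / sigmaMin sys.noiseCov) := by
      -- For n = 0 there is no positive smallest singular value, but then B has norm zero.
      rcases Nat.eq_zero_or_pos n with hn | hn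
      · rw [norm_fin_zero_left hn sys.B]; simp
      · have h2 := h.γ_mul_norm_theta_le hM hD hn
        calc _ = (sys.γ * ‖sys.theta K‖) * (‖sys.B‖ * ‖sys.closedLoop K‖) := by ring
          _ ≤ ((1 - sys.γ) * sys.J K w η P / sigmaMin sys.noiseCov) * (‖sys.B‖ * Γ) := by
              refine mul_le_mul h2 (by gcongr) (by positivity) ?_
              exact div_nonneg (h.level_nonneg hM) (sigmaMin_nonneg _)
          _ = _ := by ring
    have h3 : ‖sys.R‖ * ‖K‖ + sys.γ * (‖sys.B‖ * ‖sys.theta K‖ * ‖sys.closedLoop K‖) ≤ 2 * κ := by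
      have h4 := h1.trans (le_max_left _ (‖sys.R‖ * ‖K‖))
      have h5 : ‖sys.R‖ * ‖K‖ ≤ κ := le_max_right _ _
      linarith
    -- The 4 in `ConstParams.C₂`: one 2 from the gradient, one from bounding a sum of two terms by
    -- twice their maximum.
    calc _ ≤ 2 * (2 * κ) * (max 1 Γ ^ 2 / (1 - ρ ^ 2) * ‖sys.noiseCov‖ *
          (sys.γ ^ (L + 1) / (1 - sys.γ))) := by gcongr
      _ = _ := by
          simp only [ConstParams.C₂, constParams, ← hκ]
          rw [sq_max_one_eq hΓ]
          field_simp
          ring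
  · rcases Nat.eq_zero_or_pos d with hd | hd
    -- For d = 0 positivity of the level, needed to divide by it, is not available from tr R, but
    -- both sides vanish since B is empty.
    · have hB : ‖sys.B‖ = 0 := by
        rw [← l2_opNorm_transpose]
        exact norm_fin_zero_left hd _
      simp [ConstParams.biasConst, constParams, hB]
    · have hlev := h.level_pos hM hd
      have hJ : sys.J K w η P ≠ 0 := fun h0 => by simp [h0] at hlev
      calc _ ≤ 2 * ‖sys.B‖ * ε₀ * Γ *
            (max 1 Γ ^ 2 / (1 - ρ ^ 2) * ‖sys.noiseCov‖ / (1 - sys.γ)) := by gcongr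
        _ = _ := by
            simp only [ConstParams.biasConst, constParams]
            field_simp

lemma second_moment_le (h : sys.IsNoise P w η)
    (hM : PowBound (sys.closedLoop K) (max 1 Γ) ρ)
    (hθ : sys.IsApproxValue K w η P θ₀ Θ ε₀) (L : ℕ) :
    ∫ a, frobSq (sys.acEstimator K w η θ₀ Θ L a) ∂P ≤
      ((sys.constParams K w η P Γ ρ).varianceConst d * (1 + ε₀ ^ 2) / sys.σ ^ 2 +
          2 * ‖sys.R‖ ^ 2 * stdMoment d 6 * (sys.stationaryCov K).trace * sys.σ ^ 2) *
        (L / (1 - sys.γ ^ 2)) := by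
  have hγ2 : 0 < 1 - sys.γ ^ 2 := by nlinarith [sys.γ_pos, sys.γ_lt_one]
  have hρ1 : 0 < 1 - ρ := by linarith [hM.lt_one]
  have hρ0 := hM.nonneg
  have hρ2 : 0 < 1 - ρ ^ 2 := by linarith [hM.sq_lt_one]
  have hc := hM.const_nonneg
  -- As 1/(1-ρ) = (1+ρ)/(1-ρ²) ≤ 2/(1-ρ²), the rate enters only through `gap`.
  have hκ : max 1 Γ / (1 - ρ) ≤ 2 * max 1 Γ * (1 / (1 - ρ ^ 2)) := by
    rw [mul_one_div, div_le_div_iff₀ hρ1 hρ2]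
    nlinarith [mul_nonneg hc (mul_nonneg hρ1.le hρ1.le)]
  have hκ0 : 0 ≤ max 1 Γ / (1 - ρ) := div_nonneg hc hρ1.le
  have hi := innovMoment_nonneg (n := n) (d := d) sys.noiseCov
  refine (h.integral_frobSq_acEstimator_le hM hθ L).trans ?_
  simp only [ConstParams.varianceConst, constParams, div_eq_mul_one_div (max 1 Γ ^ 2)]
  gcongr

end IsNoise

end LQR

end

theorem lemma6p1 :
    ∃ (C₄ : ∀ n : ℕ, ConstParams n → ℝ) (C₅ : ∀ n : ℕ, ℕ → ConstParams n → ℝ) (C₆ : ℕ → ℝ → ℝ),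
      ∀ (n d : ℕ) (sys : LQR n d) (_hD : sys.noiseCov.PosDef)
        (K : Matrix (Fin d) (Fin n) ℝ) (_hK : sys.IsStable K)
        (ρ Γ : ℝ) (_hρ : sys.specRadius K < ENNReal.ofReal ρ) (_hρ1 : ρ < 1) (_hΓ : 0 < Γ)
        (_hpow : ∀ k : ℕ, 1 ≤ k → ‖sys.closedLoop K ^ k‖ ≤ Γ * ρ ^ k)
        (Ω : Type*) [MeasurableSpace Ω] (P : MeasureTheory.Measure Ω)
        [MeasureTheory.IsProbabilityMeasure P]
        (w : ℕ → Ω → EuclideanSpace ℝ (Fin n)) (η : ℕ → Ω → EuclideanSpace ℝ (Fin d))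
        (_hnoise : sys.IsNoise P w η)
        (θ₀ : ℝ) (Θ : Matrix (Fin n) (Fin n) ℝ) (ε₀ : ℝ)
        (_hθ : sys.IsApproxValue K w η P θ₀ Θ ε₀) (L : ℕ),
        DifferentiableAt ℝ (fun K' => sys.J K' w η P) K ∧
        MeasureTheory.Integrable (fun a => sys.acEstimator K w η θ₀ Θ L a) P ∧
        ‖sys.gradJ K w η P - ∫ a, sys.acEstimator K w η θ₀ Θ L a ∂P‖ ≤
          (sys.constParams K w η P Γ ρ).C₂ * sys.γ ^ (L + 1) *
              (Γ ^ 2 / ((1 - ρ ^ 2) * (1 - sys.γ))) +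
            C₄ n (sys.constParams K w η P Γ ρ) * Γ * sys.J K w η P * ε₀ ∧
        MeasureTheory.Integrable (fun a => LQR.frobSq (sys.acEstimator K w η θ₀ Θ L a)) P ∧
        ∫ a, LQR.frobSq (sys.acEstimator K w η θ₀ Θ L a) ∂P ≤
          (C₅ n d (sys.constParams K w η P Γ ρ) * (1 + ε₀ ^ 2) / sys.σ ^ 2 +
              C₆ d ‖sys.R‖ * (sys.stationaryCov K).trace * sys.σ ^ 2) *
            (L / (1 - sys.γ ^ 2)) := by
  refine ⟨fun _ p => p.biasConst, fun _ d p => p.varianceConst d,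
    fun d r => 2 * r ^ 2 * stdMoment d 6, ?_⟩
  intro n d sys hD K _ ρ Γ hρ hρ1 hΓ hpow Ω _ P _ w η hnoise θ₀ Θ ε₀ hθ L
  have hM := LQR.powBound_of_hpow hρ hρ1 hpow
  -- The first power is bounded by Γ itself, not by max 1 Γ; this is the single factor Γ in the bias
  -- bound.
  have hMΓ : ‖sys.closedLoop K‖ ≤ Γ := by
    have h1 := hpow 1 le_rfl
    rw [pow_one, pow_one] at h1
    exact h1.trans (mul_le_of_le_one_right hΓ.le hρ1.le)
  exact ⟨(hnoise.hasFDerivAt_J hM).differentiableAt, hnoise.integrable_acEstimator L,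
    hnoise.bias_le hD hΓ hM hMΓ hθ L, hnoise.integrable_frobSq_acEstimator L,
    hnoise.second_moment_le hM hθ L⟩
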